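/- Let $n\ge 0$, $X=(x_1,\dots,x_n)$, $Y=(y_1,\dots,y_n)$ and, for $m\le n$, $Y_m=(y_1,\dots,y_m)$. Let $e_k$ denote the $k$-th elementary symmetric polynomial ($e_k=0$ for $k<0$). **Partitions.** Let $\mathcal D_n$ be the set of strict partitions contained in $\rho_n=(n,n-1,\dots,1)$, i.e. of sequences $\lambda=(\lambda_1>\dots>\lambda_\ell>0)$ with $\lambda_1\le n$; put $\lambda_i=0$ for $i>\ell=\ell(\lambda)$ and $|\lambda|=\sum_i\lambda_i$. Write $\mu\subset\lambda$ if $\mu_i\le\lambda_i$ for all $i$; unions and intersections are those of the sets of parts. The dual partition $\lambda'\in\mathcal D_n$ has as its parts the elements of $\{1,\dots,n\}$ that are not parts of $\lambda$. Let $e(\lambda)=|\lambda|-\ell(\lambda)(\ell(\lambda)+1)/2$, and for $\alpha,\beta\in\mathcal D_n$ with $\alpha\cap\beta=\emptyset$ let $$e(\alpha,\beta)=\sum_{i\ge1} i\cdot\#\{\,j \mid \alpha_i>\beta_j>\alpha_{i+1}\,\}.$$ **$\widetilde Q$-polynomials.** Let $\widetilde Q_i(X)=e_i(X)$ and, for $i,j\ge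 0$, $$\widetilde Q_{i,j}(X)=\widetilde Q_i(X)\widetilde Q_j(X)+2\sum_{k=1}^{j}(-1)^k\,\widetilde Q_{i+k}(X)\,\widetilde Q_{j-k}(X).$$ For $\lambda\in\mathcal D_n$ let $\widetilde Q_\lambda(X)=\mathrm{Pfaffian}\,[\widetilde Q_{\lambda_i,\lambda_j}(X)]_{1\le i<j\le r}$, where $r$ is the least even integer with $r\ge\ell(\lambda)$. **Double Schubert polynomials.** Let $W_n$ be the group of signed permutations $w=(w(1),\dots,w(n))$, where a bar over an entry denotes a negative sign. It is generated by $s_0=(\overline1,2,\dots,n)$ and the transpositions $s_i$ of $i$ and $i+1$, $1\le i\le n-1$. Let $w_0=(\overline1,\dots,\overline n)$. On $\mathbb Z[X,Y]$ the element $s_i$ ($i\ge1$) interchanges $x_i$ and $x_{i+1}$, and $s_0$ replaces $x_1$ by $-x_1$; all other variables are fixed. Let $$\partial'_0 f=\frac{f-s_0f}{2x_1},\qquad \partial'_i f=-\frac{f-s_if}{x_i-x_{i+1}}\quad(1\le i\le n-1),$$ and $\partial'_w=\partial'_{a_1}\circ\cdots\circ\partial'_{a_r}$ for any reduced decomposition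 $w=s_{a_1}\cdots s_{a_r}$ (the operator does not depend on the decomposition). The type C double Schubert polynomial of $w\in W_n$ is $$\mathfrak C_w(X,Y)=(-1)^{n(n-1)/2}\,\partial'_{w^{-1}w_0}\Big(\prod_{i,j\ge1,\ i+j\le n}(x_i-y_j)\cdot\sum_{\mu\in\mathcal D_n}\widetilde Q_\mu(X)\,\widetilde Q_{\mu'}(Y)\Big).$$ For $\lambda\in\mathcal D_n$ with $\ell=\ell(\lambda)$ and $k=n-\ell=\ell(\lambda')$ let $w_\lambda=(\overline{\lambda}_1,\dots,\overline{\lambda}_\ell,\lambda'_k,\dots,\lambda'_1)$ and $\mathfrak C_\lambda=\mathfrak C_{w_\lambda}$. **Theorem.** For every strict partition $\lambda\in\mathcal D_n$, $$\mathfrak C_\lambda(X,Y)=(-1)^{e(\lambda)+|\lambda'|}\sum_{\alpha}\widetilde Q_\alpha(X)\sum_{\beta}(-1)^{e(\alpha,\beta)+|\beta|}\,\widetilde Q_{(\alpha\cup\beta)'}(Y)\,\det\big(e_{\beta_i-\lambda'_j}(Y_{n-\lambda'_j})\big)_{1\le i,j\le \ell(\lambda')},$$ where the first sum is over all $\alpha\in\mathcal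 D_n$ and the second over all $\beta\in\mathcal D_n$ with $\beta\supset\lambda'$, $\ell(\beta)=\ell(\lambda')$ and $\alpha\cap\beta=\emptyset$. -/

import Mathlib

namespace DoubleSchubert

/-! ### Strict partitions

A strict partition is identified with the finite set of its (nonzero, pairwise different) parts,
so `ℓ(λ)` is `λ.card`, `|λ|` is `∑ p ∈ λ, p`, and unions, intersections and differences of
strict partitions are those of the sets of parts. -/

/-- The strict partitions contained in `ρ_n = (n, n-1, …, 1)`: all parts lie in `{1, …, n}`. -/
def strictPartitions (n : ℕ) : Finset (Finset ℕ) := (Finset.Icc 1 n).powerset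

/-- The `i`-th largest part, with `i` counted from `0`; it is `0` for `i ≥ ℓ(λ)`. -/
def part (lam : Finset ℕ) (i : ℕ) : ℕ := (lam.sort (· ≥ ·)).getD i 0

/-- Containment `μ ⊂ λ` of Young diagrams. -/
def DiagramLE (mu lam : Finset ℕ) : Prop := ∀ i, part mu i ≤ part lam i

noncomputable instance : DecidableRel DiagramLE := fun _ _ => Classical.propDecidable _

/-- The weight `|λ|`. -/
def weight (lam : Finset ℕ) : ℕ := ∑ p ∈ lam, p

/-- The dual partition `λ' = ρ_n ∖ λ`. -/
def dual (n : ℕ) (lam : Finset ℕ) : Finset ℕ := Finset.Icc 1 n \ lam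

/-- The excess `e(λ) = |λ| - (1 + ⋯ + ℓ(λ))`; the subtraction never truncates on a set of
positive integers. -/
def excess (lam : Finset ℕ) : ℕ := weight lam - ∑ i ∈ Finset.range lam.card, (i + 1)

/-- `m_i(α, β) = #{j | α_i > β_j > α_{i+1}}`, with `i` counted from `0`. -/
def interlace (al be : Finset ℕ) (i : ℕ) : ℕ :=
  (be.filter fun b => b < part al i ∧ part al (i + 1) < b).card

/-- The intertwining number `e(α, β) = ∑_{i ≥ 1} i m_i(α, β)`; the terms with `i > ℓ(α)` vanish. -/
def intertwining (al be : Finset ℕ) : ℕ :=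
  ∑ i ∈ Finset.range al.card, (i + 1) * interlace al be i

/-! ### Symmetric polynomials -/

/-- The Pfaffian of the skew-symmetric `2m × 2m` matrix whose entries above the diagonal are
`A i j`, `i < j`, by expansion along the first row. Only entries with `i < j` are used. -/
def pfaffian {R : Type*} [CommRing R] : (m : ℕ) → (Fin (2 * m) → Fin (2 * m) → R) → R
  | 0, _ => 1
  | m + 1, A => ∑ j : Fin (2 * m + 1),
      (-1) ^ (j : ℕ) * A 0 j.succ *
        pfaffian m fun a b => A (j.succAbove a).succ (j.succAbove b).succ

/-- `Q̃_{i,j} = Q̃_i Q̃_j + 2 ∑_{k=1}^{j} (-1)^k Q̃_{i+k} Q̃_{j-k}` where `Q̃_i = e_i(x_1, …, x_n)`. -/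
noncomputable def qTilde₂ (n i j : ℕ) : MvPolynomial (Fin n) ℤ :=
  MvPolynomial.esymm (Fin n) ℤ i * MvPolynomial.esymm (Fin n) ℤ j +
    2 * ∑ k ∈ Finset.Icc 1 j, (-1) ^ k *
      (MvPolynomial.esymm (Fin n) ℤ (i + k) * MvPolynomial.esymm (Fin n) ℤ (j - k))

/-- The polynomial `Q̃_λ` in `n` variables: the Pfaffian of size `ℓ(λ)` or `ℓ(λ) + 1`, whichever
is even. -/
noncomputable def qTilde (n : ℕ) (lam : Finset ℕ) : MvPolynomial (Fin n) ℤ :=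
  pfaffian ((lam.card + 1) / 2) fun i j => qTilde₂ n (part lam i) (part lam j)

/-- The elementary symmetric polynomial `e_d(y_1, …, y_m)` of the first `m` of `n` variables
(`m ≤ n`), for an integer `d`; it is `0` for `d < 0`. -/
noncomputable def elemSymm (n m : ℕ) (d : ℤ) : MvPolynomial (Fin n) ℤ :=
  if 0 ≤ d then
    ∑ S ∈ (Finset.univ.filter fun i : Fin n => (i : ℕ) < m).powersetCard d.toNat,
      ∏ i ∈ S, MvPolynomial.X i
  else 0

/-- The determinant `det (e_{β_i - μ_j}(Y_{n - μ_j}))`, `1 ≤ i, j ≤ ℓ(μ)`. -/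
noncomputable def schurDet (n : ℕ) (be mu : Finset ℕ) : MvPolynomial (Fin n) ℤ :=
  (Matrix.of fun i j : Fin mu.card =>
    elemSymm n (n - part mu j) ((part be i : ℤ) - (part mu j : ℤ))).det

/-! ### The hyperoctahedral group -/

/-- A signed permutation of `n` letters: the barred word whose `i`-th entry is `perm i`, barred
if and only if `sign i = -1`. It is the map `i ↦ sign i * perm i`, `-i ↦ -(sign i * perm i)`. -/
@[ext] structure SignedPerm (n : ℕ) where
  perm : Equiv.Perm (Fin n)
  sign : Fin n → ℤˣ

namespace SignedPerm

variable {n : ℕ}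

instance : One (SignedPerm n) := ⟨⟨1, 1⟩⟩

/-- Composition of signed permutations as maps, `(u * v) i = u (v i)`. -/
instance : Mul (SignedPerm n) :=
  ⟨fun u v => ⟨u.perm * v.perm, fun i => v.sign i * u.sign (v.perm i)⟩⟩

instance : Inv (SignedPerm n) := ⟨fun u => ⟨u.perm⁻¹, fun i => u.sign (u.perm⁻¹ i)⟩⟩

@[simp] theorem one_perm : (1 : SignedPerm n).perm = 1 := rfl
@[simp] theorem one_sign (i : Fin n) : (1 : SignedPerm n).sign i = 1 := rfl
@[simp] theorem mul_perm (u v : SignedPerm n) : (u * v).perm = u.perm * v.perm := rfl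
@[simp] theorem mul_sign (u v : SignedPerm n) (i : Fin n) :
    (u * v).sign i = v.sign i * u.sign (v.perm i) := rfl
@[simp] theorem inv_perm (u : SignedPerm n) : (u⁻¹).perm = u.perm⁻¹ := rfl
@[simp] theorem inv_sign (u : SignedPerm n) (i : Fin n) :
    (u⁻¹).sign i = u.sign (u.perm⁻¹ i) := rfl

instance : Group (SignedPerm n) :=
  Group.ofLeftAxioms
    (fun a b c => by ext i <;> simp [mul_assoc])
    (fun a => by ext i <;> simp)
    (fun a => by ext i <;> simp)

/-- The generators: `simple 0` is `s_0`, which bars the first entry, and `simple i` for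
`1 ≤ i ≤ n - 1` is the transposition `s_i` of the `i`-th and `(i+1)`-st letters
(letters `i - 1` and `i` of `Fin n`). -/
def simple (i : Fin n) : SignedPerm n :=
  if (i : ℕ) = 0 then ⟨1, fun j => if j = i then -1 else 1⟩
  else ⟨Equiv.swap ⟨(i : ℕ) - 1, by omega⟩ i, 1⟩

/-- The product `s_{a_1} ⋯ s_{a_r}`. -/
def wordProd (a : List (Fin n)) : SignedPerm n := (a.map simple).prod

/-- `w = s_{a_1} ⋯ s_{a_r}` is a reduced decomposition, that is, one with the least number of
factors. -/
def IsReducedWord (a : List (Fin n)) (w : SignedPerm n) : Prop :=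
  wordProd a = w ∧ ∀ b : List (Fin n), wordProd b = w → a.length ≤ b.length

/-- The longest element `w_0`, which bars every letter. -/
def longest (n : ℕ) : SignedPerm n := ⟨1, fun _ => -1⟩

/-- Permutations as signed permutations without bars. -/
def ofPerm : Equiv.Perm (Fin n) →* SignedPerm n where
  toFun p := ⟨p, 1⟩
  map_one' := rfl
  map_mul' p q := by ext i <;> simp

/-- Changes of signs as signed permutations. -/
def ofSign : (Fin n → ℤˣ) →* SignedPerm n where
  toFun e := ⟨1, e⟩
  map_one' := rfl
  map_mul' e f := by ext i <;> simp [mul_comm]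

theorem ofPerm_mem_closure (p : Equiv.Perm (Fin n)) :
    ofPerm p ∈ Submonoid.closure (Set.range (simple (n := n))) := by
  cases n with
  | zero =>
    rw [Subsingleton.elim p 1, map_one]
    exact one_mem _
  | succ m =>
    have h : Submonoid.closure (Set.range fun i : Fin m => Equiv.swap i.castSucc i.succ) ≤
        (Submonoid.closure (Set.range (simple (n := m + 1)))).comap ofPerm := by
      rw [Submonoid.closure_le]
      rintro _ ⟨j, rfl⟩
      refine Submonoid.subset_closure ⟨j.succ, ?_⟩
      simp only [simple, Fin.val_succ, Nat.add_one_ne_zero, if_false]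
      rfl
    rw [Equiv.Perm.mclosure_swap_castSucc_succ] at h
    exact h (Submonoid.mem_top p)

theorem ofSign_mem_closure (e : Fin n → ℤˣ) :
    ofSign e ∈ Submonoid.closure (Set.range (simple (n := n))) := by
  suffices h : e ∈ (Submonoid.closure (Set.range (simple (n := n)))).comap ofSign from h
  rw [← Finset.univ_prod_mulSingle e]
  refine Submonoid.prod_mem _ fun i _ => ?_
  rcases Int.units_eq_one_or (e i) with h | h
  · rw [h, Pi.mulSingle_one]
    exact one_mem _
  · rw [h]
    let z : Fin n := ⟨0, i.pos⟩
    have key : ofSign (Pi.mulSingle i (-1)) =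
        ofPerm (Equiv.swap z i) * simple z * ofPerm (Equiv.swap z i) := by
      have hz : (simple z : SignedPerm n) = ⟨1, fun j => if j = z then -1 else 1⟩ := by
        simp [simple, z]
      rw [hz]
      ext j
      · simp [ofSign, ofPerm]
      · have : Equiv.swap z i j = z ↔ j = i := by
          rw [Equiv.swap_apply_eq_iff, Equiv.swap_apply_left]
        simp [ofSign, ofPerm, this, Pi.mulSingle_apply]
    rw [Submonoid.mem_comap, key]
    exact mul_mem (mul_mem (ofPerm_mem_closure _) (Submonoid.subset_closure ⟨z, rfl⟩))
      (ofPerm_mem_closure _)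

theorem wordProd_surjective (w : SignedPerm n) : ∃ a : List (Fin n), wordProd a = w := by
  have hw : w = ofPerm w.perm * ofSign w.sign := by
    ext i <;> simp [ofPerm, ofSign]
  have hm : w ∈ Submonoid.closure (Set.range (simple (n := n))) := by
    rw [hw]
    exact mul_mem (ofPerm_mem_closure _) (ofSign_mem_closure _)
  induction hm using Submonoid.closure_induction with
  | mem x hx =>
    obtain ⟨i, rfl⟩ := hx
    exact ⟨[i], by simp [wordProd]⟩
  | one => exact ⟨[], rfl⟩
  | mul x y _ _ hx hy =>
    obtain ⟨a, rfl⟩ := hx (by ext i <;> simp [ofPerm, ofSign])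
    obtain ⟨b, rfl⟩ := hy (by ext i <;> simp [ofPerm, ofSign])
    exact ⟨a ++ b, by simp [wordProd]⟩

theorem exists_isReducedWord (w : SignedPerm n) : ∃ a : List (Fin n), IsReducedWord a w := by
  classical
  have h : ∃ r, ∃ a : List (Fin n), wordProd a = w ∧ a.length = r := by
    obtain ⟨a, ha⟩ := wordProd_surjective w
    exact ⟨_, a, ha, rfl⟩
  obtain ⟨a, ha, hl⟩ := Nat.find_spec h
  exact ⟨a, ha, fun b hb => hl ▸ Nat.find_min' h ⟨b, hb, rfl⟩⟩

end SignedPerm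

/-- The barred word `(λ_1, …, λ_ℓ, λ'_k, …, λ'_1)` without its bars. -/
def grassWord (n : ℕ) (lam : Finset ℕ) : List ℕ :=
  lam.sort (· ≥ ·) ++ (dual n lam).sort (· ≤ ·)

theorem grassWord_length {n : ℕ} {lam : Finset ℕ} (h : lam ∈ strictPartitions n) :
    (grassWord n lam).length = n := by
  have h' : lam ⊆ Finset.Icc 1 n := Finset.mem_powerset.mp h
  have := Finset.card_sdiff_add_card_eq_card h'
  simp only [Nat.card_Icc] at this
  simp only [grassWord, dual, List.length_append, Finset.length_sort]
  omega

theorem grassWord_nodup (n : ℕ) (lam : Finset ℕ) : (grassWord n lam).Nodup := by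
  refine List.Nodup.append (Finset.sort_nodup _ _) (Finset.sort_nodup _ _) ?_
  intro a ha hb
  simp [dual] at ha hb
  exact hb.2 ha

theorem mem_grassWord {n : ℕ} {lam : Finset ℕ} (h : lam ∈ strictPartitions n) {a : ℕ}
    (ha : a ∈ grassWord n lam) : 1 ≤ a ∧ a ≤ n := by
  have h' : lam ⊆ Finset.Icc 1 n := Finset.mem_powerset.mp h
  simp only [grassWord, dual, List.mem_append, Finset.mem_sort, Finset.mem_sdiff] at ha
  rcases ha with ha | ha
  · exact Finset.mem_Icc.mp (h' ha)
  · exact Finset.mem_Icc.mp ha.1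

/-- The `i`-th entry of the word, as an element of `Fin n` (the letter `p` is `p - 1`). -/
def grassFun {n : ℕ} (lam : Finset ℕ) (h : lam ∈ strictPartitions n) (i : Fin n) : Fin n :=
  ⟨(grassWord n lam)[(i : ℕ)]'(by rw [grassWord_length h]; exact i.2) - 1, by
    have := mem_grassWord h (List.getElem_mem
      (show (i : ℕ) < (grassWord n lam).length by rw [grassWord_length h]; exact i.2))
    omega⟩

theorem grassFun_injective {n : ℕ} (lam : Finset ℕ) (h : lam ∈ strictPartitions n) :
    Function.Injective (grassFun lam h) := by
  intro i j hij
  have hi : (i : ℕ) < (grassWord n lam).length := by rw [grassWord_length h]; exact i.2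
  have hj : (j : ℕ) < (grassWord n lam).length := by rw [grassWord_length h]; exact j.2
  have h1 := mem_grassWord h (List.getElem_mem hi)
  have h2 := mem_grassWord h (List.getElem_mem hj)
  have h3 : (grassWord n lam)[(i : ℕ)] - 1 = (grassWord n lam)[(j : ℕ)] - 1 :=
    congrArg Fin.val hij
  have h4 : (grassWord n lam)[(i : ℕ)] = (grassWord n lam)[(j : ℕ)] := by omega
  exact Fin.ext (((grassWord_nodup n lam).getElem_inj_iff).mp h4)

/-- The maximal Grassmannian element `w_λ = (λ̄_1, …, λ̄_ℓ, λ'_k, …, λ'_1)`. -/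
noncomputable def grassElt {n : ℕ} (lam : Finset ℕ) (h : lam ∈ strictPartitions n) :
    SignedPerm n where
  perm := Equiv.ofBijective (grassFun lam h)
    (Finite.injective_iff_bijective.mp (grassFun_injective lam h))
  sign i := if (i : ℕ) < lam.card then -1 else 1

/-! ### Divided differences -/

section DividedDifferences

variable {n : ℕ} {A : Type*} [CommRing A]

/-- A signed permutation acts on `A[X]` by `x_j ↦ ± x_{w(j)}`, the sign being that of `w(j)`.
Thus `s_i` interchanges `x_i` and `x_{i+1}`, and `s_0` replaces `x_1` by `-x_1`. -/
noncomputable def act (w : SignedPerm n) :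
    MvPolynomial (Fin n) A →ₐ[A] MvPolynomial (Fin n) A :=
  MvPolynomial.aeval fun j =>
    (((w.sign j : ℤˣ) : ℤ) : MvPolynomial (Fin n) A) * MvPolynomial.X (w.perm j)

/-- The denominators of the divided differences: `2 x_1` for `i = 0` and `x_i - x_{i+1}` for
`1 ≤ i ≤ n - 1`. -/
noncomputable def denom (A : Type*) [CommRing A] (i : Fin n) : MvPolynomial (Fin n) A :=
  if (i : ℕ) = 0 then 2 * MvPolynomial.X i
  else MvPolynomial.X ⟨(i : ℕ) - 1, by omega⟩ - MvPolynomial.X i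

theorem denom_dvd_sub_act (i : Fin n) (f : MvPolynomial (Fin n) A) :
    denom A i ∣ f - act (SignedPerm.simple i) f := by
  have hX : ∀ k : Fin n, denom A i ∣
      MvPolynomial.X k - act (A := A) (SignedPerm.simple i) (MvPolynomial.X k) := by
    intro k
    by_cases h0 : (i : ℕ) = 0
    · by_cases hk : k = i
      · subst hk
        simp [act, denom, SignedPerm.simple, h0, two_mul]
      · simp [act, denom, SignedPerm.simple, h0, hk]
    · by_cases hk : k = i
      · subst hk
        simp only [act, denom, SignedPerm.simple, h0, if_false, MvPolynomial.aeval_X,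
          Equiv.swap_apply_right, Pi.one_apply, Units.val_one, Int.cast_one, one_mul]
        exact (dvd_sub_comm).mp dvd_rfl
      · by_cases hk' : k = ⟨(i : ℕ) - 1, by omega⟩
        · subst hk'
          simp [act, denom, SignedPerm.simple, h0]
        · simp [act, denom, SignedPerm.simple, h0, Equiv.swap_apply_of_ne_of_ne hk' hk]
  induction f using MvPolynomial.induction_on with
  | C a => simp [act]
  | add p q hp hq =>
    rw [map_add, add_sub_add_comm]
    exact dvd_add hp hq
  | mul_X p k hp =>
    rw [map_mul]
    have : p * MvPolynomial.X k -
        act (SignedPerm.simple i) p * act (SignedPerm.simple i) (MvPolynomial.X k) =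
        (p - act (SignedPerm.simple i) p) * MvPolynomial.X k +
        act (SignedPerm.simple i) p *
          (MvPolynomial.X k - act (SignedPerm.simple i) (MvPolynomial.X k)) := by ring
    rw [this]
    exact dvd_add (Dvd.dvd.mul_right hp _) (Dvd.dvd.mul_left (hX k) _)

/-- The divided difference `∂_i f = (f - s_i f) / (x_i - x_{i+1})` for `i ≥ 1` and
`∂_0 f = (f - s_0 f) / (2 x_1)`. The quotient is unique when `2` is not a zero divisor in `A`. -/
noncomputable def dividedDiff (i : Fin n) (f : MvPolynomial (Fin n) A) :
    MvPolynomial (Fin n) A :=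
  Classical.choose (denom_dvd_sub_act i f)

theorem denom_mul_dividedDiff (i : Fin n) (f : MvPolynomial (Fin n) A) :
    denom A i * dividedDiff i f = f - act (SignedPerm.simple i) f :=
  (Classical.choose_spec (denom_dvd_sub_act i f)).symm

/-- `∂'_0 = ∂_0` and `∂'_i = -∂_i` for `i ≥ 1`. -/
noncomputable def dividedDiff' (i : Fin n) (f : MvPolynomial (Fin n) A) :
    MvPolynomial (Fin n) A :=
  if (i : ℕ) = 0 then dividedDiff i f else -dividedDiff i f

/-- The composite `∂'_{a_1} ∘ ⋯ ∘ ∂'_{a_r}`. -/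
noncomputable def wordOp (a : List (Fin n)) (f : MvPolynomial (Fin n) A) :
    MvPolynomial (Fin n) A :=
  a.foldr dividedDiff' f

/-- The operator `∂'_w = ∂'_{a_1} ∘ ⋯ ∘ ∂'_{a_r}` for a reduced decomposition
`w = s_{a_1} ⋯ s_{a_r}`. The operator does not depend on the decomposition, since the `∂'_i`
satisfy the Coxeter relations of the `s_i`; an unspecified one is used. -/
noncomputable def weylOp (w : SignedPerm n) (f : MvPolynomial (Fin n) A) :
    MvPolynomial (Fin n) A :=
  wordOp (Classical.choose (SignedPerm.exists_isReducedWord w)) f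

end DividedDifferences

/-! ### Type C double Schubert polynomials -/

/-- The ring `ℤ[X, Y] = A[X]` with `A = ℤ[Y]`. -/
abbrev PolyXY (n : ℕ) : Type := MvPolynomial (Fin n) (MvPolynomial (Fin n) ℤ)

/-- `f(X)`, as an element of `ℤ[X, Y]`. -/
noncomputable def inX {n : ℕ} (f : MvPolynomial (Fin n) ℤ) : PolyXY n :=
  MvPolynomial.map MvPolynomial.C f

/-- `f(Y)`, as an element of `ℤ[X, Y]`. -/
noncomputable def inY {n : ℕ} (f : MvPolynomial (Fin n) ℤ) : PolyXY n := MvPolynomial.C f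

/-- `Δ(X, Y) = ∏_{i + j ≤ n} (x_i - y_j)`, `i, j ≥ 1` (the indices in `Fin n` start from `0`). -/
noncomputable def deltaXY (n : ℕ) : PolyXY n :=
  ∏ p ∈ Finset.univ.filter
      fun p : Fin n × Fin n => ((p.1 : ℕ) + 1) + ((p.2 : ℕ) + 1) ≤ n,
    (inX (MvPolynomial.X p.1) - inY (MvPolynomial.X p.2))

/-- The reproducing kernel `Q̃(X, Y) = ∑_λ Q̃_λ(X) Q̃_{λ'}(Y)`. -/
noncomputable def qKernel (n : ℕ) : PolyXY n :=
  ∑ lam ∈ strictPartitions n, inX (qTilde n lam) * inY (qTilde n (dual n lam))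

/-- The type C double Schubert polynomial
`ℭ_w(X, Y) = (-1)^{n(n-1)/2} ∂'_{w⁻¹ w_0} (Δ(X, Y) Q̃(X, Y))`. -/
noncomputable def typeC {n : ℕ} (w : SignedPerm n) : PolyXY n :=
  (-1) ^ (n * (n - 1) / 2) * weylOp (w⁻¹ * SignedPerm.longest n) (deltaXY n * qKernel n)

end DoubleSchubert

open DoubleSchubert

/-!
The operators `∂'_i` satisfy the braid relations of type C, so `∂'_w` may be computed from any
reduced word (`wordOp_eq_of_wordProd_eq`). For `w_λ⁻¹ w_0` there is one adapted to the formula: with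
`μ = λ'`, `k = ℓ(μ)` and `T = ∂'_{n-1} ⋯ ∂'_1 ∂'_0`, it gives the operator `T^k ∘ S`, where `S` is a
product of `∂'_i` with `i ≥ 1` (`weylOp_grassElt`).

* The kernel `∑_α Q̃_α(X) Q̃_{α'}(Y)` is symmetric in `X`, so `S` acts on `Δ(X, Y)` alone. There it
  deletes, for each part of `λ`, the largest remaining exponent of the staircase; up to sign,
  `∏_i P_{n-m_i}(x_i)` is left, where `m_1 < ⋯ < m_k` are the parts of `μ` and
  `P_m(t) = (t - y_1) ⋯ (t - y_m)` (`sortOp_deltaXY`).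
* Moving a `T` past a polynomial in `x_{j+1}` turns it into the same polynomial in `x_j`, up to an
  error of small degree in `x` that the remaining powers of `T` annihilate. So `T^k` applied to
  `∏_i P_{n-m_i}(x_i) f`, with `f` symmetric, is the composite of the operators
  `f ↦ T(P_{n-m_i}(x_1) f)` (`fullChain_pow_succ_mul`).
* The operator `f ↦ T(x_1^{n-b} f)` removes the part `b` from `Q̃_α`, with a sign, and is `0` if `b`
  is not a part (`fullChain_pow_mul_qPoly`). Indeed, `s_0` changes the matrix
  `(Q̃_{α_i, α_j})` by a skew-symmetric matrix of rank two, so that `∂'_0 Q̃_α` is a sum over the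
  ways to remove one part, weighted by polynomials `e_j(x_2, …, x_n)` (`map_pfaffianOn`), and
  `∂'_{n-1} ⋯ ∂'_1` picks out one of these weights (`chain_pow_mul_esymmTail`).
* Expanding `P_{n-m}` in powers, `f ↦ T(P_{n-m}(x_1) f)` acts on the coefficients of a combination
  of the `Q̃_α` by adding a part `b` to `α`, with weight `± e_{b-m}(Y_{n-m})`. Iterating over the
  parts of `μ` is the Laplace expansion of `det (e_{β_i-μ_j}(Y_{n-μ_j}))`, and the signs accumulate
  to `(-1)^{e(α, β)}` because `e(α, β)` counts the pairs of a part of `α` and a smaller part of `β`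
  (`coeffStep_coeffIter`, `intertwining_eq_sum`).
-/

namespace DoubleSchubert

open MvPolynomial

/-! ### Divided differences as linear operators -/

section Operators

variable {n : ℕ} {A : Type*} [CommRing A]

/-- The variable `x_{i+1}`, with the convention that it is `0` for `i ≥ n`. -/
noncomputable def xvar (n : ℕ) (A : Type*) [CommRing A] (i : ℕ) : MvPolynomial (Fin n) A :=
  if h : i < n then X ⟨i, h⟩ else 0

/-- The action of the generator `s_i`, extended by the identity to `i ≥ n`. -/
noncomputable def refl (n : ℕ) (A : Type*) [CommRing A] (i : ℕ) :
    MvPolynomial (Fin n) A →ₐ[A] MvPolynomial (Fin n) A :=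
  if h : i < n then act (SignedPerm.simple ⟨i, h⟩) else AlgHom.id A _

/-- The denominator of `∂'_i`: this is `2 x_1` for `i = 0`, and `x_{i+1} - x_i` for `i ≥ 1`, the
sign in the definition of `∂'_i` being absorbed. -/
noncomputable def root (n : ℕ) (A : Type*) [CommRing A] (i : ℕ) : MvPolynomial (Fin n) A :=
  if i = 0 then 2 * xvar n A 0 else xvar n A i - xvar n A (i - 1)

theorem refl_of_le {i : ℕ} (hi : n ≤ i) (f : MvPolynomial (Fin n) A) : refl n A i f = f := by
  simp [refl, not_lt.mpr hi]

theorem xvar_of_lt {i : ℕ} (hi : i < n) : xvar n A i = X ⟨i, hi⟩ := by simp [xvar, hi]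

theorem refl_zero_xvar_zero : refl n A 0 (xvar n A 0) = -xvar n A 0 := by
  by_cases h : 0 < n
  · simp [refl, xvar, h, act, SignedPerm.simple]
  · simp [xvar, h]

theorem refl_succ_xvar {i : ℕ} (hi : i + 1 < n) :
    refl n A (i + 1) (xvar n A i) = xvar n A (i + 1) := by
  have h : i < n := by omega
  simp [refl, xvar, h, hi, act, SignedPerm.simple]

theorem refl_succ_xvar_succ {i : ℕ} (hi : i + 1 < n) :
    refl n A (i + 1) (xvar n A (i + 1)) = xvar n A i := by
  have h : i < n := by omega
  simp [refl, xvar, h, hi, act, SignedPerm.simple]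

theorem refl_xvar_of_ne {i j : ℕ} (h1 : j ≠ i) (h2 : j + 1 ≠ i) :
    refl n A i (xvar n A j) = xvar n A j := by
  by_cases hi : i < n
  swap
  · exact refl_of_le (not_lt.mp hi) _
  by_cases hj : j < n
  swap
  · simp [xvar, hj]
  by_cases h0 : i = 0
  · subst h0
    simp [refl, xvar, hi, hj, act, SignedPerm.simple, h1]
  · simp only [refl, hi, hj, xvar, dite_true, act, SignedPerm.simple, h0, if_false, aeval_X,
      Pi.one_apply, Units.val_one, Int.cast_one, one_mul]
    rw [Equiv.swap_apply_of_ne_of_ne]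
    · simp only [ne_eq, Fin.mk.injEq]; omega
    · simp only [ne_eq, Fin.mk.injEq]; omega

theorem algHom_ext_xvar {f g : MvPolynomial (Fin n) A →ₐ[A] MvPolynomial (Fin n) A}
    (h : ∀ i < n, f (xvar n A i) = g (xvar n A i)) : f = g := by
  refine MvPolynomial.algHom_ext fun j => ?_
  have := h j j.2
  rwa [xvar_of_lt j.2] at this

theorem refl_refl (i : ℕ) (f : MvPolynomial (Fin n) A) : refl n A i (refl n A i f) = f := by
  have h : (refl n A i).comp (refl n A i) = AlgHom.id A _ := by
    refine algHom_ext_xvar fun j hj => ?_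
    rw [AlgHom.comp_apply, AlgHom.id_apply]
    rcases Nat.lt_or_ge i n with hi | hi
    · by_cases h1 : j = i
      · subst h1
        rcases j with _ | j
        · simp [refl_zero_xvar_zero]
        · rw [refl_succ_xvar_succ hi, refl_succ_xvar hi]
      · by_cases h2 : j + 1 = i
        · subst h2
          rw [refl_succ_xvar hi, refl_succ_xvar_succ hi]
        · simp only [refl_xvar_of_ne h1 h2]
    · simp [refl_of_le hi]
  exact DFunLike.congr_fun h f

theorem root_mul_dividedDiff' {i : ℕ} (hi : i < n) (f : MvPolynomial (Fin n) A) :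
    root n A i * dividedDiff' ⟨i, hi⟩ f = f - refl n A i f := by
  have h := denom_mul_dividedDiff ⟨i, hi⟩ f
  simp only [refl, hi, dite_true]
  rw [← h]
  by_cases h0 : i = 0
  · subst h0
    simp [root, dividedDiff', denom, xvar_of_lt hi]
  · have h1 : i - 1 < n := by omega
    simp [root, dividedDiff', denom, h0, xvar_of_lt hi, xvar_of_lt h1]
    ring

theorem refl_root {i : ℕ} (hi : i < n) : refl n A i (root n A i) = -root n A i := by
  rcases i with _ | i
  · simp only [root, if_true, map_mul, map_ofNat, refl_zero_xvar_zero]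
    ring
  · simp [root, refl_succ_xvar hi, refl_succ_xvar_succ hi]

theorem refl_root_of_add_two_le {i j : ℕ} (h : i + 2 ≤ j ∨ j + 2 ≤ i) :
    refl n A i (root n A j) = root n A j := by
  rcases j with _ | j
  · simp only [root, if_true, map_mul, map_ofNat]
    rw [refl_xvar_of_ne (by omega) (by omega)]
  · simp only [root, Nat.add_one_ne_zero, if_false, map_sub, Nat.add_sub_cancel]
    rw [refl_xvar_of_ne (by omega) (by omega), refl_xvar_of_ne (by omega) (by omega)]

theorem refl_comm {i j : ℕ} (h : i + 2 ≤ j ∨ j + 2 ≤ i) (f : MvPolynomial (Fin n) A) :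
    refl n A i (refl n A j f) = refl n A j (refl n A i f) := by
  wlog hij : i + 2 ≤ j generalizing i j
  · exact (this h.symm (by omega)).symm
  rcases Nat.lt_or_ge j n with hj | hj
  swap
  · simp [refl_of_le hj]
  have e : (refl n A i).comp (refl n A j) = (refl n A j).comp (refl n A i) := by
    refine algHom_ext_xvar fun a ha => ?_
    simp only [AlgHom.comp_apply]
    obtain ⟨j, rfl⟩ : ∃ j', j = j' + 1 := ⟨j - 1, by omega⟩
    by_cases h1 : a = j + 1
    · subst h1
      rw [refl_succ_xvar_succ hj, refl_xvar_of_ne (i := i) (by omega) (by omega),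
        refl_xvar_of_ne (i := i) (by omega) (by omega), refl_succ_xvar_succ hj]
    by_cases h2 : a = j
    · subst h2
      rw [refl_succ_xvar hj, refl_xvar_of_ne (i := i) (by omega) (by omega),
        refl_xvar_of_ne (i := i) (by omega) (by omega), refl_succ_xvar hj]
    rw [refl_xvar_of_ne (i := j + 1) h1 (by omega)]
    by_cases h3 : a = i
    · subst h3
      rcases a with _ | a
      · rw [refl_zero_xvar_zero, map_neg, refl_xvar_of_ne (by omega) (by omega)]
      · rw [refl_succ_xvar_succ (by omega), refl_xvar_of_ne (by omega) (by omega)]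
    by_cases h4 : a + 1 = i
    · subst h4
      rw [refl_succ_xvar (by omega), refl_xvar_of_ne (by omega) (by omega)]
    rw [refl_xvar_of_ne h3 h4, refl_xvar_of_ne h1 (by omega)]
  exact DFunLike.congr_fun e f

theorem refl_braid_three {i : ℕ} (hi : 1 ≤ i) (f : MvPolynomial (Fin n) A) (hn : i + 1 < n) :
    refl n A i (refl n A (i + 1) (refl n A i f)) =
      refl n A (i + 1) (refl n A i (refl n A (i + 1) f)) := by
  obtain ⟨i, rfl⟩ : ∃ j, i = j + 1 := ⟨i - 1, by omega⟩
  have e : (refl n A (i + 1)).comp ((refl n A (i + 1 + 1)).comp (refl n A (i + 1))) =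
      (refl n A (i + 1 + 1)).comp ((refl n A (i + 1)).comp (refl n A (i + 1 + 1))) := by
    refine algHom_ext_xvar fun a ha => ?_
    simp only [AlgHom.comp_apply]
    have a1 := refl_succ_xvar (A := A) hn
    have a2 := refl_succ_xvar_succ (A := A) hn
    have a3 := refl_succ_xvar (A := A) (show i + 1 < n by omega)
    have a4 := refl_succ_xvar_succ (A := A) (show i + 1 < n by omega)
    have a5 := refl_xvar_of_ne (n := n) (A := A) (i := i + 1) (j := i + 1 + 1) (by omega) (by omega)
    have a6 := refl_xvar_of_ne (n := n) (A := A) (i := i + 1 + 1) (j := i) (by omega) (by omega)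
    by_cases h1 : a = i
    · subst h1; simp only [a1, a3, a5, a6]
    by_cases h2 : a = i + 1
    · subst h2; simp only [a1, a2, a3, a4, a5, a6]
    by_cases h3 : a = i + 1 + 1
    · subst h3; simp only [a2, a4, a5, a6]
    have a7 := refl_xvar_of_ne (n := n) (A := A) (i := i + 1) (j := a) (by omega) (by omega)
    have a8 := refl_xvar_of_ne (n := n) (A := A) (i := i + 1 + 1) (j := a) (by omega) (by omega)
    simp only [a7, a8]
  exact DFunLike.congr_fun e f

theorem refl_zero_xvar_one : refl n A 0 (xvar n A 1) = xvar n A 1 :=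
  refl_xvar_of_ne (by omega) (by omega)

theorem refl_braid_four (hn : 1 < n) (f : MvPolynomial (Fin n) A) :
    refl n A 0 (refl n A 1 (refl n A 0 (refl n A 1 f))) =
      refl n A 1 (refl n A 0 (refl n A 1 (refl n A 0 f))) := by
  have e : (refl n A 0).comp ((refl n A 1).comp ((refl n A 0).comp (refl n A 1))) =
      (refl n A 1).comp ((refl n A 0).comp ((refl n A 1).comp (refl n A 0))) := by
    refine algHom_ext_xvar fun a ha => ?_
    simp only [AlgHom.comp_apply]
    have a1 := refl_succ_xvar (A := A) (i := 0) hn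
    have a2 := refl_succ_xvar_succ (A := A) (i := 0) hn
    rw [Nat.zero_add] at a1 a2
    have a3 := refl_zero_xvar_zero (n := n) (A := A)
    have a4 := refl_zero_xvar_one (n := n) (A := A)
    rcases a with _ | _ | a
    · simp only [a1, a2, a3, a4, map_neg]
    · simp only [Nat.zero_add, a1, a2, a3, a4, map_neg]
    have a5 := refl_xvar_of_ne (n := n) (A := A) (i := 0) (j := a + 1 + 1) (by omega) (by omega)
    have a6 := refl_xvar_of_ne (n := n) (A := A) (i := 1) (j := a + 1 + 1) (by omega) (by omega)
    simp only [a5, a6]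
  exact DFunLike.congr_fun e f

variable [IsDomain A] [CharZero A]

theorem root_ne_zero {i : ℕ} (hi : i < n) : root n A i ≠ 0 := by
  by_cases h0 : i = 0
  · subst h0
    simp [root, xvar_of_lt hi]
  · have h1 : i - 1 < n := by omega
    simp only [root, h0, if_false, xvar_of_lt hi, xvar_of_lt h1]
    rw [sub_ne_zero]
    intro h
    have := X_injective h
    simp only [Fin.mk.injEq] at this
    omega

/-- The operator `∂'_i` as a linear map; it is `0` for `i ≥ n`. -/
noncomputable def ddiff (n : ℕ) (A : Type*) [CommRing A] [IsDomain A] [CharZero A] (i : ℕ) :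
    Module.End A (MvPolynomial (Fin n) A) :=
  if h : i < n then
    { toFun := dividedDiff' ⟨i, h⟩
      map_add' := fun f g => mul_left_cancel₀ (root_ne_zero h) (by
        rw [mul_add, root_mul_dividedDiff', root_mul_dividedDiff', root_mul_dividedDiff', map_add]
        ring)
      map_smul' := fun a f => mul_left_cancel₀ (root_ne_zero h) (by
        rw [RingHom.id_apply, mul_smul_comm, root_mul_dividedDiff', root_mul_dividedDiff', map_smul,
          smul_sub]) }
  else 0

theorem ddiff_of_le {i : ℕ} (hi : n ≤ i) : ddiff n A i = 0 := by simp [ddiff, not_lt.mpr hi]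

theorem ddiff_eq {i : ℕ} (hi : i < n) (f : MvPolynomial (Fin n) A) :
    ddiff n A i f = dividedDiff' ⟨i, hi⟩ f := by
  simp [ddiff, hi]

theorem root_mul_ddiff (i : ℕ) (f : MvPolynomial (Fin n) A) :
    root n A i * ddiff n A i f = f - refl n A i f := by
  by_cases hi : i < n
  · rw [ddiff_eq hi, root_mul_dividedDiff']
  · rw [not_lt] at hi
    simp [ddiff_of_le hi, refl_of_le hi]

theorem ddiff_eq_of_root_mul {i : ℕ} (hi : i < n) {f g : MvPolynomial (Fin n) A}
    (h : root n A i * g = f - refl n A i f) : ddiff n A i f = g :=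
  mul_left_cancel₀ (root_ne_zero hi) (by rw [root_mul_ddiff, h])

/-- The twisted Leibniz rule. -/
theorem ddiff_mul (i : ℕ) (f g : MvPolynomial (Fin n) A) :
    ddiff n A i (f * g) = refl n A i f * ddiff n A i g + ddiff n A i f * g := by
  by_cases hi : i < n
  · refine ddiff_eq_of_root_mul hi ?_
    rw [map_mul]
    linear_combination refl n A i f * root_mul_ddiff i g + g * root_mul_ddiff i f
  · simp [ddiff_of_le (not_lt.mp hi)]

theorem ddiff_eq_zero_iff {i : ℕ} {f : MvPolynomial (Fin n) A} :
    ddiff n A i f = 0 ↔ refl n A i f = f := by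
  constructor
  · intro h
    have := root_mul_ddiff i f
    rw [h, mul_zero] at this
    exact (sub_eq_zero.mp this.symm).symm
  · intro h
    by_cases hi : i < n
    · exact ddiff_eq_of_root_mul hi (by rw [h]; ring)
    · simp [ddiff_of_le (not_lt.mp hi)]

theorem ddiff_mul_of_refl_eq {i : ℕ} {f : MvPolynomial (Fin n) A} (hf : refl n A i f = f)
    (g : MvPolynomial (Fin n) A) : ddiff n A i (f * g) = f * ddiff n A i g := by
  rw [ddiff_mul, hf, ddiff_eq_zero_iff.mpr hf, zero_mul, add_zero]

theorem refl_ddiff (i : ℕ) (f : MvPolynomial (Fin n) A) :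
    refl n A i (ddiff n A i f) = ddiff n A i f := by
  by_cases hi : i < n
  · refine mul_left_cancel₀ (root_ne_zero hi) ?_
    have h := congrArg (refl n A i) (root_mul_ddiff i f)
    rw [map_mul, map_sub, refl_refl, refl_root hi] at h
    linear_combination -h - root_mul_ddiff i f
  · simp [ddiff_of_le (not_lt.mp hi)]

theorem ddiff_ddiff (i : ℕ) (f : MvPolynomial (Fin n) A) : ddiff n A i (ddiff n A i f) = 0 :=
  ddiff_eq_zero_iff.mpr (refl_ddiff i f)

theorem ddiff_mul_self (i : ℕ) : ddiff n A i * ddiff n A i = 0 :=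
  LinearMap.ext fun f => ddiff_ddiff i f

theorem ddiff_refl (i : ℕ) (f : MvPolynomial (Fin n) A) :
    ddiff n A i (refl n A i f) = -ddiff n A i f := by
  by_cases hi : i < n
  · refine ddiff_eq_of_root_mul hi ?_
    rw [refl_refl]
    linear_combination -root_mul_ddiff i f
  · simp [ddiff_of_le (not_lt.mp hi)]

/-! ### The relations of the nil-Coxeter algebra -/

theorem ddiff_comm {i j : ℕ} (h : i + 2 ≤ j ∨ j + 2 ≤ i) :
    Commute (ddiff n A i) (ddiff n A j) := by
  rcases Nat.lt_or_ge i n with hi | hi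
  swap
  · rw [ddiff_of_le hi]; exact Commute.zero_left _
  rcases Nat.lt_or_ge j n with hj | hj
  swap
  · rw [ddiff_of_le hj]; exact Commute.zero_right _
  refine LinearMap.ext fun f => ?_
  change ddiff n A i (ddiff n A j f) = ddiff n A j (ddiff n A i f)
  refine mul_left_cancel₀ (mul_ne_zero (root_ne_zero hi) (root_ne_zero hj)) ?_
  have e1 := root_mul_ddiff i (ddiff n A j f)
  have e2 := root_mul_ddiff j (ddiff n A i f)
  have e3 := root_mul_ddiff j f
  have e4 := root_mul_ddiff i f
  have e5 := congrArg (refl n A i) e3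
  have e6 := congrArg (refl n A j) e4
  rw [map_mul, map_sub, refl_root_of_add_two_le h] at e5
  rw [map_mul, map_sub, refl_root_of_add_two_le h.symm] at e6
  rw [← refl_comm h] at e6
  linear_combination root n A j * e1 - root n A i * e2 + e3 - e5 - e4 + e6

/-- Multiplying by the denominators turns both sides into the alternating sum over the
dihedral group generated by the two reflections. -/
theorem ddiff_braid_three {i : ℕ} (hi : 1 ≤ i) :
    ddiff n A i * ddiff n A (i + 1) * ddiff n A i =
      ddiff n A (i + 1) * ddiff n A i * ddiff n A (i + 1) := by
  rcases Nat.lt_or_ge (i + 1) n with hn | hn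
  swap
  · rw [ddiff_of_le hn]; simp
  have hi' : i < n := by omega
  refine LinearMap.ext fun f => ?_
  simp only [Module.End.mul_apply]
  set d := root n A i with hd
  set d' := root n A (i + 1) with hd'
  have hsum : refl n A i d' = d + d' := by
    obtain ⟨i, rfl⟩ : ∃ j, i = j + 1 := ⟨i - 1, by omega⟩
    simp only [hd, hd', root, Nat.add_one_ne_zero, if_false, map_sub, Nat.add_sub_cancel,
      refl_succ_xvar_succ hi', refl_xvar_of_ne (n := n) (A := A) (i := i + 1) (j := i + 1 + 1)
      (by omega) (by omega)]
    ring
  have hsum' : refl n A (i + 1) d = d + d' := by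
    obtain ⟨i, rfl⟩ : ∃ j, i = j + 1 := ⟨i - 1, by omega⟩
    simp only [hd, hd', root, Nat.add_one_ne_zero, if_false, map_sub, Nat.add_sub_cancel,
      refl_succ_xvar hn, refl_xvar_of_ne (n := n) (A := A) (i := i + 1 + 1) (j := i)
      (by omega) (by omega)]
    ring
  have hs : refl n A i d = -d := refl_root hi'
  have ht : refl n A (i + 1) d' = -d' := refl_root hn
  have hne : d + d' ≠ 0 := by
    rw [← hsum']
    intro h
    have := congrArg (refl n A (i + 1)) h
    rw [refl_refl, map_zero] at this
    exact root_ne_zero hi' this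
  refine mul_left_cancel₀ (mul_ne_zero (mul_ne_zero (root_ne_zero hi') (root_ne_zero hn)) hne) ?_
  rw [← hd, ← hd']
  have key : ∀ f, d * d' * (d + d') *
      ddiff n A i (ddiff n A (i + 1) (ddiff n A i f)) =
      f - refl n A i f - refl n A (i + 1) f + refl n A (i + 1) (refl n A i f) +
        refl n A i (refl n A (i + 1) f) - refl n A i (refl n A (i + 1) (refl n A i f)) := by
    intro f
    have e1 := root_mul_ddiff i f
    have e2 := root_mul_ddiff (i + 1) (ddiff n A i f)
    have e3 := root_mul_ddiff i (ddiff n A (i + 1) (ddiff n A i f))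
    have e4 := refl_ddiff i f
    have e5 := congrArg (refl n A (i + 1)) e1
    have e6 := congrArg (refl n A i) e2
    have e7 := congrArg (refl n A i) e5
    simp only [map_mul, map_sub, ← hd, ← hd', hsum, hsum', hs, map_add, e4] at e1 e2 e3 e5 e6 e7
    have hs' : refl n A i d + refl n A i d' = d' := by rw [hs, hsum]; ring
    linear_combination d' * (d + d') * e3 + (d + d') * e2 - d' * e6 + e1 - e5 + e7
  have key' : ∀ f, d * d' * (d + d') *
      ddiff n A (i + 1) (ddiff n A i (ddiff n A (i + 1) f)) =
      f - refl n A i f - refl n A (i + 1) f + refl n A (i + 1) (refl n A i f) +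
        refl n A i (refl n A (i + 1) f) -
        refl n A (i + 1) (refl n A i (refl n A (i + 1) f)) := by
    intro f
    have e1 := root_mul_ddiff (i + 1) f
    have e2 := root_mul_ddiff i (ddiff n A (i + 1) f)
    have e3 := root_mul_ddiff (i + 1) (ddiff n A i (ddiff n A (i + 1) f))
    have e4 := refl_ddiff (i + 1) f
    have e5 := congrArg (refl n A i) e1
    have e6 := congrArg (refl n A (i + 1)) e2
    have e7 := congrArg (refl n A (i + 1)) e5
    simp only [map_mul, map_sub, ← hd, ← hd', hsum, hsum', ht, map_add, e4] at e1 e2 e3 e5 e6 e7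
    linear_combination d * (d + d') * e3 + (d + d') * e2 - d * e6 + e1 - e5 + e7
  rw [key, key', refl_braid_three hi f hn]

/-- As for `ddiff_braid_three`, with the dihedral group of order eight. -/
theorem ddiff_braid_four :
    ddiff n A 0 * ddiff n A 1 * ddiff n A 0 * ddiff n A 1 =
      ddiff n A 1 * ddiff n A 0 * ddiff n A 1 * ddiff n A 0 := by
  rcases Nat.lt_or_ge 1 n with hn | hn
  swap
  · rw [ddiff_of_le hn]; simp
  have hn' : 0 < n := by omega
  refine LinearMap.ext fun f => ?_
  simp only [Module.End.mul_apply]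
  set d := root n A 0 with hd
  set d' := root n A 1 with hd'
  have ed : d = 2 * xvar n A 0 := by simp [hd, root]
  have ed' : d' = xvar n A 1 - xvar n A 0 := by simp [hd', root]
  have a1 : refl n A 1 (xvar n A 0) = xvar n A 1 := refl_succ_xvar hn
  have s1 : refl n A 0 d = -d := refl_root hn'
  have s2 : refl n A 0 d' = d + d' := by
    rw [ed', ed, map_sub, refl_zero_xvar_zero, refl_zero_xvar_one]; ring
  have t1 : refl n A 1 d = d + 2 * d' := by
    rw [ed, ed', map_mul, map_ofNat, a1]; ring
  have t2 : refl n A 1 d' = -d' := refl_root hn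
  have hne1 : d + d' ≠ 0 := by
    rw [← s2]
    intro h
    have := congrArg (refl n A 0) h
    rw [refl_refl, map_zero] at this
    exact root_ne_zero hn this
  have hne2 : d + 2 * d' ≠ 0 := by
    rw [← t1]
    intro h
    have := congrArg (refl n A 1) h
    rw [refl_refl, map_zero] at this
    exact root_ne_zero hn' this
  refine mul_left_cancel₀ (mul_ne_zero (mul_ne_zero (mul_ne_zero (root_ne_zero hn')
    (root_ne_zero hn)) hne1) hne2) ?_
  rw [← hd, ← hd']
  have eL : d * d' * (d + d') * (d + 2 * d') *
      ddiff n A 0 (ddiff n A 1 (ddiff n A 0 (ddiff n A 1 f))) =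
      f - refl n A 1 f - refl n A 0 f + refl n A 0 (refl n A 1 f) + refl n A 1 (refl n A 0 f) -
        refl n A 1 (refl n A 0 (refl n A 1 f)) - refl n A 0 (refl n A 1 (refl n A 0 f)) +
        refl n A 0 (refl n A 1 (refl n A 0 (refl n A 1 f))) := by
    have e1 := root_mul_ddiff 1 f
    have e2 := root_mul_ddiff 0 (ddiff n A 1 f)
    have e3 := root_mul_ddiff 1 (ddiff n A 0 (ddiff n A 1 f))
    have e4 := root_mul_ddiff 0 (ddiff n A 1 (ddiff n A 0 (ddiff n A 1 f)))
    have i1 := refl_ddiff 1 f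
    have i2 := refl_ddiff 0 (ddiff n A 1 f)
    have e5 := congrArg (refl n A 0) e1
    have e6 := congrArg (refl n A 1) e5
    have e7 := congrArg (refl n A 0) e6
    have e8 := congrArg (refl n A 1) e2
    have e9 := congrArg (refl n A 0) e8
    have e10 := congrArg (refl n A 0) e3
    simp only [map_mul, map_sub, map_add, map_neg, map_ofNat, ← hd, ← hd', s1, s2, t1, t2, i1, i2]
      at e1 e2 e3 e4 e5 e6 e7 e8 e9 e10
    linear_combination d' * (d + d') * (d + 2 * d') * e4 + (d + d') * (d + 2 * d') * e3 -
      d' * (d + 2 * d') * e10 + (d + 2 * d') * e2 - (d + d') * e8 + d' * e9 + e1 - e5 + e6 - e7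
  have eR : d * d' * (d + d') * (d + 2 * d') *
      ddiff n A 1 (ddiff n A 0 (ddiff n A 1 (ddiff n A 0 f))) =
      f - refl n A 1 f - refl n A 0 f + refl n A 0 (refl n A 1 f) + refl n A 1 (refl n A 0 f) -
        refl n A 1 (refl n A 0 (refl n A 1 f)) - refl n A 0 (refl n A 1 (refl n A 0 f)) +
        refl n A 1 (refl n A 0 (refl n A 1 (refl n A 0 f))) := by
    have e1 := root_mul_ddiff 0 f
    have e2 := root_mul_ddiff 1 (ddiff n A 0 f)
    have e3 := root_mul_ddiff 0 (ddiff n A 1 (ddiff n A 0 f))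
    have e4 := root_mul_ddiff 1 (ddiff n A 0 (ddiff n A 1 (ddiff n A 0 f)))
    have i1 := refl_ddiff 0 f
    have i2 := refl_ddiff 1 (ddiff n A 0 f)
    have e5 := congrArg (refl n A 1) e1
    have e6 := congrArg (refl n A 0) e5
    have e7 := congrArg (refl n A 1) e6
    have e8 := congrArg (refl n A 0) e2
    have e9 := congrArg (refl n A 1) e8
    have e10 := congrArg (refl n A 1) e3
    simp only [map_mul, map_sub, map_add, map_neg, map_ofNat, ← hd, ← hd', s1, s2, t1, t2, i1, i2]
      at e1 e2 e3 e4 e5 e6 e7 e8 e9 e10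
    linear_combination d * (d + d') * (d + 2 * d') * e4 + (d + d') * (d + 2 * d') * e3 -
      d * (d + d') * e10 + 2 * (d + d') * e2 - (d + 2 * d') * e8 + d * e9 + e1 - e5 + e6 - e7
  rw [eL, eR, refl_braid_four hn]

end Operators

end DoubleSchubert

namespace DoubleSchubert

open MvPolynomial

/-! ### Degrees -/

section Chains

variable {n : ℕ} {A : Type*} [CommRing A]

/-- The polynomial `f` has degree `< d`, the zero polynomial having negative degree. -/
def DegreeLT (d : ℕ) (f : MvPolynomial (Fin n) A) : Prop := f = 0 ∨ f.totalDegree < d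

theorem totalDegree_refl_le (i : ℕ) (f : MvPolynomial (Fin n) A) :
    (refl n A i f).totalDegree ≤ f.totalDegree := by
  by_cases hi : i < n
  swap
  · rw [refl_of_le (not_lt.mp hi)]
  conv_lhs => rw [f.as_sum, map_sum]
  refine totalDegree_finsetSum_le fun s hs => ?_
  refine le_trans ?_ (le_totalDegree hs)
  simp only [refl, hi, dite_true, act, aeval_monomial]
  refine (totalDegree_mul _ _).trans ?_
  rw [algebraMap_eq, totalDegree_C, zero_add, Finsupp.prod]
  refine (totalDegree_finsetProd _ _).trans ?_
  rw [Finsupp.sum]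
  refine Finset.sum_le_sum fun j _ => ?_
  refine (totalDegree_pow _ _).trans ?_
  refine (Nat.mul_le_mul_left _ ?_).trans (Nat.mul_one _).le
  refine (totalDegree_mul _ _).trans ?_
  have h1 : ∀ z : ℤ, (z : MvPolynomial (Fin n) A).totalDegree = 0 := fun z => by
    rw [← map_intCast (C : A →+* MvPolynomial (Fin n) A), totalDegree_C]
  rw [h1, zero_add]
  exact (totalDegree_monomial_le _ _).trans (by simp)

theorem DegreeLT.eq_zero {f : MvPolynomial (Fin n) A} (hf : DegreeLT 0 f) : f = 0 :=
  hf.resolve_right (Nat.not_lt_zero _)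

variable [IsDomain A] [CharZero A]

theorem DegreeLT.ddiff {d : ℕ} {f : MvPolynomial (Fin n) A} (hf : DegreeLT (d + 1) f) (i : ℕ) :
    DegreeLT d (ddiff n A i f) := by
  by_cases hi : i < n
  swap
  · left; rw [ddiff_of_le (not_lt.mp hi)]; rfl
  rcases hf with rfl | hf
  · left; exact map_zero _
  by_cases h0 : DoubleSchubert.ddiff n A i f = 0
  · exact Or.inl h0
  right
  have h1 : (root n A i).totalDegree ≠ 0 := by
    intro h
    have h2 := totalDegree_eq_zero_iff_eq_C.mp h
    have h3 := refl_root (A := A) hi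
    rw [h2] at h3
    have h4 : refl n A i (C (coeff 0 (root n A i))) = C (coeff 0 (root n A i)) :=
      AlgHom.commutes _ _
    rw [h4, ← h2] at h3
    have h5 : (2 : MvPolynomial (Fin n) A) * root n A i = 0 := by linear_combination h3
    rcases mul_eq_zero.mp h5 with h6 | h6
    · exact two_ne_zero h6
    · exact root_ne_zero hi h6
  have h2 := congrArg totalDegree (root_mul_ddiff i f)
  rw [totalDegree_mul_of_isDomain (root_ne_zero hi) h0] at h2
  have h3 : (f - refl n A i f).totalDegree ≤ f.totalDegree :=
    (totalDegree_sub _ _).trans (max_le le_rfl (totalDegree_refl_le i f))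
  omega

/-! ### Descending products of divided differences -/

/-- The composite `∂'_{a+l-1} ∘ ⋯ ∘ ∂'_{a+1} ∘ ∂'_a`. -/
noncomputable def chain (n : ℕ) (A : Type*) [CommRing A] [IsDomain A] [CharZero A] (a : ℕ) :
    ℕ → Module.End A (MvPolynomial (Fin n) A)
  | 0 => 1
  | l + 1 => ddiff n A (a + l) * chain n A a l

theorem chain_succ (a l : ℕ) : chain n A a (l + 1) = ddiff n A (a + l) * chain n A a l := rfl

theorem chain_add (a l m : ℕ) : chain n A a (l + m) = chain n A (a + l) m * chain n A a l := by
  induction m with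
  | zero => simp [chain]
  | succ m ih => rw [← add_assoc, chain_succ, chain_succ, ih, mul_assoc, add_assoc]

theorem chain_succ' (a l : ℕ) : chain n A a (l + 1) = chain n A (a + 1) l * ddiff n A a := by
  rw [add_comm l 1, chain_add]
  simp [chain]

theorem ddiff_commute_chain {j a l : ℕ} (h : j + 2 ≤ a ∨ a + l + 1 ≤ j) :
    Commute (ddiff n A j) (chain n A a l) := by
  induction l with
  | zero => exact Commute.one_right _
  | succ l ih => exact (ddiff_comm (by omega)).mul_right (ih (by omega))

theorem ddiff_mul_chain {i a l : ℕ} (h1 : 1 ≤ i) (h2 : a ≤ i) (h3 : i + 1 < a + l) :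
    ddiff n A i * chain n A a l = chain n A a l * ddiff n A (i + 1) := by
  induction l with
  | zero => omega
  | succ l ih =>
    rcases Nat.lt_or_ge (i + 1) (a + l) with h | h
    · rw [chain_succ, ← mul_assoc, (ddiff_comm (show i + 2 ≤ a + l ∨ a + l + 2 ≤ i by omega)).eq,
        mul_assoc, ih h, mul_assoc]
    · obtain ⟨m, rfl⟩ : ∃ m, l = m + 1 := ⟨l - 1, by omega⟩
      obtain rfl : i = a + m := by omega
      rw [chain_succ, chain_succ, ← add_assoc, mul_assoc, mul_assoc,
        ← (ddiff_commute_chain (n := n) (A := A) (j := a + m + 1) (a := a) (l := m)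
          (by omega)).eq]
      simp only [← mul_assoc]
      rw [ddiff_braid_three h1]

theorem ddiff_mul_chain_top (a l : ℕ) : ddiff n A (a + l) * chain n A a (l + 1) = 0 := by
  rw [chain_succ, ← mul_assoc, ddiff_mul_self, zero_mul]

theorem chain_mul_of_refl_eq {a l : ℕ} {f : MvPolynomial (Fin n) A}
    (hf : ∀ i, a ≤ i → i < a + l → refl n A i f = f) (g : MvPolynomial (Fin n) A) :
    chain n A a l (f * g) = f * chain n A a l g := by
  induction l with
  | zero => rfl
  | succ l ih =>
    rw [chain_succ, Module.End.mul_apply, ih fun i h1 h2 => hf i h1 (by omega),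
      ddiff_mul_of_refl_eq (hf _ (by omega) (by omega)), Module.End.mul_apply]

theorem DegreeLT.chain {a l d : ℕ} {f : MvPolynomial (Fin n) A} (hf : DegreeLT (d + l) f) :
    DegreeLT d (chain n A a l f) := by
  induction l generalizing d with
  | zero => exact hf
  | succ l ih =>
    rw [chain_succ]
    exact (ih (d := d + 1) (by rwa [add_right_comm])).ddiff _

/-- The full chain `T = ∂'_{n-1} ∘ ⋯ ∘ ∂'_1 ∘ ∂'_0`. -/
noncomputable def fullChain (n : ℕ) (A : Type*) [CommRing A] [IsDomain A] [CharZero A] :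
    Module.End A (MvPolynomial (Fin n) A) := chain n A 0 n

theorem ddiff_mul_fullChain {i : ℕ} (h1 : 1 ≤ i) (h2 : i + 1 < n) :
    ddiff n A i * fullChain n A = fullChain n A * ddiff n A (i + 1) :=
  ddiff_mul_chain h1 (Nat.zero_le _) (by omega)

theorem ddiff_mul_fullChain_top {i : ℕ} (h : i + 1 = n) : ddiff n A i * fullChain n A = 0 := by
  subst h
  have := ddiff_mul_chain_top (n := i + 1) (A := A) 0 i
  rwa [Nat.zero_add] at this

theorem fullChain_mul_ddiff_zero : fullChain n A * ddiff n A 0 = 0 := by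
  rcases n with _ | n
  · rw [ddiff_of_le le_rfl, mul_zero]
  · rw [fullChain, chain_succ', mul_assoc, ddiff_mul_self, mul_zero]

theorem chain_mul_shift (a l : ℕ) (ha : 1 ≤ a) {m : ℕ} (hm : m + 1 ≤ l) :
    chain n A a l * chain n A (a + 1) m = chain n A a m * chain n A a l := by
  induction m with
  | zero => simp [chain]
  | succ m ih =>
    rw [chain_succ, chain_succ, ← mul_assoc, add_right_comm, ← ddiff_mul_chain (by omega) (by omega)
      (by omega), mul_assoc, ih (by omega), mul_assoc]

/-- The four-term braid relation brings two factors `∂'_1` side by side. -/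
theorem fullChain_sq_mul_ddiff_one : fullChain n A * fullChain n A * ddiff n A 1 = 0 := by
  rcases Nat.lt_or_ge 1 n with hn | hn
  swap
  · rw [ddiff_of_le hn, mul_zero]
  obtain ⟨m, rfl⟩ : ∃ m, n = m + 2 := ⟨n - 2, by omega⟩
  set D0 := ddiff (m + 2) A 0
  set D1 := ddiff (m + 2) A 1
  set C1 := chain (m + 2) A 1 (m + 1)
  set C2 := chain (m + 2) A 2 m
  have e1 : fullChain (m + 2) A = C1 * D0 := chain_succ' _ _
  have e2 : C1 = C2 * D1 := chain_succ' _ _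
  have e3 : D0 * C2 = C2 * D0 := (ddiff_commute_chain (by omega)).eq
  have e4 : C1 * C2 = chain (m + 2) A 1 m * C1 := chain_mul_shift 1 (m + 1) le_rfl le_rfl
  have e5 : C1 * D1 = 0 := by rw [e2, mul_assoc, ddiff_mul_self, mul_zero]
  have e6 : D0 * D1 * D0 * D1 = D1 * D0 * D1 * D0 := ddiff_braid_four
  calc fullChain (m + 2) A * fullChain (m + 2) A * D1 = C1 * D0 * (C2 * D1 * D0) * D1 := by
        rw [e1]; conv_lhs => rw [mul_assoc (C1 * D0), e2]
        rw [e2]; simp only [mul_assoc]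
    _ = C1 * (D0 * C2) * (D1 * D0 * D1) := by simp only [mul_assoc]
    _ = C1 * C2 * (D0 * D1 * D0 * D1) := by rw [e3]; simp only [mul_assoc]
    _ = chain (m + 2) A 1 m * (C1 * D1) * (D0 * D1 * D0) := by
        rw [e4, e6]; simp only [mul_assoc]
    _ = 0 := by rw [e5, mul_zero, zero_mul]

/-- The word of `T^m` followed by `s_i`, `i < m`, is not reduced. -/
theorem fullChain_pow_mul_ddiff {i m : ℕ} (h : i < m) :
    fullChain n A ^ m * ddiff n A i = 0 := by
  rcases Nat.lt_or_ge i n with hi | hi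
  swap
  · rw [ddiff_of_le hi, mul_zero]
  induction i generalizing m with
  | zero =>
    obtain ⟨m, rfl⟩ : ∃ k, m = k + 1 := ⟨m - 1, by omega⟩
    rw [pow_succ, mul_assoc, fullChain_mul_ddiff_zero, mul_zero]
  | succ i ih =>
    rcases Nat.eq_zero_or_pos i with rfl | h0
    · obtain ⟨m, rfl⟩ : ∃ k, m = k + 2 := ⟨m - 2, by omega⟩
      rw [pow_add, pow_two, mul_assoc, fullChain_sq_mul_ddiff_one, mul_zero]
    · obtain ⟨m, rfl⟩ : ∃ k, m = k + 1 := ⟨m - 1, by omega⟩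
      rw [pow_succ, mul_assoc, ← ddiff_mul_fullChain h0 hi, ← mul_assoc, ih (by omega) (by omega),
        zero_mul]

/-- Moving the `∂'_i` from the right factor to the left one, modulo the image of `∂'_i`, the
left factor is differentiated to `0`. -/
theorem fullChain_pow_mul_chain_eq_zero {m j : ℕ} (hj : j ≤ m) {r : MvPolynomial (Fin n) A}
    (hr : DegreeLT j r) (f : MvPolynomial (Fin n) A) :
    (fullChain n A ^ m) (r * chain n A 0 j f) = 0 := by
  induction j generalizing r with
  | zero => rw [hr.eq_zero, zero_mul, map_zero]
  | succ j ih =>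
    have e := ddiff_mul j (refl n A j r) (chain n A 0 j f)
    rw [refl_refl, ddiff_refl] at e
    have e' : r * chain n A 0 (j + 1) f =
        ddiff n A j (refl n A j r * chain n A 0 j f) + ddiff n A j r * chain n A 0 j f := by
      rw [e, chain_succ, Nat.zero_add, Module.End.mul_apply]; ring
    rw [e', map_add, ih (by omega) (hr.ddiff j), add_zero, ← Module.End.mul_apply,
      fullChain_pow_mul_ddiff (by omega), LinearMap.zero_apply]

/-- Commuting a polynomial in one variable with `T`. Of the two terms of the Leibniz rule for
`∂'_j`, one gives the polynomial in the preceding variable; in the other one `∂'_{n-1} ⋯ ∂'_j` acts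
on the polynomial and lowers its degree by `n - j`. -/
theorem exists_fullChain_mul {j : ℕ} (h0 : 1 ≤ j) (hj : j < n) {f : MvPolynomial (Fin n) A}
    (hf : ∀ i, j < i → ddiff n A i f = 0) (p : Polynomial A) (hp : p.degree < n) :
    ∃ r, DegreeLT j r ∧ fullChain n A (Polynomial.aeval (xvar n A j) p * f) =
      Polynomial.aeval (xvar n A (j - 1)) p * fullChain n A f + r * chain n A 0 j f := by
  obtain ⟨m, hm⟩ : ∃ m, n = j + 1 + m := ⟨n - j - 1, by omega⟩
  set q := ddiff n A j (Polynomial.aeval (xvar n A j) p) with hq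
  have hT : fullChain n A = chain n A (j + 1) m * (ddiff n A j * chain n A 0 j) := by
    rw [fullChain, show chain n A 0 n = chain n A 0 (j + 1 + m) by rw [← hm], chain_add, chain_succ,
      Nat.zero_add, Nat.zero_add]
  have hx : ∀ i, i ≠ j → i ≠ j + 1 → refl n A i (Polynomial.aeval (xvar n A j) p) =
      Polynomial.aeval (xvar n A j) p := by
    intro i h1 h2
    rw [← Polynomial.aeval_algHom_apply, refl_xvar_of_ne (by omega) (by omega)]
  have hx' : refl n A j (Polynomial.aeval (xvar n A j) p) =
      Polynomial.aeval (xvar n A (j - 1)) p := by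
    obtain ⟨j, rfl⟩ : ∃ k, j = k + 1 := ⟨j - 1, by omega⟩
    rw [← Polynomial.aeval_algHom_apply, refl_succ_xvar_succ hj, Nat.add_sub_cancel]
  have hx'' : ∀ i, j + 1 ≤ i → refl n A i (Polynomial.aeval (xvar n A (j - 1)) p) =
      Polynomial.aeval (xvar n A (j - 1)) p := by
    intro i h1
    rw [← Polynomial.aeval_algHom_apply, refl_xvar_of_ne (by omega) (by omega)]
  have hdeg : DegreeLT (j + m + 1) (Polynomial.aeval (xvar n A j) p) := by
    by_cases hp0 : p = 0
    · left; simp [hp0]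
    right
    rw [Polynomial.aeval_eq_sum_range]
    refine lt_of_le_of_lt (totalDegree_finsetSum_le (d := p.natDegree) fun i hi => ?_) ?_
    · refine (totalDegree_smul_le _ _).trans ((totalDegree_pow _ _).trans ?_)
      have : (xvar n A j).totalDegree ≤ 1 := by rw [xvar_of_lt hj, totalDegree_X]
      rw [Finset.mem_range] at hi
      calc _ ≤ i * 1 := Nat.mul_le_mul_left _ this
        _ ≤ _ := by omega
    · rw [Polynomial.degree_eq_natDegree hp0] at hp
      have := Nat.cast_lt.mp hp
      omega
  refine ⟨chain n A (j + 1) m q, (hdeg.ddiff j).chain, ?_⟩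
  have hg : ∀ i, j < i → refl n A i (chain n A 0 j f) = chain n A 0 j f := by
    intro i hi
    rw [← ddiff_eq_zero_iff, ← Module.End.mul_apply, (ddiff_commute_chain (by omega)).eq,
      Module.End.mul_apply, hf i hi, map_zero]
  simp only [hT, Module.End.mul_apply]
  rw [chain_mul_of_refl_eq fun i _ h => hx i (by omega) (by omega), ddiff_mul, hx', map_add,
    chain_mul_of_refl_eq fun i h _ => hx'' i h, ← hq, mul_comm q,
    chain_mul_of_refl_eq fun i h _ => hg i h, mul_comm (chain n A (j + 1) m q)]

/-- Of the `j + 1` operators `T` all but the outermost one act on `f` only, and the variable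
`x_{j+1}` becomes `x_1`. -/
theorem fullChain_pow_succ_mul {j : ℕ} (hj : j < n) {f : MvPolynomial (Fin n) A}
    (hf : ∀ i, j < i → ddiff n A i f = 0) (p : Polynomial A) (hp : p.degree < n) :
    (fullChain n A ^ (j + 1)) (Polynomial.aeval (xvar n A j) p * f) =
      fullChain n A (Polynomial.aeval (xvar n A 0) p * (fullChain n A ^ j) f) := by
  induction j generalizing f with
  | zero => simp
  | succ j ih =>
    obtain ⟨r, hr, e⟩ := exists_fullChain_mul (by omega) hj hf p hp
    rw [pow_succ (fullChain n A) (j + 1), Module.End.mul_apply, e, map_add,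
      fullChain_pow_mul_chain_eq_zero le_rfl hr, add_zero, Nat.add_sub_cancel, ih (by omega),
      pow_succ, Module.End.mul_apply]
    intro i hi
    rcases Nat.lt_or_ge (i + 1) n with h | h
    · rw [← Module.End.mul_apply, ddiff_mul_fullChain (by omega) h, Module.End.mul_apply,
        hf _ (by omega), map_zero]
    · rcases Nat.lt_or_ge i n with h' | h'
      · rw [← Module.End.mul_apply, ddiff_mul_fullChain_top (by omega)]; rfl
      · rw [ddiff_of_le h']; rfl

end Chains

end DoubleSchubert

namespace DoubleSchubert

/-! ### Parts and ranks -/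

/-- The number of parts of `S` that are larger than `b`. -/
def numGT (S : Finset ℕ) (b : ℕ) : ℕ := (S.filter fun c => b < c).card

theorem part_empty (i : ℕ) : part ∅ i = 0 := by simp [part]

theorem sort_insert_max {S : Finset ℕ} {a : ℕ} (ha : ∀ b ∈ S, b < a) :
    (insert a S).sort (· ≥ ·) = a :: S.sort (· ≥ ·) :=
  Finset.sort_insert _ (fun b hb => (ha b hb).le) fun h => lt_irrefl _ (ha a h)

theorem part_insert_max_zero {S : Finset ℕ} {a : ℕ} (ha : ∀ b ∈ S, b < a) :
    part (insert a S) 0 = a := by simp [part, sort_insert_max ha]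

theorem part_insert_max_succ {S : Finset ℕ} {a : ℕ} (ha : ∀ b ∈ S, b < a) (i : ℕ) :
    part (insert a S) (i + 1) = part S i := by simp [part, sort_insert_max ha]

theorem numGT_insert_max_self {S : Finset ℕ} {a : ℕ} (ha : ∀ b ∈ S, b < a) :
    numGT (insert a S) a = 0 := by
  rw [numGT, Finset.card_eq_zero, Finset.filter_eq_empty_iff]
  intro b hb
  rcases Finset.mem_insert.mp hb with rfl | hb
  · exact lt_irrefl _
  · exact (ha b hb).not_gt

theorem numGT_insert_of_lt {S : Finset ℕ} {a b : ℕ} (ha : a ∉ S) (hb : b < a) :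
    numGT (insert a S) b = numGT S b + 1 := by
  rw [numGT, Finset.filter_insert, if_pos hb, Finset.card_insert_of_notMem]
  · rfl
  · simp [ha]

theorem numGT_insert_of_le {S : Finset ℕ} {a b : ℕ} (hb : a ≤ b) :
    numGT (insert a S) b = numGT S b := by
  rw [numGT, Finset.filter_insert, if_neg hb.not_gt]
  rfl

theorem part_numGT {S : Finset ℕ} {b : ℕ} (hb : b ∈ S) : part S (numGT S b) = b := by
  induction S using Finset.induction_on_max with
  | empty => simp at hb
  | insert a S ha ih =>
    have ha' : a ∉ S := fun h => lt_irrefl _ (ha a h)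
    rcases Finset.mem_insert.mp hb with rfl | hb
    · rw [numGT_insert_max_self ha, part_insert_max_zero ha]
    · rw [numGT_insert_of_lt ha' (ha b hb), part_insert_max_succ ha, ih hb]

theorem part_mem {S : Finset ℕ} {i : ℕ} (hi : i < S.card) : part S i ∈ S := by
  induction S using Finset.induction_on_max generalizing i with
  | empty => simp at hi
  | insert a S ha ih =>
    have ha' : a ∉ S := fun h => lt_irrefl _ (ha a h)
    rw [Finset.card_insert_of_notMem ha'] at hi
    rcases i with _ | i
    · rw [part_insert_max_zero ha]; exact Finset.mem_insert_self _ _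
    · rw [part_insert_max_succ ha]; exact Finset.mem_insert_of_mem (ih (by omega))

theorem numGT_part {S : Finset ℕ} {i : ℕ} (hi : i < S.card) : numGT S (part S i) = i := by
  induction S using Finset.induction_on_max generalizing i with
  | empty => simp at hi
  | insert a S ha ih =>
    have ha' : a ∉ S := fun h => lt_irrefl _ (ha a h)
    rw [Finset.card_insert_of_notMem ha'] at hi
    rcases i with _ | i
    · rw [part_insert_max_zero ha, numGT_insert_max_self ha]
    · rw [part_insert_max_succ ha, numGT_insert_of_lt ha' (ha _ (part_mem (by omega))),
        ih (by omega)]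

theorem part_of_card_le {S : Finset ℕ} {i : ℕ} (hi : S.card ≤ i) : part S i = 0 := by
  rw [part, List.getD_eq_default]
  rwa [Finset.length_sort]

theorem numGT_lt_card {S : Finset ℕ} {b : ℕ} (hb : b ∈ S) : numGT S b < S.card :=
  Finset.card_lt_card (Finset.filter_ssubset.mpr ⟨b, hb, lt_irrefl _⟩)

theorem part_erase {S : Finset ℕ} {j : ℕ} (hj : j < S.card) (x : ℕ) :
    part (S.erase (part S j)) x = part S (if x < j then x else x + 1) := by
  induction S using Finset.induction_on_max generalizing j x with
  | empty => simp at hj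
  | insert a S ha ih =>
    have ha' : a ∉ S := fun h => lt_irrefl _ (ha a h)
    rw [Finset.card_insert_of_notMem ha'] at hj
    rcases j with _ | j
    · rw [part_insert_max_zero ha, Finset.erase_insert ha', if_neg (by omega),
        part_insert_max_succ ha]
    · have hm : part S j ∈ S := part_mem (by omega)
      rw [part_insert_max_succ ha, Finset.erase_insert_of_ne (ha _ hm).ne']
      have ha2 : ∀ b ∈ S.erase (part S j), b < a := fun b hb => ha b (Finset.mem_of_mem_erase hb)
      rcases x with _ | x
      · rw [part_insert_max_zero ha2, if_pos (by omega), part_insert_max_zero ha]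
      · rw [part_insert_max_succ ha2, ih (by omega)]
        by_cases h : x < j
        · rw [if_pos h, if_pos (by omega), part_insert_max_succ ha]
        · rw [if_neg h, if_neg (by omega), part_insert_max_succ ha]

theorem part_insert_zero {S : Finset ℕ} (hS : 0 ∉ S) : part (insert 0 S) = part S := by
  induction S using Finset.induction_on_max with
  | empty =>
    funext i
    rw [part_empty]
    rcases i with _ | i
    · exact part_insert_max_zero (by simp)
    · rw [part_insert_max_succ (by simp), part_empty]
  | insert a S ha ih =>
    rw [Finset.mem_insert, not_or] at hS
    have ha2 : ∀ b ∈ insert 0 S, b < a := by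
      intro b hb
      rcases Finset.mem_insert.mp hb with rfl | hb
      · omega
      · exact ha b hb
    rw [Finset.insert_comm]
    funext i
    rcases i with _ | i
    · rw [part_insert_max_zero ha2, part_insert_max_zero ha]
    · rw [part_insert_max_succ ha2, part_insert_max_succ ha, ih hS.2]

/-! ### Signed removal of a part -/

section Contract

variable {R : Type*} [CommRing R]

/-- The operator `g ↦ (S ↦ ∑_{i ∈ S} ± w_i g(S ∖ i))` on functions of finite sets, the sign being
determined by the position of `i` in the decreasing order of `S`: contraction with the covector
`w` in an exterior algebra. -/
def contract (w : ℕ → R) (g : Finset ℕ → R) (S : Finset ℕ) : R :=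
  ∑ i ∈ S, (-1) ^ numGT S i * w i * g (S.erase i)

theorem contract_congr {w w' : ℕ → R} {g g' : Finset ℕ → R} {S : Finset ℕ}
    (hw : ∀ i ∈ S, w i = w' i) (hg : ∀ i ∈ S, g (S.erase i) = g' (S.erase i)) :
    contract w g S = contract w' g' S :=
  Finset.sum_congr rfl fun i hi => by rw [hw i hi, hg i hi]

theorem contract_zero_right (w : ℕ → R) (S : Finset ℕ) : contract w (fun _ => 0) S = 0 := by
  simp [contract]

theorem contract_add_right (w : ℕ → R) (g g' : Finset ℕ → R) (S : Finset ℕ) :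
    contract w (fun T => g T + g' T) S = contract w g S + contract w g' S := by
  simp only [contract, ← Finset.sum_add_distrib, mul_add]

theorem contract_neg_right (w : ℕ → R) (g : Finset ℕ → R) (S : Finset ℕ) :
    contract w (fun T => - g T) S = - contract w g S := by
  simp only [contract, ← Finset.sum_neg_distrib, mul_neg]

theorem contract_sub_right (w : ℕ → R) (g g' : Finset ℕ → R) (S : Finset ℕ) :
    contract w (fun T => g T - g' T) S = contract w g S - contract w g' S := by
  simp only [contract, ← Finset.sum_sub_distrib, mul_sub]

theorem contract_mul_right (w : ℕ → R) (r : R) (g : Finset ℕ → R) (S : Finset ℕ) :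
    contract w (fun T => r * g T) S = r * contract w g S := by
  rw [contract, contract, Finset.mul_sum]
  exact Finset.sum_congr rfl fun i _ => by ring

theorem contract_sub_left (w w' : ℕ → R) (g : Finset ℕ → R) (S : Finset ℕ) :
    contract (fun i => w i - w' i) g S = contract w g S - contract w' g S := by
  rw [contract, contract, contract, ← Finset.sum_sub_distrib]
  exact Finset.sum_congr rfl fun i _ => by ring

theorem numGT_erase_of_le {S : Finset ℕ} {i j : ℕ} (h : i ≤ j) :
    numGT (S.erase i) j = numGT S j := by
  rw [numGT, numGT]
  congr 1
  ext c
  simp only [Finset.mem_filter, Finset.mem_erase]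
  constructor
  · rintro ⟨⟨-, h1⟩, h2⟩; exact ⟨h1, h2⟩
  · rintro ⟨h1, h2⟩; exact ⟨⟨by omega, h1⟩, h2⟩

theorem numGT_erase_of_lt {S : Finset ℕ} {i j : ℕ} (hj : j ∈ S) (h : i < j) :
    numGT S i = numGT (S.erase j) i + 1 := by
  conv_lhs => rw [← Finset.insert_erase hj]
  exact numGT_insert_of_lt (Finset.notMem_erase _ _) h

theorem neg_one_pow_numGT_erase {S : Finset ℕ} {i j : ℕ} (hi : i ∈ S) (hj : j ∈ S) (h : i ≠ j) :
    (-1 : R) ^ numGT S i * (-1) ^ numGT (S.erase i) j =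
      -((-1) ^ numGT S j * (-1) ^ numGT (S.erase j) i) := by
  rcases lt_or_gt_of_ne h with h | h
  · rw [numGT_erase_of_le h.le, numGT_erase_of_lt hj h]; ring
  · rw [numGT_erase_of_le (S := S) h.le, numGT_erase_of_lt hi h]; ring

theorem contract_anticomm (w w' : ℕ → R) (g : Finset ℕ → R) (S : Finset ℕ) :
    contract w (contract w' g) S = -contract w' (contract w g) S := by
  simp only [contract, Finset.mul_sum]
  rw [Finset.sum_comm' (s' := fun j => S.erase j) (t' := S), ← Finset.sum_neg_distrib]
  · refine Finset.sum_congr rfl fun j hj => ?_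
    rw [← Finset.sum_neg_distrib]
    refine Finset.sum_congr rfl fun i hi => ?_
    rw [Finset.mem_erase] at hi
    rw [Finset.erase_right_comm]
    linear_combination w i * w' j * g ((S.erase j).erase i) *
      neg_one_pow_numGT_erase (R := R) hi.2 hj hi.1
  · intro i j
    simp only [Finset.mem_erase]
    tauto

theorem contract_contract_self [NoZeroDivisors R] [CharZero R] (w : ℕ → R) (g : Finset ℕ → R)
    (S : Finset ℕ) : contract w (contract w g) S = 0 :=
  self_eq_neg.mp (contract_anticomm w w g S)

theorem contract_insert_max (w : ℕ → R) (g : Finset ℕ → R) {S : Finset ℕ} {a : ℕ}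
    (ha : ∀ b ∈ S, b < a) :
    contract w g (insert a S) = w a * g S - contract w (fun T => g (insert a T)) S := by
  have ha' : a ∉ S := fun h => lt_irrefl _ (ha a h)
  rw [contract, Finset.sum_insert ha', numGT_insert_max_self ha, Finset.erase_insert ha', contract,
    sub_eq_add_neg, ← Finset.sum_neg_distrib, pow_zero, one_mul]
  congr 1
  refine Finset.sum_congr rfl fun i hi => ?_
  rw [numGT_insert_of_lt ha' (ha i hi), Finset.erase_insert_of_ne (ha i hi).ne']
  ring

theorem contract_insert_zero (w : ℕ → R) (g : Finset ℕ → R) {S : Finset ℕ} (hS : 0 ∉ S) :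
    contract w g (insert 0 S) =
      (-1) ^ S.card * w 0 * g S + contract w (fun T => g (insert 0 T)) S := by
  have h0 : ∀ i ∈ S, 0 < i := fun i hi => Nat.pos_of_ne_zero fun h => hS (h ▸ hi)
  have h1 : numGT (insert 0 S) 0 = S.card := by
    rw [numGT_insert_of_le le_rfl, numGT, Finset.filter_true_of_mem h0]
  rw [contract, Finset.sum_insert hS, h1, Finset.erase_insert hS, contract]
  congr 1
  refine Finset.sum_congr rfl fun i hi => ?_
  rw [numGT_insert_of_le (h0 i hi).le, Finset.erase_insert_of_ne (h0 i hi).ne]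

/-! ### Pfaffians indexed by sets -/

/-- The Pfaffian of the entries `M i j`, `i > j` in `S`, for a set `S` of even cardinality. -/
def pfaffianOn (M : ℕ → ℕ → R) (S : Finset ℕ) : R :=
  pfaffian (S.card / 2) fun i j => M (part S i) (part S j)

theorem pfaffianOn_empty (M : ℕ → ℕ → R) : pfaffianOn M ∅ = 1 := rfl

theorem sum_part {M : Type*} [AddCommMonoid M] {S : Finset ℕ} {k : ℕ} (hk : S.card = k)
    (f : ℕ → M) : ∑ i ∈ S, f i = ∑ j : Fin k, f (part S j) := by
  symm
  refine Finset.sum_bij (fun j _ => part S j) (fun j _ => part_mem (hk ▸ j.2)) ?_ ?_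
    fun _ _ => rfl
  · intro i _ j _ h
    have h' := congrArg (numGT S) h
    rw [numGT_part (hk ▸ i.2), numGT_part (hk ▸ j.2)] at h'
    exact Fin.ext h'
  · intro b hb
    exact ⟨⟨numGT S b, hk ▸ numGT_lt_card hb⟩, Finset.mem_univ _, part_numGT hb⟩

theorem val_succAbove {k : ℕ} (j : Fin (k + 1)) (x : Fin k) :
    (j.succAbove x : ℕ) = if (x : ℕ) < j then (x : ℕ) else x + 1 := by
  simp only [Fin.succAbove, Fin.lt_def, Fin.val_castSucc]
  split_ifs <;> simp

/-- Expansion along the first row. -/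
theorem pfaffianOn_insert_max (M : ℕ → ℕ → R) {S : Finset ℕ} {a : ℕ} (ha : ∀ b ∈ S, b < a)
    (hS : Odd S.card) : pfaffianOn M (insert a S) = contract (M a) (pfaffianOn M) S := by
  have ha' : a ∉ S := fun h => lt_irrefl _ (ha a h)
  obtain ⟨m, hm⟩ := hS
  have hc : (insert a S).card / 2 = m + 1 := by
    rw [Finset.card_insert_of_notMem ha']; omega
  rw [pfaffianOn, hc, pfaffian, contract, sum_part hm]
  refine Finset.sum_congr rfl fun j _ => ?_
  have hj : (j : ℕ) < S.card := by omega
  have hc' : (S.erase (part S j)).card / 2 = m := by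
    rw [Finset.card_erase_of_mem (part_mem hj)]; omega
  rw [numGT_part hj, pfaffianOn, hc']
  simp only [Fin.val_succ, part_insert_max_succ ha, part_erase hj, val_succAbove]
  rw [show ((0 : Fin (2 * (m + 1))) : ℕ) = 0 from rfl, part_insert_max_zero ha]

/-- Expansion along the last column, when the smallest index is `0`. -/
theorem pfaffianOn_insert_zero (M : ℕ → ℕ → R) {S : Finset ℕ} (h0 : 0 ∉ S) (hS : Odd S.card) :
    pfaffianOn M (insert 0 S) = contract (fun i => M i 0) (pfaffianOn M) S := by
  induction hc : S.card using Nat.strong_induction_on generalizing S with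
  | _ c ih =>
  induction S using Finset.induction_on_max with
  | empty => simp at hS
  | insert a S ha =>
    have ha' : a ∉ S := fun h => lt_irrefl _ (ha a h)
    rw [Finset.mem_insert, not_or] at h0
    rw [Finset.card_insert_of_notMem ha'] at hS hc
    have hev : Even S.card := by
      rw [Nat.odd_add_one, Nat.not_odd_iff_even] at hS; exact hS
    have ha2 : ∀ b ∈ insert 0 S, b < a := by
      intro b hb
      rcases Finset.mem_insert.mp hb with rfl | hb
      · omega
      · exact ha b hb
    have hodd : ∀ i ∈ S, Odd (S.erase i).card := fun i hi => by
      rw [Finset.card_erase_of_mem hi]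
      exact Nat.Even.sub_odd (Finset.card_pos.mpr ⟨i, hi⟩) hev odd_one
    rw [Finset.insert_comm, pfaffianOn_insert_max M ha2
      (by rw [Finset.card_insert_of_notMem h0.2]; exact hS), contract_insert_zero _ _ h0.2,
      contract_insert_max _ _ ha, hev.neg_one_pow, one_mul, sub_eq_add_neg]
    congr 1
    rw [contract_congr (g' := contract (fun i => M i 0) (pfaffianOn M)) (fun _ _ => rfl)
        fun i hi => ?_,
      contract_anticomm, neg_inj]
    · refine contract_congr (fun _ _ => rfl) fun i hi => ?_
      exact (pfaffianOn_insert_max M (fun b hb => ha b (Finset.mem_of_mem_erase hb))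
        (hodd i hi)).symm
    · exact ih _ (by rw [Finset.card_erase_of_mem hi]; omega)
        (fun h => h0.2 (Finset.mem_of_mem_erase h)) (hodd i hi) rfl

/-- A rank two skew-symmetric perturbation of the entries changes the Pfaffian by a term linear
in the perturbation. -/
theorem map_pfaffianOn [NoZeroDivisors R] [CharZero R] (σ : R →+* R) (M : ℕ → ℕ → R)
    (u v : ℕ → R) (hσ : ∀ i j, j < i → σ (M i j) = M i j + (u i * v j - v i * u j))
    {S : Finset ℕ} (hS : Even S.card) :
    σ (pfaffianOn M S) = pfaffianOn M S + contract u (contract v (pfaffianOn M)) S := by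
  induction hc : S.card using Nat.strong_induction_on generalizing S with
  | _ c ih =>
  induction S using Finset.induction_on_max with
  | empty => simp [pfaffianOn_empty, contract]
  | insert a S ha =>
    have ha' : a ∉ S := fun h => lt_irrefl _ (ha a h)
    rw [Finset.card_insert_of_notMem ha'] at hS hc
    have hodd : Odd S.card := by
      rw [Nat.even_add_one, Nat.not_even_iff_odd] at hS; exact hS
    have hev : ∀ i ∈ S, Even (S.erase i).card := fun i hi => by
      rw [Finset.card_erase_of_mem hi]
      exact Nat.Odd.sub_odd hodd odd_one
    have hlt : ∀ i, ∀ b ∈ S.erase i, b < a := fun i b hb => ha b (Finset.mem_of_mem_erase hb)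
    have e1 : contract u (contract v (pfaffianOn M)) (insert a S) =
        u a * contract v (pfaffianOn M) S - (v a * contract u (pfaffianOn M) S -
          contract u (contract v (contract (M a) (pfaffianOn M))) S) := by
      rw [contract_insert_max _ _ ha, ← contract_mul_right u (v a), ← contract_sub_right]
      congr 1
      refine contract_congr (fun _ _ => rfl) fun i hi => ?_
      rw [contract_insert_max _ _ (hlt i)]
      congr 1
      refine contract_congr (fun _ _ => rfl) fun j hj => ?_
      refine pfaffianOn_insert_max M (fun b hb => hlt i b (Finset.mem_of_mem_erase hb)) ?_
      rw [Finset.card_erase_of_mem hj]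
      exact Nat.Even.sub_odd (Finset.card_pos.mpr ⟨j, hj⟩) (hev i hi) odd_one
    have e2 : σ (contract (M a) (pfaffianOn M) S) =
        contract (fun j => M a j - (v a * u j - u a * v j))
          (fun T => pfaffianOn M T + contract u (contract v (pfaffianOn M)) T) S := by
      rw [contract, map_sum]
      refine Finset.sum_congr rfl fun j hj => ?_
      rw [map_mul, map_mul, map_pow, map_neg, map_one, hσ a j (ha j hj),
        ih _ (by rw [Finset.card_erase_of_mem hj]; omega) (hev j hj) rfl]
      ring
    have e3 : ∀ (r : R) (w : ℕ → R) (g : Finset ℕ → R), contract (fun j => r * w j) g S =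
        r * contract w g S := by
      intro r w g
      rw [contract, contract, Finset.mul_sum]
      exact Finset.sum_congr rfl fun i _ => by ring
    -- The second-order terms vanish, since contractions square to zero and anticommute.
    have e4 : contract v (contract u (contract v (pfaffianOn M))) S = 0 := by
      rw [contract_anticomm, contract_congr (g' := fun _ => 0) (fun _ _ => rfl)
        (fun i _ => contract_contract_self _ _ _), contract_zero_right, neg_zero]
    have e5 : contract (M a) (contract u (contract v (pfaffianOn M))) S =
        contract u (contract v (contract (M a) (pfaffianOn M))) S := by
      rw [contract_anticomm, ← contract_neg_right]
      exact contract_congr (fun _ _ => rfl) fun i _ => by rw [contract_anticomm, neg_neg]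
    rw [pfaffianOn_insert_max M ha hodd, e2, contract_add_right, contract_sub_left,
      contract_sub_left, contract_sub_left, contract_sub_left, e1, e3, e3, e3, e3,
      contract_contract_self, e4, e5]
    ring

end Contract

end DoubleSchubert

namespace DoubleSchubert

open MvPolynomial

/-! ### Divided differences of powers of `x_1` -/

section Powers

theorem degreeLT_xvar_pow {n : ℕ} {A : Type*} [CommRing A] [CharZero A] (i c : ℕ) :
    DegreeLT (c + 1) (xvar n A i ^ c) := by
  by_cases hi : i < n
  · right
    rw [xvar_of_lt hi, totalDegree_X_pow]
    omega
  · rcases c with _ | c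
    · right; simp
    · left; simp [xvar, hi]

variable {n : ℕ} {A : Type*} [CommRing A] [IsDomain A] [CharZero A]

theorem ddiff_succ_xvar {i : ℕ} (hi : i + 1 < n) : ddiff n A (i + 1) (xvar n A i) = -1 :=
  ddiff_eq_of_root_mul hi (by rw [refl_succ_xvar hi]; simp [root])

/-- The recursion of the complete symmetric polynomials. -/
theorem chain_one_pow_succ {i : ℕ} (hi : i + 1 < n) (c : ℕ) :
    chain n A 1 (i + 1) (xvar n A 0 ^ (c + 1)) =
      xvar n A (i + 1) * chain n A 1 (i + 1) (xvar n A 0 ^ c) -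
        chain n A 1 i (xvar n A 0 ^ c) := by
  induction i with
  | zero =>
    have e := ddiff_mul 1 (xvar n A 0) (xvar n A 0 ^ c)
    have e1 : refl n A 1 (xvar n A 0) = xvar n A 1 := refl_succ_xvar hi
    have e2 : ddiff n A 1 (xvar n A 0) = -1 := ddiff_succ_xvar hi
    rw [e1, e2] at e
    simp only [chain, mul_one, Module.End.one_apply]
    rw [pow_succ', show 1 + 0 = 1 from rfl, e]
    ring
  | succ i ih =>
    have e0 : ddiff n A (i + 1 + 1) (chain n A 1 i (xvar n A 0 ^ c)) = 0 := by
      rw [← Module.End.mul_apply, (ddiff_commute_chain (by omega)).eq, Module.End.mul_apply,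
        ddiff_eq_zero_iff.mpr, map_zero]
      rw [map_pow, refl_xvar_of_ne (by omega) (by omega)]
    rw [chain_succ, add_comm 1, Module.End.mul_apply, ih (by omega), map_sub, e0, ddiff_mul,
      refl_succ_xvar hi, ddiff_succ_xvar hi, Module.End.mul_apply]
    ring

theorem chain_one_pow_self {i : ℕ} (hi : i < n) :
    chain n A 1 i (xvar n A 0 ^ i) = (-1) ^ i := by
  induction i with
  | zero => simp [chain]
  | succ i ih =>
    rw [chain_one_pow_succ hi, ih (by omega), DegreeLT.eq_zero (DegreeLT.chain (d := 0) _)]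
    · ring
    · rw [Nat.zero_add]; exact degreeLT_xvar_pow _ _

end Powers

/-! ### Elementary symmetric polynomials and the first variable -/

section Esymm

variable (n : ℕ) (A : Type*) [CommRing A]

theorem refl_esymm {i : ℕ} (hi : 1 ≤ i) (j : ℕ) :
    refl n A i (esymm (Fin n) A j) = esymm (Fin n) A j := by
  by_cases h : i < n
  swap
  · rw [refl_of_le (not_lt.mp h)]
  have h0 : i ≠ 0 := by omega
  have e : refl n A i = rename (Equiv.swap (⟨i - 1, by omega⟩ : Fin n) ⟨i, h⟩) := by
    refine MvPolynomial.algHom_ext fun k => ?_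
    simp [refl, h, act, SignedPerm.simple, h0]
  rw [e, rename_esymm]

/-- The polynomial `e_{j-1}(x_2, …, x_n)`, which is `0` for `j = 0`. -/
noncomputable def esymmTail : ℕ → MvPolynomial (Fin n) A
  | 0 => 0
  | j + 1 => ∑ S ∈ (Finset.univ.filter fun i : Fin n => (i : ℕ) ≠ 0).powersetCard j, ∏ i ∈ S, X i

theorem refl_zero_esymmTail (j : ℕ) : refl n A 0 (esymmTail n A j) = esymmTail n A j := by
  rcases j with _ | j
  · exact map_zero _
  rw [esymmTail, map_sum]
  refine Finset.sum_congr rfl fun S hS => ?_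
  rw [map_prod]
  refine Finset.prod_congr rfl fun i hi => ?_
  have h := (Finset.mem_filter.mp ((Finset.mem_powersetCard.mp hS).1 hi)).2
  rw [← xvar_of_lt i.2, refl_xvar_of_ne h (by omega)]

theorem esymm_eq_esymmTail (hn : 0 < n) (j : ℕ) :
    esymm (Fin n) A j = esymmTail n A (j + 1) + xvar n A 0 * esymmTail n A j := by
  set s := Finset.univ.filter fun i : Fin n => (i : ℕ) ≠ 0
  have h0 : (⟨0, hn⟩ : Fin n) ∉ s := by simp [s]
  have hu : (Finset.univ : Finset (Fin n)) = insert ⟨0, hn⟩ s := by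
    ext i
    simp only [s, Finset.mem_univ, Finset.mem_insert, Finset.mem_filter, true_and, true_iff,
      Fin.ext_iff]
    tauto
  rcases j with _ | j
  · simp [esymmTail]
  rw [esymm, hu, Finset.powersetCard_succ_insert h0, Finset.sum_union, Finset.sum_image,
    esymmTail, esymmTail, Finset.mul_sum]
  · congr 1
    refine Finset.sum_congr rfl fun S hS => ?_
    rw [Finset.prod_insert fun h => h0 ((Finset.mem_powersetCard.mp hS).1 h), xvar_of_lt hn]
  · intro S hS T hT h
    have h1 : (⟨0, hn⟩ : Fin n) ∉ S := fun h => h0 ((Finset.mem_powersetCard.mp hS).1 h)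
    have h2 : (⟨0, hn⟩ : Fin n) ∉ T := fun h => h0 ((Finset.mem_powersetCard.mp hT).1 h)
    rw [← Finset.erase_insert h1, ← Finset.erase_insert h2, h]
  · rw [Finset.disjoint_left]
    intro S hS hS'
    obtain ⟨T, -, rfl⟩ := Finset.mem_image.mp hS'
    exact h0 ((Finset.mem_powersetCard.mp hS).1 (Finset.mem_insert_self _ _))

theorem esymmTail_of_lt {j : ℕ} (hn : 0 < n) (hj : n < j) : esymmTail n A j = 0 := by
  obtain ⟨j, rfl⟩ : ∃ k, j = k + 1 := ⟨j - 1, by omega⟩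
  rw [esymmTail, Finset.powersetCard_eq_empty.mpr, Finset.sum_empty]
  have h := Finset.card_lt_card (Finset.filter_ssubset (s := (Finset.univ : Finset (Fin n)))
    (p := fun i : Fin n => (i : ℕ) ≠ 0).mpr ⟨⟨0, hn⟩, Finset.mem_univ _, by simp⟩)
  rw [Finset.card_univ, Fintype.card_fin] at h
  omega

variable [IsDomain A] [CharZero A]

theorem ddiff_zero_esymm (hn : 0 < n) (j : ℕ) :
    ddiff n A 0 (esymm (Fin n) A j) = esymmTail n A j := by
  refine ddiff_eq_of_root_mul hn ?_
  rw [esymm_eq_esymmTail n A hn, map_add, map_mul, refl_zero_esymmTail, refl_zero_esymmTail,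
    refl_zero_xvar_zero, root, if_pos rfl]
  ring

/-- Write the tail as a polynomial of degree `< n` in `x_1` with symmetric coefficients, in one of
two ways according to the sign of `a + j - n`. -/
theorem chain_pow_mul_esymmTail {a : ℕ} (ha : a < n) (j : ℕ) :
    chain n A 1 (n - 1) (xvar n A 0 ^ a * esymmTail n A j) =
      if a + j = n then (-1) ^ a else 0 := by
  have hn : 0 < n := by omega
  have hsymm : ∀ c k, chain n A 1 (n - 1) (esymm (Fin n) A k * xvar n A 0 ^ c) =
      esymm (Fin n) A k * chain n A 1 (n - 1) (xvar n A 0 ^ c) := fun c k =>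
    chain_mul_of_refl_eq (fun i hi _ => refl_esymm n A hi k) _
  have hstep : ∀ c k, chain n A 1 (n - 1) (xvar n A 0 ^ c * esymmTail n A (k + 1)) =
      esymm (Fin n) A k * chain n A 1 (n - 1) (xvar n A 0 ^ c) -
        chain n A 1 (n - 1) (xvar n A 0 ^ (c + 1) * esymmTail n A k) := fun c k => by
    rw [← hsymm, ← map_sub, esymm_eq_esymmTail n A hn]
    ring_nf
  have hzero : ∀ c, c + 1 < n → chain n A 1 (n - 1) (xvar n A 0 ^ c) = 0 := fun c hc => by
    refine DegreeLT.eq_zero (DegreeLT.chain (d := 0) ?_)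
    rcases degreeLT_xvar_pow (n := n) (A := A) 0 c with h | h
    · exact Or.inl h
    · exact Or.inr (by omega)
  rcases Nat.lt_or_ge n (a + j) with h | h
  -- Here `a` is lowered until the index of the tail exceeds `n`.
  · rw [if_neg (by omega)]
    induction a generalizing j with
    | zero => rw [esymmTail_of_lt n A hn (by omega), mul_zero, map_zero]
    | succ a ih =>
      have := hstep a j
      rw [ih (by omega) (j + 1) (by omega), hzero a ha] at this
      linear_combination this
  -- Here `a` is raised until the tail is `0` or the power of `x_1` is `n - 1`.
  · induction j generalizing a with
    | zero =>
      rw [if_neg (by omega), esymmTail, mul_zero, map_zero]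
    | succ j ih =>
      rcases Nat.lt_or_ge (a + 1) n with h1 | h1
      · rw [hstep, hzero a h1, ih h1 (by omega), mul_zero, zero_sub]
        by_cases h2 : a + (j + 1) = n
        · rw [if_pos h2, if_pos (by omega), pow_succ]; ring
        · rw [if_neg h2, if_neg (by omega), neg_zero]
      · obtain rfl : j = 0 := by omega
        obtain rfl : n = a + 1 := by omega
        rw [hstep, esymmTail, mul_zero, map_zero, if_pos rfl, Nat.add_sub_cancel,
          chain_one_pow_self ha]
        simp

/-- The term of the Leibniz rule in which `∂'_0` acts on `x_1^a` has too small a degree in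
the non-symmetric factor to survive `∂'_{n-1} ⋯ ∂'_1`. -/
theorem fullChain_pow_mul {a : ℕ} (ha : a < n) {f : MvPolynomial (Fin n) A}
    (hf : ∀ i, 1 ≤ i → refl n A i f = f) :
    fullChain n A (xvar n A 0 ^ a * f) =
      (-1) ^ a * chain n A 1 (n - 1) (xvar n A 0 ^ a * ddiff n A 0 f) := by
  have hT : fullChain n A = chain n A 1 (n - 1) * ddiff n A 0 := by
    have := chain_succ' (n := n) (A := A) 0 (n - 1)
    rwa [Nat.zero_add, Nat.sub_add_cancel (by omega)] at this
  have h1 : chain n A 1 (n - 1) (ddiff n A 0 (xvar n A 0 ^ a)) = 0 := by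
    refine DegreeLT.eq_zero (DegreeLT.chain (d := 0) (DegreeLT.ddiff ?_ _))
    rcases degreeLT_xvar_pow (n := n) (A := A) 0 a with h | h
    · exact Or.inl h
    · exact Or.inr (by omega)
  have h2 : ∀ g, chain n A 1 (n - 1) ((-1) ^ a * g) = (-1) ^ a * chain n A 1 (n - 1) g :=
    fun g => chain_mul_of_refl_eq (fun i _ _ => by rw [map_pow, map_neg, map_one]) g
  rw [hT, Module.End.mul_apply, ddiff_mul, map_add, mul_comm (ddiff n A 0 _),
    chain_mul_of_refl_eq fun i hi _ => hf i hi, h1, mul_zero, add_zero, map_pow,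
    refl_zero_xvar_zero, neg_pow, mul_assoc, h2]

end Esymm

/-! ### `Q̃`-polynomials over a ring of coefficients -/

section QPolynomials

variable (n : ℕ) (A : Type*) [CommRing A]

/-- The polynomial `Q̃_{i,j}` over `A`. -/
noncomputable def qPair (i j : ℕ) : MvPolynomial (Fin n) A :=
  esymm (Fin n) A i * esymm (Fin n) A j +
    2 * ∑ k ∈ Finset.Icc 1 j, (-1) ^ k * (esymm (Fin n) A (i + k) * esymm (Fin n) A (j - k))

/-- A strict partition with the part `0` added if its length is odd. -/
def evenParts (al : Finset ℕ) : Finset ℕ := if Even al.card then al else insert 0 al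

/-- The polynomial `Q̃_α` over `A`. -/
noncomputable def qPoly (al : Finset ℕ) : MvPolynomial (Fin n) A :=
  pfaffianOn (qPair n A) (evenParts al)

theorem map_pfaffian {R S : Type*} [CommRing R] [CommRing S] (f : R →+* S) (m : ℕ)
    (M : Fin (2 * m) → Fin (2 * m) → R) :
    f (pfaffian m M) = pfaffian m fun i j => f (M i j) := by
  induction m with
  | zero => exact map_one f
  | succ m ih =>
    simp only [pfaffian, map_sum, map_mul, map_pow, map_neg, map_one, ih]

theorem even_card_evenParts {al : Finset ℕ} (h0 : 0 ∉ al) : Even (evenParts al).card := by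
  rw [evenParts]
  split_ifs with h
  · exact h
  · rw [Finset.card_insert_of_notMem h0, Nat.even_add_one]
    exact h

theorem inX_qTilde {al : Finset ℕ} (h0 : 0 ∉ al) :
    inX (qTilde n al) = qPoly n (MvPolynomial (Fin n) ℤ) al := by
  have e : ∀ i j, map (C : ℤ →+* MvPolynomial (Fin n) ℤ) (qTilde₂ n i j) =
      qPair n (MvPolynomial (Fin n) ℤ) i j := by
    intro i j
    simp [qTilde₂, qPair, map_esymm]
  have hp : part (evenParts al) = part al := by
    rw [evenParts]; split_ifs
    · rfl
    · exact part_insert_zero h0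
  have hc : (evenParts al).card / 2 = (al.card + 1) / 2 := by
    rw [evenParts]
    split_ifs with h
    · obtain ⟨k, hk⟩ := h; omega
    · rw [Finset.card_insert_of_notMem h0]
  rw [inX, qTilde, map_pfaffian]
  simp only [e]
  rw [qPoly, pfaffianOn, hp, hc]

theorem qPair_zero_right (i : ℕ) : qPair n A i 0 = esymm (Fin n) A i := by
  simp [qPair]

theorem refl_qPair {i : ℕ} (hi : 1 ≤ i) (a b : ℕ) :
    refl n A i (qPair n A a b) = qPair n A a b := by
  simp only [qPair, map_add, map_mul, map_sum, map_pow, map_neg, map_one, map_ofNat,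
    refl_esymm n A hi]

theorem refl_pfaffianOn {i : ℕ} (hi : 1 ≤ i) (S : Finset ℕ) :
    refl n A i (pfaffianOn (qPair n A) S) = pfaffianOn (qPair n A) S := by
  have := map_pfaffian (refl n A i : MvPolynomial (Fin n) A →+* MvPolynomial (Fin n) A) (S.card / 2)
    fun a b => qPair n A (part S a) (part S b)
  simp only [RingHom.coe_coe, refl_qPair n A hi] at this
  exact this

theorem refl_qPoly {i : ℕ} (hi : 1 ≤ i) (al : Finset ℕ) :
    refl n A i (qPoly n A al) = qPoly n A al := refl_pfaffianOn n A hi _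

/-- In the generating function, `s_0` multiplies `E(t)` by `g(t) = (1 - x_1 t) / (1 + x_1 t)`, and
`(t - u) (g(t) g(u) - 1) = (t + u) (g(t) - g(u))`. -/
theorem refl_zero_qPair (hn : 0 < n) (i j : ℕ) :
    refl n A 0 (qPair n A i j) = qPair n A i j +
      (refl n A 0 (esymm (Fin n) A i) * esymm (Fin n) A j -
        esymm (Fin n) A i * refl n A 0 (esymm (Fin n) A j)) := by
  set x := xvar n A 0
  set H := esymmTail n A
  have hv : ∀ k, esymm (Fin n) A k = H (k + 1) + x * H k := esymm_eq_esymmTail n A hn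
  have hu : ∀ k, refl n A 0 (esymm (Fin n) A k) = H (k + 1) - x * H k := fun k => by
    rw [hv, map_add, map_mul, refl_zero_esymmTail, refl_zero_esymmTail, refl_zero_xvar_zero]
    ring
  -- The difference of the two alternating sums telescopes.
  have hsum : ∀ m ≤ j,
      ∑ k ∈ Finset.Icc 1 m, (-1) ^ k * ((H (i + k + 1) - x * H (i + k)) *
          (H (j - k + 1) - x * H (j - k))) =
        ∑ k ∈ Finset.Icc 1 m, (-1) ^ k * ((H (i + k + 1) + x * H (i + k)) *
          (H (j - k + 1) + x * H (j - k))) -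
        2 * x * ((-1) ^ m * (H (i + m + 1) * H (j - m)) - H (i + 1) * H j) := by
    intro m hm
    induction m with
    | zero => simp
    | succ m ih =>
      rw [Finset.sum_Icc_succ_top (by omega), Finset.sum_Icc_succ_top (by omega), ih (by omega)]
      rw [show j - (m + 1) + 1 = j - m by omega, ← add_assoc i m 1]
      ring
  have h := hsum j le_rfl
  simp only [qPair, map_add, map_mul, map_sum, map_pow, map_neg, map_one, map_ofNat, hu]
  simp only [hv]
  rw [h, Nat.sub_self, show H 0 = 0 from rfl]
  ring

/-- The covector `(e_i)_i` is the last column of the matrix of a partition of odd length, so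
contraction with it supplies the part `0` that is needed after the removal of `b` from a partition
of even length, and removes it otherwise. -/
theorem contract_evenParts_erase [IsDomain A] [CharZero A] {al : Finset ℕ} (h0 : 0 ∉ al) {b : ℕ}
    (hb : b ∈ al) :
    contract (esymm (Fin n) A) (pfaffianOn (qPair n A)) ((evenParts al).erase b) =
      qPoly n A (al.erase b) := by
  have hv : (fun i => qPair n A i 0) = esymm (Fin n) A := funext (qPair_zero_right n A)
  have h0' : 0 ∉ al.erase b := fun h => h0 (Finset.mem_of_mem_erase h)
  have hc := Finset.card_erase_add_one hb
  rw [qPoly, evenParts, evenParts]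
  by_cases h : Even al.card
  · have h1 : ¬ Even (al.erase b).card := by
      rw [← hc, Nat.even_add_one] at h; exact h
    rw [if_pos h, if_neg h1, pfaffianOn_insert_zero _ h0' (Nat.not_even_iff_odd.mp h1), hv]
  · have h1 : Even (al.erase b).card := by
      rw [← hc, Nat.even_add_one, not_not] at h; exact h
    have hb0 : b ≠ 0 := fun e => h0 (e ▸ hb)
    rw [if_neg h, if_pos h1, Finset.erase_insert_of_ne hb0.symm, contract_insert_zero _ _ h0',
      h1.neg_one_pow, one_mul, esymm_zero, one_mul,
      contract_congr (g' := contract (esymm (Fin n) A) (pfaffianOn (qPair n A))) (fun _ _ => rfl)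
        fun i hi => ?_, contract_contract_self, add_zero]
    rw [pfaffianOn_insert_zero _ (fun h => h0' (Finset.mem_of_mem_erase h)) ?_, hv]
    rw [Finset.card_erase_of_mem hi]
    exact Nat.Even.sub_odd (Finset.card_pos.mpr ⟨i, hi⟩) h1 odd_one

/-- The operators `f ↦ T(x_1^{n-b} f)`, `1 ≤ b ≤ n`, remove the part `b` from a `Q̃`-polynomial. -/
theorem fullChain_pow_mul_qPoly [IsDomain A] [CharZero A] {al : Finset ℕ}
    (hal : al ∈ strictPartitions n) {b : ℕ} (hb1 : 1 ≤ b) (hbn : b ≤ n) :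
    fullChain n A (xvar n A 0 ^ (n - b) * qPoly n A al) =
      if b ∈ al then (-1) ^ numGT al b * qPoly n A (al.erase b) else 0 := by
  have hn : 0 < n := by omega
  have h0 : 0 ∉ al := fun h => by
    have := Finset.mem_Icc.mp (Finset.mem_powerset.mp hal h); omega
  set S := evenParts al with hSdef
  set v := esymm (Fin n) A
  set g := contract v (pfaffianOn (qPair n A)) with hg
  have hS : Even S.card := even_card_evenParts h0
  have e1 := map_pfaffianOn (refl n A 0 : MvPolynomial (Fin n) A →+* MvPolynomial (Fin n) A)
    (qPair n A) (fun i => refl n A 0 (v i)) v (fun i j _ => refl_zero_qPair n A hn i j) hS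
  have e2 : ddiff n A 0 (qPoly n A al) = contract (esymmTail n A) g S := by
    refine ddiff_eq_of_root_mul hn ?_
    have e3 : root n A 0 * contract (esymmTail n A) g S =
        contract (fun i => v i - refl n A 0 (v i)) g S := by
      rw [contract, contract, Finset.mul_sum]
      refine Finset.sum_congr rfl fun i _ => ?_
      rw [← root_mul_ddiff, ddiff_zero_esymm n A hn]
      ring
    rw [e3, contract_sub_left, hg, contract_contract_self, zero_sub, qPoly]
    simp only [RingHom.coe_coe] at e1
    rw [e1]
    ring
  have hgs : ∀ i, 1 ≤ i → ∀ T, refl n A i (g T) = g T := by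
    intro i hi T
    simp only [hg, contract, map_sum, map_mul, map_pow, map_neg, map_one, v,
      refl_esymm n A hi, refl_pfaffianOn n A hi]
  rw [fullChain_pow_mul n A (by omega) fun i hi => refl_qPoly n A hi al, e2, contract,
    Finset.mul_sum, map_sum, Finset.mul_sum]
  have e4 : ∀ i ∈ S, (-1) ^ (n - b) * chain n A 1 (n - 1) (xvar n A 0 ^ (n - b) *
      ((-1) ^ numGT S i * esymmTail n A i * g (S.erase i))) =
      if i = b then (-1) ^ numGT S b * g (S.erase b) else 0 := by
    intro i _
    rw [show xvar n A 0 ^ (n - b) * ((-1) ^ numGT S i * esymmTail n A i * g (S.erase i)) =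
        ((-1) ^ numGT S i * g (S.erase i)) * (xvar n A 0 ^ (n - b) * esymmTail n A i) by ring,
      chain_mul_of_refl_eq fun k hk _ => by
        rw [map_mul, map_pow, map_neg, map_one, hgs k hk],
      chain_pow_mul_esymmTail n A (by omega)]
    by_cases h : i = b
    · rw [if_pos (by omega), if_pos h, h, mul_comm _ ((-1 : MvPolynomial (Fin n) A) ^ (n - b)),
        ← mul_assoc, ← mul_pow, neg_one_mul, neg_neg, one_pow, one_mul]
    · rw [if_neg (by omega), if_neg h, mul_zero, mul_zero]
  rw [Finset.sum_congr rfl e4, Finset.sum_ite_eq']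
  have hbS : b ∈ S ↔ b ∈ al := by
    rw [hSdef, evenParts]
    split_ifs
    · rfl
    · rw [Finset.mem_insert]; constructor
      · rintro (h | h)
        · omega
        · exact h
      · exact Or.inr
  have hnum : numGT S b = numGT al b := by
    rw [hSdef, evenParts]
    split_ifs
    · rfl
    · exact numGT_insert_of_le (Nat.zero_le _)
  by_cases h : b ∈ al
  · rw [if_pos (hbS.mpr h), if_pos h, hnum, hg, contract_evenParts_erase n A h0 h]
  · rw [if_neg (fun h' => h (hbS.mp h')), if_neg h]

end QPolynomials

end DoubleSchubert

namespace DoubleSchubert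

open MvPolynomial

/-! ### Factorial powers -/

section Factorial

variable (n : ℕ)

/-- The factorial power `(t - y_1) ⋯ (t - y_m)`, as a polynomial in `t` over `ℤ[Y]`. -/
noncomputable def factPow (m : ℕ) : Polynomial (MvPolynomial (Fin n) ℤ) :=
  ∏ j ∈ Finset.range m, (Polynomial.X - Polynomial.C (xvar n ℤ j))

theorem degree_factPow (m : ℕ) : (factPow n m).degree = m := by
  rw [factPow, Polynomial.degree_prod]
  simp

theorem elemSymm_of_neg {m : ℕ} {d : ℤ} (hd : d < 0) : elemSymm n m d = 0 :=
  if_neg hd.not_ge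

theorem elemSymm_natCast {m : ℕ} (hm : m ≤ n) (d : ℕ) :
    elemSymm n m d = ((Multiset.range m).map (xvar n ℤ)).esymm d := by
  have e : (Multiset.range m).map (xvar n ℤ) =
      (Finset.univ.filter fun i : Fin n => (i : ℕ) < m).val.map (X (R := ℤ)) := by
    have e1 : (Finset.univ.filter fun i : Fin n => (i : ℕ) < m).map Fin.valEmbedding =
        Finset.range m := by
      ext j
      simp only [Finset.mem_map, Finset.mem_filter, Finset.mem_univ, true_and, Finset.mem_range,
        Fin.valEmbedding_apply]
      constructor
      · rintro ⟨i, hi, rfl⟩; exact hi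
      · intro hj; exact ⟨⟨j, by omega⟩, hj, rfl⟩
    rw [← Finset.range_val, ← e1, Finset.map_val, Multiset.map_map]
    refine Multiset.map_congr rfl fun i _ => ?_
    exact xvar_of_lt i.2
  rw [e, Finset.esymm_map_val, elemSymm, if_pos (Int.natCast_nonneg d), Int.toNat_natCast]

theorem factPow_eq_sum {m : ℕ} (h1 : 1 ≤ m) (hm : m ≤ n) :
    factPow n (n - m) = ∑ b ∈ Finset.Icc 1 n,
      Polynomial.C ((-1) ^ (b + m) * elemSymm n (n - m) ((b : ℤ) - m)) *
        Polynomial.X ^ (n - b) := by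
  have e := Multiset.prod_X_sub_X_eq_sum_esymm ((Multiset.range (n - m)).map (xvar n ℤ))
  rw [Multiset.map_map, Multiset.card_map, Multiset.card_range] at e
  have e' : factPow n (n - m) = (Multiset.map ((fun t => Polynomial.X - Polynomial.C t) ∘ xvar n ℤ)
      (Multiset.range (n - m))).prod := rfl
  rw [e', e, ← Finset.sum_subset (Finset.Icc_subset_Icc_left h1 : Finset.Icc m n ⊆ _)]
  · rw [Finset.range_eq_Ico, Finset.sum_Ico_eq_sum_range, Nat.sub_zero]
    rw [show Finset.Icc m n = Finset.Ico m (n + 1) from rfl, Finset.sum_Ico_eq_sum_range,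
      show n + 1 - m = n - m + 1 by omega]
    refine Finset.sum_congr rfl fun j _ => ?_
    rw [Nat.zero_add, show (((m + j : ℕ) : ℤ) - (m : ℤ)) = (j : ℕ) by push_cast; ring,
      elemSymm_natCast n (Nat.sub_le _ _), show n - (m + j) = n - m - j by omega,
      show (-1 : MvPolynomial (Fin n) ℤ) ^ (m + j + m) = (-1) ^ j by
        rw [show m + j + m = j + 2 * m by ring, pow_add, pow_mul]; simp]
    rw [map_mul, map_pow, map_neg, map_one, mul_assoc]
  · intro b hb hb'
    rw [Finset.mem_Icc] at hb hb'
    rw [elemSymm_of_neg n (by omega), mul_zero, map_zero, zero_mul]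

end Factorial

/-! ### Determinants -/

section Determinants

variable (n : ℕ)

theorem schurDet_eq_det {k : ℕ} {mu : Finset ℕ} (hk : mu.card = k) (be : Finset ℕ) :
    schurDet n be mu = (Matrix.of fun i j : Fin k =>
      elemSymm n (n - part mu j) ((part be i : ℤ) - (part mu j : ℤ))).det := by
  subst hk; rfl

/-- Expansion along the first column. -/
theorem schurDet_insert_max {mu : Finset ℕ} {m : ℕ} (hm : ∀ b ∈ mu, b < m) {be : Finset ℕ}
    (hbe : be.card = mu.card + 1) :
    schurDet n be (insert m mu) = ∑ b ∈ be, (-1) ^ numGT be b *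
      elemSymm n (n - m) ((b : ℤ) - m) * schurDet n (be.erase b) mu := by
  have hm' : m ∉ mu := fun h => lt_irrefl _ (hm m h)
  rw [schurDet_eq_det n (Finset.card_insert_of_notMem hm'), Matrix.det_succ_column_zero,
    sum_part hbe]
  refine Finset.sum_congr rfl fun i _ => ?_
  have hi : (i : ℕ) < be.card := by omega
  rw [numGT_part hi, schurDet_eq_det n rfl]
  congr 1
  · simp [part_insert_max_zero hm]
  · congr 1
    ext a b : 2
    simp only [Matrix.submatrix_apply, Matrix.of_apply, Fin.val_succ, part_insert_max_succ hm,
      part_erase hi, val_succAbove]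

theorem part_antitone (S : Finset ℕ) : Antitone (part S) := by
  refine antitone_nat_of_succ_le fun i => ?_
  induction S using Finset.induction_on_max generalizing i with
  | empty => simp [part_empty]
  | insert a S ha ih =>
    rcases i with _ | i
    · rw [part_insert_max_succ ha, part_insert_max_zero ha]
      rcases Nat.lt_or_ge 0 S.card with h | h
      · exact (ha _ (part_mem h)).le
      · rw [part_of_card_le h]; exact Nat.zero_le _
    · rw [part_insert_max_succ ha, part_insert_max_succ ha]; exact ih i

/-- If `μ ⊄ β` the matrix has a block of zeros whose semiperimeter exceeds its size. -/
theorem schurDet_eq_zero {be mu : Finset ℕ} (h : ¬ DiagramLE mu be) : schurDet n be mu = 0 := by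
  simp only [DiagramLE, not_forall, not_le] at h
  obtain ⟨i, hi⟩ := h
  have hik : i < mu.card := by
    by_contra hc
    rw [part_of_card_le (not_lt.mp hc)] at hi
    omega
  rw [schurDet, Matrix.det_apply]
  refine Finset.sum_eq_zero fun σ _ => ?_
  obtain ⟨j, hj, hσ⟩ : ∃ j : Fin mu.card, (j : ℕ) ≤ i ∧ i ≤ (σ j : ℕ) := by
    by_contra! hc
    have h1 : ((Finset.univ.filter fun j : Fin mu.card => (j : ℕ) ≤ i).image σ).card ≤
        (Finset.univ.filter fun j : Fin mu.card => (j : ℕ) < i).card := by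
      refine Finset.card_le_card fun a ha => ?_
      obtain ⟨j, hj, rfl⟩ := Finset.mem_image.mp ha
      simp only [Finset.mem_filter, Finset.mem_univ, true_and] at hj ⊢
      exact hc j hj
    rw [Finset.card_image_of_injective _ σ.injective] at h1
    refine absurd h1 (not_le.mpr (Finset.card_lt_card ?_))
    rw [Finset.ssubset_iff_of_subset]
    · exact ⟨⟨i, hik⟩, by simp, by simp⟩
    · intro j
      simp only [Finset.mem_filter, Finset.mem_univ, true_and]
      omega
  rw [Finset.prod_eq_zero (Finset.mem_univ j), smul_zero]
  rw [Matrix.of_apply, elemSymm_of_neg]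
  have h1 := part_antitone be hσ
  have h2 := part_antitone mu hj
  omega

end Determinants

/-! ### Intertwining numbers -/

theorem lt_part_iff {S : Finset ℕ} {b i : ℕ} : b < part S i ↔ i < numGT S b := by
  induction S using Finset.induction_on_max generalizing i with
  | empty => simp [part_empty, numGT]
  | insert a S ha ih =>
    have ha' : a ∉ S := fun h => lt_irrefl _ (ha a h)
    rcases Nat.lt_or_ge b a with h | h
    · rw [numGT_insert_of_lt ha' h]
      rcases i with _ | i
      · rw [part_insert_max_zero ha]; omega
      · rw [part_insert_max_succ ha, ih]; omega
    · have h0 : numGT S b = 0 := by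
        rw [numGT, Finset.card_eq_zero, Finset.filter_eq_empty_iff]
        intro c hc; have := ha c hc; omega
      rw [numGT_insert_of_le h, h0]
      have := part_antitone (insert a S) (Nat.zero_le i)
      rw [part_insert_max_zero ha] at this
      omega

/-- The intertwining number counts the pairs of a part of `α` and a smaller part of `β`. -/
theorem intertwining_eq_sum {al be : Finset ℕ} (h : Disjoint al be) (h0 : 0 ∉ be) :
    intertwining al be = ∑ b ∈ be, numGT al b := by
  simp only [intertwining, interlace, Finset.card_filter, Finset.mul_sum]
  rw [Finset.sum_comm]
  refine Finset.sum_congr rfl fun b hb => ?_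
  have hle : numGT al b ≤ al.card := Finset.card_filter_le _ _
  have key : ∀ i, (b < part al i ∧ part al (i + 1) < b) ↔ i + 1 = numGT al b := by
    intro i
    have h1 : part al (i + 1) ≠ b := by
      intro e
      rcases Nat.lt_or_ge (i + 1) al.card with h' | h'
      · exact Finset.disjoint_left.mp h (part_mem h') (e ▸ hb)
      · rw [part_of_card_le h'] at e; exact h0 (e ▸ hb)
    have h2 : part al (i + 1) < b ↔ ¬ (i + 1 < numGT al b) := by rw [← lt_part_iff]; omega
    rw [lt_part_iff, h2]
    omega
  simp only [key]
  rcases Nat.eq_zero_or_pos (numGT al b) with h1 | h1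
  · rw [h1]
    exact Finset.sum_eq_zero fun i _ => by simp
  · rw [Finset.sum_eq_single (numGT al b - 1)]
    · rw [if_pos (by omega)]; omega
    · intro i _ hi
      rw [if_neg (by omega), mul_zero]
    · intro hi
      rw [Finset.mem_range] at hi
      omega

/-! ### Iterating the operators that remove a part -/

section Iteration

variable (n : ℕ)

/-- The linear combination `∑_α g(α) Q̃_α(X)` with coefficients in `ℤ[Y]`. -/
noncomputable def qCombination (g : Finset ℕ → MvPolynomial (Fin n) ℤ) : PolyXY n :=
  ∑ al ∈ strictPartitions n, C (g al) * qPoly n (MvPolynomial (Fin n) ℤ) al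

/-- The action of `f ↦ T((x_1 - y_1) ⋯ (x_1 - y_{n-m}) f)` on coefficients. -/
noncomputable def coeffStep (m : ℕ) (g : Finset ℕ → MvPolynomial (Fin n) ℤ) (al : Finset ℕ) :
    MvPolynomial (Fin n) ℤ :=
  ∑ b ∈ Finset.Icc 1 n \ al, (-1) ^ (b + m) * elemSymm n (n - m) ((b : ℤ) - m) *
    (-1) ^ numGT al b * g (insert b al)

theorem fullChain_C_mul (c : MvPolynomial (Fin n) ℤ) (f : PolyXY n) :
    fullChain n (MvPolynomial (Fin n) ℤ) (C c * f) =
      C c * fullChain n (MvPolynomial (Fin n) ℤ) f := by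
  rw [C_mul', C_mul', map_smul]

theorem fullChain_factPow_mul {m : ℕ} (h1 : 1 ≤ m) (hm : m ≤ n)
    (g : Finset ℕ → MvPolynomial (Fin n) ℤ) :
    fullChain n (MvPolynomial (Fin n) ℤ)
      (Polynomial.aeval (xvar n (MvPolynomial (Fin n) ℤ) 0) (factPow n (n - m)) *
        qCombination n g) = qCombination n (coeffStep n m g) := by
  set w : ℕ → MvPolynomial (Fin n) ℤ := fun b =>
    (-1) ^ (b + m) * elemSymm n (n - m) ((b : ℤ) - m) with hw
  rw [factPow_eq_sum n h1 hm, map_sum, qCombination, Finset.sum_mul_sum, map_sum]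
  have e1 : ∀ b ∈ Finset.Icc 1 n, fullChain n (MvPolynomial (Fin n) ℤ)
      (∑ al ∈ strictPartitions n,
        Polynomial.aeval (xvar n (MvPolynomial (Fin n) ℤ) 0)
          (Polynomial.C ((-1) ^ (b + m) * elemSymm n (n - m) ((b : ℤ) - m)) *
            Polynomial.X ^ (n - b)) *
          (C (g al) * qPoly n (MvPolynomial (Fin n) ℤ) al)) =
      ∑ al ∈ strictPartitions n with b ∉ al, C (w b * (-1) ^ numGT al b * g (insert b al)) *
        qPoly n (MvPolynomial (Fin n) ℤ) al := by
    intro b hb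
    have hb' := Finset.mem_Icc.mp hb
    rw [map_sum]
    have e2 : ∀ al ∈ strictPartitions n, fullChain n (MvPolynomial (Fin n) ℤ)
        (Polynomial.aeval (xvar n (MvPolynomial (Fin n) ℤ) 0)
          (Polynomial.C ((-1) ^ (b + m) * elemSymm n (n - m) ((b : ℤ) - m)) *
            Polynomial.X ^ (n - b)) *
          (C (g al) * qPoly n (MvPolynomial (Fin n) ℤ) al)) =
        if b ∈ al then C (w b * (-1) ^ numGT al b * g al) *
          qPoly n (MvPolynomial (Fin n) ℤ) (al.erase b) else 0 := by
      intro al hal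
      rw [map_mul (Polynomial.aeval _), Polynomial.aeval_C, map_pow (Polynomial.aeval _),
        Polynomial.aeval_X, algebraMap_eq,
        show ∀ a x c q : PolyXY n, a * x * (c * q) = a * (c * (x * q)) by intros; ring,
        fullChain_C_mul, fullChain_C_mul, fullChain_pow_mul_qPoly n _ hal hb'.1 hb'.2]
      split_ifs
      · simp only [map_mul, hw, map_pow, map_neg, map_one]
        ring
      · simp
    rw [Finset.sum_congr rfl e2, ← Finset.sum_filter]
    refine Finset.sum_bij' (fun al _ => al.erase b) (fun al _ => insert b al) ?_ ?_ ?_ ?_ ?_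
    · intro al hal
      rw [Finset.mem_filter, strictPartitions, Finset.mem_powerset] at hal ⊢
      exact ⟨(Finset.erase_subset _ _).trans hal.1, Finset.notMem_erase _ _⟩
    · intro al hal
      rw [Finset.mem_filter, strictPartitions, Finset.mem_powerset] at hal ⊢
      exact ⟨Finset.insert_subset hb hal.1, Finset.mem_insert_self _ _⟩
    · intro al hal
      exact Finset.insert_erase (Finset.mem_filter.mp hal).2
    · intro al hal
      exact Finset.erase_insert (Finset.mem_filter.mp hal).2
    · intro al hal
      rw [Finset.insert_erase (Finset.mem_filter.mp hal).2, numGT_erase_of_le le_rfl]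
  rw [Finset.sum_congr rfl e1, qCombination,
    Finset.sum_comm' (s' := fun al => Finset.Icc 1 n \ al) (t' := strictPartitions n)]
  · refine Finset.sum_congr rfl fun al _ => ?_
    rw [coeffStep, map_sum, Finset.sum_mul]
  · intro b al
    rw [Finset.mem_filter, Finset.mem_sdiff]
    tauto

/-- The coefficients obtained by applying the operators for all parts of `μ`. -/
noncomputable def coeffIter (mu : Finset ℕ) (g : Finset ℕ → MvPolynomial (Fin n) ℤ)
    (al : Finset ℕ) : MvPolynomial (Fin n) ℤ :=
  (-1) ^ (weight mu + mu.card * (mu.card - 1) / 2) *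
    ∑ be ∈ (Finset.Icc 1 n \ al).powersetCard mu.card,
      (-1) ^ (weight be + ∑ b ∈ be, numGT al b) * schurDet n be mu * g (al ∪ be)

/-- The number of elements of `S` that are smaller than `b`. -/
def numLT (S : Finset ℕ) (b : ℕ) : ℕ := (S.filter fun c => c < b).card

theorem numLT_add_numGT {S : Finset ℕ} {b : ℕ} (hb : b ∈ S) :
    numLT S b + numGT S b + 1 = S.card := by
  rw [numLT, numGT, ← Finset.card_union_of_disjoint]
  · rw [← Finset.card_erase_add_one hb]
    congr 2
    ext c
    simp only [Finset.mem_union, Finset.mem_filter, Finset.mem_erase, ne_eq]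
    constructor
    · rintro (⟨h1, h2⟩ | ⟨h1, h2⟩)
      · exact ⟨by omega, h1⟩
      · exact ⟨by omega, h1⟩
    · rintro ⟨h1, h2⟩
      rcases Nat.lt_or_gt_of_ne h1 with h | h
      · exact Or.inl ⟨h2, h⟩
      · exact Or.inr ⟨h2, h⟩
  · rw [Finset.disjoint_left]
    intro c h1 h2
    rw [Finset.mem_filter] at h1 h2
    omega

theorem sum_powersetCard_succ {ι M : Type*} [DecidableEq ι] [AddCommMonoid M] (U : Finset ι)
    (k : ℕ) (f : ι → Finset ι → M) :
    ∑ b ∈ U, ∑ be ∈ (U.erase b).powersetCard k, f b be =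
      ∑ be ∈ U.powersetCard (k + 1), ∑ b ∈ be, f b (be.erase b) := by
  rw [Finset.sum_sigma', Finset.sum_sigma']
  refine Finset.sum_bij' (fun p _ => ⟨insert p.1 p.2, p.1⟩) (fun p _ => ⟨p.2, p.1.erase p.2⟩)
    ?_ ?_ ?_ ?_ ?_
  · rintro ⟨b, be⟩ h
    simp only [Finset.mem_sigma, Finset.mem_powersetCard] at h ⊢
    obtain ⟨h1, h2, h3⟩ := h
    have h4 : b ∉ be := fun h => Finset.notMem_erase _ _ (h2 h)
    exact ⟨⟨Finset.insert_subset h1 (h2.trans (Finset.erase_subset _ _)), by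
      rw [Finset.card_insert_of_notMem h4, h3]⟩, Finset.mem_insert_self _ _⟩
  · rintro ⟨be, b⟩ h
    simp only [Finset.mem_sigma, Finset.mem_powersetCard] at h ⊢
    obtain ⟨⟨h1, h2⟩, h3⟩ := h
    exact ⟨h1 h3, Finset.erase_subset_erase _ h1, by rw [Finset.card_erase_of_mem h3, h2]; rfl⟩
  · rintro ⟨b, be⟩ h
    simp only [Finset.mem_sigma, Finset.mem_powersetCard] at h
    have h4 : b ∉ be := fun h' => Finset.notMem_erase _ _ (h.2.1 h')
    simp [Finset.erase_insert h4]
  · rintro ⟨be, b⟩ h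
    simp only [Finset.mem_sigma, Finset.mem_powersetCard] at h
    simp [Finset.insert_erase h.2]
  · rintro ⟨b, be⟩ h
    simp only [Finset.mem_sigma, Finset.mem_powersetCard] at h
    have h4 : b ∉ be := fun h' => Finset.notMem_erase _ _ (h.2.1 h')
    simp [Finset.erase_insert h4]

theorem triangle_succ (k : ℕ) : (k + 1) * (k + 1 - 1) / 2 = k * (k - 1) / 2 + k := by
  rw [← Finset.sum_range_id_mul_two, ← Finset.sum_range_id_mul_two, Nat.mul_div_cancel _ two_pos,
    Nat.mul_div_cancel _ two_pos, Finset.sum_range_succ]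

theorem sum_numGT_insert {al be : Finset ℕ} {b : ℕ} (hb : b ∉ al) :
    ∑ c ∈ be, numGT (insert b al) c = ∑ c ∈ be, numGT al c + numLT be b := by
  rw [numLT, Finset.card_filter, ← Finset.sum_add_distrib]
  refine Finset.sum_congr rfl fun c _ => ?_
  split_ifs with h
  · exact numGT_insert_of_lt hb h
  · rw [numGT_insert_of_le (not_lt.mp h), add_zero]

/-- Laplace expansion along the first column, which belongs to the largest part of `μ`. -/
theorem coeffStep_coeffIter {mu : Finset ℕ} {m : ℕ} (hm : ∀ b ∈ mu, b < m)
    (g : Finset ℕ → MvPolynomial (Fin n) ℤ) :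
    coeffStep n m (coeffIter n mu g) = coeffIter n (insert m mu) g := by
  have hm' : m ∉ mu := fun h => lt_irrefl _ (hm m h)
  funext al
  rw [coeffStep, coeffIter, Finset.card_insert_of_notMem hm', weight, Finset.sum_insert hm']
  simp only [coeffIter, Finset.mul_sum]
  have e1 : ∀ b, Finset.Icc 1 n \ insert b al = (Finset.Icc 1 n \ al).erase b := fun b => by
    ext c; simp only [Finset.mem_sdiff, Finset.mem_insert, Finset.mem_erase]; tauto
  simp only [e1]
  rw [sum_powersetCard_succ (f := fun b be => (-1) ^ (b + m) * elemSymm n (n - m) ((b : ℤ) - m) *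
    (-1) ^ numGT al b * ((-1) ^ (weight mu + mu.card * (mu.card - 1) / 2) *
      ((-1) ^ (weight be + ∑ c ∈ be, numGT (insert b al) c) * schurDet n be mu *
        g (insert b al ∪ be))))]
  refine Finset.sum_congr rfl fun be hbe => ?_
  rw [Finset.mem_powersetCard] at hbe
  rw [schurDet_insert_max n hm hbe.2, Finset.mul_sum, Finset.sum_mul, Finset.mul_sum]
  refine Finset.sum_congr rfl fun b hb => ?_
  have hbal : b ∉ al := (Finset.mem_sdiff.mp (hbe.1 hb)).2
  have e2 : insert b al ∪ be.erase b = al ∪ be := by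
    rw [Finset.insert_union, ← Finset.union_insert, Finset.insert_erase hb]
  have e3 : weight be = weight (be.erase b) + b := (Finset.sum_erase_add _ _ hb).symm
  have e4 : ∑ c ∈ be, numGT al c = ∑ c ∈ be.erase b, numGT al c + numGT al b :=
    (Finset.sum_erase_add _ _ hb).symm
  have e5 : numLT (be.erase b) b = numLT be b := by
    rw [numLT, numLT]; congr 1; ext c
    simp only [Finset.mem_filter, Finset.mem_erase]
    constructor
    · rintro ⟨⟨-, h1⟩, h2⟩; exact ⟨h1, h2⟩
    · rintro ⟨h1, h2⟩; exact ⟨⟨by omega, h1⟩, h2⟩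
  have e6 := numLT_add_numGT hb
  -- The Laplace sign counts the parts of `β` above `b`, the sign of the new intertwinings those
  -- below, and together they are the `k` other parts, which the triangular exponent accounts for.
  have e7 : mu.card = numLT be b + numGT be b := by omega
  rw [e2, sum_numGT_insert hbal, triangle_succ, e3, e4, e5]
  generalize hT : mu.card * (mu.card - 1) / 2 = t
  rw [e7]
  have e8 : (-1 : MvPolynomial (Fin n) ℤ) ^ numGT be b * (-1) ^ numGT be b = 1 := by
    rw [← mul_pow]; simp
  change _ = (-1) ^ (m + weight mu + _) * _
  simp only [pow_add]
  linear_combination -((-1) ^ b * (-1) ^ m * elemSymm n (n - m) ((b : ℤ) - m) *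
    (-1) ^ numGT al b * ((-1) ^ weight mu * (-1) ^ t * ((-1) ^ weight (be.erase b) *
      ((-1) ^ (∑ c ∈ be.erase b, numGT al c) * (-1) ^ numLT be b) * schurDet n (be.erase b) mu *
        g (al ∪ be)))) * e8

theorem coeffIter_empty (g : Finset ℕ → MvPolynomial (Fin n) ℤ) : coeffIter n ∅ g = g := by
  funext al
  simp [coeffIter, weight, schurDet_eq_det n Finset.card_empty]

theorem numLT_insert_max {S : Finset ℕ} {a b : ℕ} (hb : b ≤ a) :
    numLT (insert a S) b = numLT S b := by
  rw [numLT, Finset.filter_insert, if_neg hb.not_gt]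
  rfl

theorem numLT_max {S : Finset ℕ} {a : ℕ} (ha : ∀ b ∈ S, b < a) : numLT S a = S.card := by
  rw [numLT, Finset.filter_true_of_mem ha]

theorem refl_qCombination {i : ℕ} (hi : 1 ≤ i) (g : Finset ℕ → MvPolynomial (Fin n) ℤ) :
    refl n _ i (qCombination n g) = qCombination n g := by
  simp only [qCombination, map_sum, map_mul, refl_qPoly n _ hi]
  refine Finset.sum_congr rfl fun al _ => ?_
  congr 1
  exact AlgHom.commutes _ _

/-- The product of factorial powers `∏_i (x_i - y_1) ⋯ (x_i - y_{n-m_i})` over the elements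
`m_1 < m_2 < ⋯` of `μ`. -/
noncomputable def factProd (mu : Finset ℕ) : PolyXY n :=
  ∏ q ∈ mu, Polynomial.aeval (xvar n (MvPolynomial (Fin n) ℤ) (numLT mu q)) (factPow n (n - q))

theorem factProd_insert_max {mu : Finset ℕ} {m : ℕ} (hm : ∀ b ∈ mu, b < m) :
    factProd n (insert m mu) =
      Polynomial.aeval (xvar n (MvPolynomial (Fin n) ℤ) mu.card) (factPow n (n - m)) *
        factProd n mu := by
  have hm' : m ∉ mu := fun h => lt_irrefl _ (hm m h)
  rw [factProd, Finset.prod_insert hm', numLT_insert_max le_rfl, numLT_max hm]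
  congr 1
  exact Finset.prod_congr rfl fun q hq => by rw [numLT_insert_max (hm q hq).le]

theorem refl_aeval_xvar {A : Type*} [CommRing A] {i j : ℕ} (h1 : j ≠ i) (h2 : j + 1 ≠ i)
    (p : Polynomial A) : refl n A i (Polynomial.aeval (xvar n A j) p) =
      Polynomial.aeval (xvar n A j) p := by
  rw [← Polynomial.aeval_algHom_apply, refl_xvar_of_ne h1 h2]

theorem refl_factProd {mu : Finset ℕ} {i : ℕ} (hi : mu.card < i) :
    refl n _ i (factProd n mu) = factProd n mu := by
  rw [factProd, map_prod]
  refine Finset.prod_congr rfl fun q hq => ?_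
  have := numLT_add_numGT hq
  exact refl_aeval_xvar n (by omega) (by omega) _

/-- The largest part of `μ` belongs to the variable with the largest index, hence to the operator
applied last. -/
theorem fullChain_pow_factProd {mu : Finset ℕ} (hmu : mu ⊆ Finset.Icc 1 n)
    (g : Finset ℕ → MvPolynomial (Fin n) ℤ) :
    (fullChain n (MvPolynomial (Fin n) ℤ) ^ mu.card) (factProd n mu * qCombination n g) =
      qCombination n (coeffIter n mu g) := by
  induction mu using Finset.induction_on_max with
  | empty => simp [factProd, coeffIter_empty]
  | insert m mu hm ih =>
    have hm' : m ∉ mu := fun h => lt_irrefl _ (hm m h)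
    have hmn := Finset.mem_Icc.mp (hmu (Finset.mem_insert_self m mu))
    have hc := Finset.card_le_card hmu
    rw [Finset.card_insert_of_notMem hm', Nat.card_Icc] at hc
    rw [Finset.card_insert_of_notMem hm', factProd_insert_max n hm, mul_assoc,
      fullChain_pow_succ_mul (by omega), ih ((Finset.subset_insert _ _).trans hmu),
      fullChain_factPow_mul n hmn.1 hmn.2, coeffStep_coeffIter n hm]
    · intro i hi
      rw [ddiff_eq_zero_iff, map_mul, refl_factProd n hi, refl_qCombination n (by omega)]
    · rw [degree_factPow]
      exact_mod_cast (by omega : n - m < n)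

end Iteration

end DoubleSchubert

namespace DoubleSchubert

open MvPolynomial

/-! ### The product `Δ(X, Y)` -/

section Staircase

variable (n : ℕ)

/-- The product of the factorial powers of `x_{k+1}, …, x_{k+L}` with exponents `L, …, 1`. -/
noncomputable def staircase : ℕ → ℕ → PolyXY n
  | _, 0 => 1
  | k, L + 1 => Polynomial.aeval (xvar n (MvPolynomial (Fin n) ℤ) k) (factPow n (L + 1)) *
      staircase (k + 1) L

theorem staircase_eq_mul (k L : ℕ) : staircase n k L =
    Polynomial.aeval (xvar n (MvPolynomial (Fin n) ℤ) k) (factPow n L) *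
      staircase n (k + 1) (L - 1) := by
  rcases L with _ | L
  · simp [staircase, factPow]
  · rfl

theorem staircase_eq_prod (k L m : ℕ) : staircase n k L =
    (∏ i ∈ Finset.range m, Polynomial.aeval (xvar n (MvPolynomial (Fin n) ℤ) (k + i))
      (factPow n (L - i))) * staircase n (k + m) (L - m) := by
  induction m with
  | zero => simp
  | succ m ih =>
    rw [ih, Finset.prod_range_succ, staircase_eq_mul n (k + m) (L - m), mul_assoc, ← add_assoc,
      Nat.sub_sub]

theorem deltaXY_eq_staircase : deltaXY n = staircase n 0 (n - 1) := by
  rw [staircase_eq_prod n 0 (n - 1) n, Nat.sub_eq_zero_of_le (Nat.sub_le n 1), staircase, mul_one,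
    deltaXY, Finset.prod_filter, Fintype.prod_prod_type]
  set x := xvar n (MvPolynomial (Fin n) ℤ)
  have e1 : ∀ i j : Fin n,
      (inX (X i) - inY (X j) : PolyXY n) = x i - C (xvar n ℤ j) := fun i j => by
    simp only [inX, inY, x, map_X, xvar_of_lt i.2, xvar_of_lt j.2]
  simp only [e1]
  have e2 : ∀ i : Fin n, (∏ j : Fin n, if (i : ℕ) + 1 + (j + 1) ≤ n then x i - C (xvar n ℤ j)
      else 1)
      = Polynomial.aeval (x i) (factPow n (n - 1 - i)) := fun i => by
    rw [Fin.prod_univ_eq_prod_range (fun j => if (i : ℕ) + 1 + (j + 1) ≤ n then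
      x i - C (xvar n ℤ j) else 1), ← Finset.prod_filter, factPow, map_prod]
    refine Finset.prod_congr ?_ fun j _ => ?_
    · ext j
      simp only [Finset.mem_filter, Finset.mem_range]
      omega
    · rw [map_sub, Polynomial.aeval_X, Polynomial.aeval_C, algebraMap_eq]
  simp only [e2]
  rw [Fin.prod_univ_eq_prod_range (fun i => Polynomial.aeval (x i) (factPow n (n - 1 - i)))]
  simp only [Nat.zero_add]

theorem refl_staircase {i k : ℕ} (h : i < k) (L : ℕ) :
    refl n _ i (staircase n k L) = staircase n k L := by
  induction L generalizing k with
  | zero => exact map_one _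
  | succ L ih =>
    rw [staircase, map_mul, ih (by omega), refl_aeval_xvar n (by omega) (by omega)]

theorem ddiff_factPow_mul {k L : ℕ} (h : k + 1 < n) :
    ddiff n _ (k + 1) (Polynomial.aeval (xvar n (MvPolynomial (Fin n) ℤ) k) (factPow n (L + 1)) *
      staircase n (k + 1) L) =
    -(Polynomial.aeval (xvar n (MvPolynomial (Fin n) ℤ) k) (factPow n L) *
      staircase n (k + 1) L) := by
  set F := fun j => Polynomial.aeval (xvar n (MvPolynomial (Fin n) ℤ) j) (factPow n L) with hF
  have hsym : refl n _ (k + 1) (F k * F (k + 1)) = F k * F (k + 1) := by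
    simp only [hF]
    rw [map_mul, ← Polynomial.aeval_algHom_apply, ← Polynomial.aeval_algHom_apply,
      refl_succ_xvar h, refl_succ_xvar_succ h, mul_comm]
  have e1 : Polynomial.aeval (xvar n (MvPolynomial (Fin n) ℤ) k) (factPow n (L + 1)) =
      F k * (xvar n _ k - C (xvar n ℤ L)) := by
    rw [factPow, Finset.prod_range_succ, map_mul, map_sub, Polynomial.aeval_X, Polynomial.aeval_C]
    rfl
  have e2 : ddiff n _ (k + 1) (C (xvar n ℤ L) : PolyXY n) = 0 :=
    ddiff_eq_zero_iff.mpr (AlgHom.commutes _ _)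
  rw [staircase_eq_mul n (k + 1), e1,
    show F k * (xvar n _ k - C (xvar n ℤ L)) * (F (k + 1) * staircase n (k + 1 + 1) (L - 1)) =
      (F k * F (k + 1)) * (staircase n (k + 1 + 1) (L - 1) * (xvar n _ k - C (xvar n ℤ L))) by ring,
    ddiff_mul_of_refl_eq hsym, ddiff_mul_of_refl_eq (refl_staircase n (by omega) _), map_sub, e2,
    ddiff_succ_xvar h]
  ring

/-- The chain of divided differences deletes the largest exponent of the staircase. -/
theorem chain_staircase {k L : ℕ} (h : k + L < n) :
    chain n _ (k + 1) L (staircase n k L) = (-1) ^ L * staircase n k (L - 1) := by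
  induction L generalizing k with
  | zero => simp [chain, staircase]
  | succ L ih =>
    have e : ∀ f : PolyXY n, chain n _ (k + 1 + 1) L (-f) = -chain n _ (k + 1 + 1) L f :=
      fun f => map_neg _ f
    rw [chain_succ', Module.End.mul_apply, staircase, ddiff_factPow_mul n (by omega), e,
      chain_mul_of_refl_eq fun i hi _ => refl_aeval_xvar n (by omega) (by omega) _,
      ih (by omega), Nat.add_sub_cancel, staircase_eq_mul n k L, pow_succ]
    ring

/-! ### The operator of the reduced word on `Δ(X, Y)` -/

/-- The number of elements of `{1, …, p}` that are not parts of `λ`. -/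
def coCount (lam : Finset ℕ) (p : ℕ) : ℕ := (Finset.Icc 1 p \ lam).card

theorem coCount_succ (lam : Finset ℕ) (p : ℕ) :
    coCount lam (p + 1) = coCount lam p + if p + 1 ∈ lam then 0 else 1 := by
  have h : Finset.Icc 1 (p + 1) = insert (p + 1) (Finset.Icc 1 p) := by
    ext c; simp only [Finset.mem_Icc, Finset.mem_insert]; omega
  rw [coCount, coCount, h]
  split_ifs with h1
  · rw [Finset.insert_sdiff_of_mem _ h1, add_zero]
  · rw [Finset.insert_sdiff_of_notMem _ h1, Finset.card_insert_of_notMem]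
    simp

theorem coCount_le (lam : Finset ℕ) (p : ℕ) : coCount lam p ≤ p :=
  (Finset.card_le_card Finset.sdiff_subset).trans (by simp)

/-- The operator of the inverse of the permutation with one-line notation
`(μ_k, …, μ_1, λ_1, …, λ_ℓ)`, `μ = λ'`, built up by running through the parts of `λ` that are at
most `p`. -/
noncomputable def sortOp (lam : Finset ℕ) : ℕ → Module.End (MvPolynomial (Fin n) ℤ) (PolyXY n)
  | 0 => 1
  | p + 1 => if p + 1 ∈ lam then chain n _ (coCount lam p + 1) (n - (p + 1)) * sortOp lam p
      else sortOp lam p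

/-- The parts of `λ` shorten the staircase, and the other elements of `{1, …, n}` split off its
first factor. -/
theorem sortOp_deltaXY (lam : Finset ℕ) {p : ℕ} (hp : p ≤ n)
    (g : Finset ℕ → MvPolynomial (Fin n) ℤ) :
    sortOp n lam p (deltaXY n * qCombination n g) =
      (-1) ^ (∑ q ∈ Finset.Icc 1 p with q ∈ lam, (n - q)) *
        (factProd n (Finset.Icc 1 p \ lam) * staircase n (coCount lam p) (n - p - 1) *
          qCombination n g) := by
  induction p with
  | zero =>
    simp [sortOp, deltaXY_eq_staircase, coCount, factProd]
  | succ p ih =>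
    have h : Finset.Icc 1 (p + 1) = insert (p + 1) (Finset.Icc 1 p) := by
      ext c; simp only [Finset.mem_Icc, Finset.mem_insert]; omega
    have h' : p + 1 ∉ Finset.Icc 1 p := by simp
    have hc := coCount_le lam p
    rw [sortOp, coCount_succ, h, Finset.filter_insert]
    split_ifs with hl
    · rw [Module.End.mul_apply, ih (by omega), Finset.sum_insert (by simp),
        Finset.insert_sdiff_of_mem _ hl, add_zero,
        chain_mul_of_refl_eq fun i _ _ => by rw [map_pow, map_neg, map_one],
        mul_right_comm,
        chain_mul_of_refl_eq fun i hi _ => ?_,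
        show n - p - 1 = n - (p + 1) by omega, chain_staircase n (by omega), pow_add]
      · ring
      · rw [map_mul, refl_factProd n (by rw [coCount] at hi; omega),
          refl_qCombination n (by omega)]
    · rw [ih (by omega), Finset.insert_sdiff_of_notMem _ hl, factProd_insert_max, ← coCount,
        staircase_eq_mul n (coCount lam p), show n - p - 1 = n - (p + 1) by omega]
      · ring
      · intro b hb
        have := Finset.mem_Icc.mp (Finset.mem_sdiff.mp hb).1
        omega

end Staircase

end DoubleSchubert

namespace DoubleSchubert

/-! ### Signed permutations as functions on natural numbers -/

namespace SignedPerm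

variable {n : ℕ}

/-- The letter to which `u` sends the letter `j`, the identity outside `{0, …, n - 1}`. -/
def img (u : SignedPerm n) (j : ℕ) : ℕ := if h : j < n then u.perm ⟨j, h⟩ else j

/-- The sign with which `u` acts on the letter `j`. -/
def sgn (u : SignedPerm n) (j : ℕ) : ℤˣ := if h : j < n then u.sign ⟨j, h⟩ else 1

theorem img_of_lt (u : SignedPerm n) {j : ℕ} (h : j < n) : u.img j = u.perm ⟨j, h⟩ := by
  simp [img, h]

theorem sgn_of_lt (u : SignedPerm n) {j : ℕ} (h : j < n) : u.sgn j = u.sign ⟨j, h⟩ := by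
  simp [sgn, h]

theorem img_lt (u : SignedPerm n) {j : ℕ} (h : j < n) : u.img j < n := by
  rw [img_of_lt u h]; exact Fin.isLt _

theorem img_mul (u v : SignedPerm n) (j : ℕ) : (u * v).img j = u.img (v.img j) := by
  by_cases h : j < n
  · rw [img_of_lt _ h, img_of_lt u (img_lt v h), mul_perm, Equiv.Perm.mul_apply]
    simp [img_of_lt v h]
  · simp [img, h]

theorem sgn_mul (u v : SignedPerm n) (j : ℕ) :
    (u * v).sgn j = v.sgn j * u.sgn (v.img j) := by
  by_cases h : j < n
  · rw [sgn_of_lt _ h, sgn_of_lt _ h, sgn_of_lt u (img_lt v h), mul_sign]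
    simp [img_of_lt v h]
  · simp [img, sgn, h]

theorem ext_img {u v : SignedPerm n} (h1 : ∀ j < n, u.img j = v.img j)
    (h2 : ∀ j < n, u.sgn j = v.sgn j) : u = v := by
  ext j
  · have := h1 j j.2
    rwa [img_of_lt _ j.2, img_of_lt _ j.2] at this
  · have := h2 j j.2
    rw [sgn_of_lt _ j.2, sgn_of_lt _ j.2] at this
    exact congrArg Units.val this

theorem img_one (j : ℕ) : (1 : SignedPerm n).img j = j := by
  simp [img]

theorem sgn_one (j : ℕ) : (1 : SignedPerm n).sgn j = 1 := by
  simp [sgn]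

theorem img_injective (u : SignedPerm n) : Function.Injective u.img := by
  intro a b h
  have h' := congrArg (u⁻¹).img h
  rwa [← img_mul, ← img_mul, inv_mul_cancel, img_one, img_one] at h'

/-- The generator `s_i`, and the identity for `i ≥ n`. -/
def gen (n i : ℕ) : SignedPerm n := if h : i < n then simple ⟨i, h⟩ else 1

theorem gen_of_lt {i : ℕ} (h : i < n) : gen n i = simple ⟨i, h⟩ := by simp [gen, h]

theorem img_gen_zero (j : ℕ) : (gen n 0).img j = j := by
  by_cases h : 0 < n
  · simp [gen, h, img, simple]
  · simp [gen, h, img]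

theorem sgn_gen_zero (hn : 0 < n) (j : ℕ) : (gen n 0).sgn j = if j = 0 then -1 else 1 := by
  simp only [gen, hn, sgn, simple, dite_true, if_true, Fin.mk.injEq]
  split_ifs <;> first | rfl | omega

theorem img_gen_succ {i : ℕ} (h : i + 1 < n) (j : ℕ) :
    (gen n (i + 1)).img j = if j = i then i + 1 else if j = i + 1 then i else j := by
  simp only [gen, h, img, simple, dite_true, Nat.add_one_ne_zero, if_false, Nat.add_sub_cancel,
    Equiv.swap_apply_def, Fin.mk.injEq]
  split_ifs <;> first | rfl | omega

theorem sgn_gen_succ {i : ℕ} (h : i + 1 < n) (j : ℕ) : (gen n (i + 1)).sgn j = 1 := by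
  simp [gen, h, sgn, simple]

theorem gen_mul_self (i : ℕ) : gen n i * gen n i = 1 := by
  rcases Nat.lt_or_ge i n with h | h
  swap
  · simp [gen, not_lt.mpr h]
  rcases i with _ | i
  · refine ext_img (fun j _ => ?_) fun j _ => ?_
    · simp only [img_mul, img_gen_zero, img_one]
    · simp only [sgn_mul, img_gen_zero, sgn_gen_zero h, sgn_one]
      split_ifs <;> simp
  · refine ext_img (fun j _ => ?_) fun j _ => ?_
    · simp only [img_mul, img_gen_succ h, img_one]
      split_ifs <;> omega
    · simp only [sgn_mul, sgn_gen_succ h, sgn_one, mul_one]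

theorem gen_inv (i : ℕ) : (gen n i)⁻¹ = gen n i := inv_eq_of_mul_eq_one_left (gen_mul_self i)

theorem gen_comm {i j : ℕ} (h : i + 2 ≤ j) (hj : j < n) :
    gen n i * gen n j = gen n j * gen n i := by
  obtain ⟨j, rfl⟩ : ∃ k, j = k + 1 := ⟨j - 1, by omega⟩
  rcases i with _ | i
  · refine ext_img (fun a _ => ?_) fun a _ => ?_
    · simp only [img_mul, img_gen_zero]
    · simp only [sgn_mul, img_gen_zero, sgn_gen_zero (n := n) (by omega), sgn_gen_succ hj,
        img_gen_succ hj, one_mul, mul_one]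
      grind
  · have hi : i + 1 < n := by omega
    refine ext_img (fun a _ => ?_) fun a _ => ?_
    · simp only [img_mul, img_gen_succ hi, img_gen_succ hj]
      split_ifs <;> omega
    · simp only [sgn_mul, sgn_gen_succ hi, sgn_gen_succ hj]

theorem gen_braid_three {i : ℕ} (hi : 1 ≤ i) (h : i + 1 < n) :
    gen n i * gen n (i + 1) * gen n i = gen n (i + 1) * gen n i * gen n (i + 1) := by
  obtain ⟨i, rfl⟩ : ∃ k, i = k + 1 := ⟨i - 1, by omega⟩
  have hi' : i + 1 < n := by omega
  refine ext_img (fun a _ => ?_) fun a _ => ?_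
  · simp only [img_mul, img_gen_succ h, img_gen_succ hi']
    split_ifs <;> omega
  · simp only [sgn_mul, sgn_gen_succ h, sgn_gen_succ hi']

theorem gen_braid_four (h : 1 < n) :
    gen n 0 * gen n 1 * gen n 0 * gen n 1 = gen n 1 * gen n 0 * gen n 1 * gen n 0 := by
  have e1 := img_gen_succ (i := 0) h
  have e2 := sgn_gen_succ (i := 0) h
  rw [Nat.zero_add] at e1 e2
  refine ext_img (fun a _ => ?_) fun a _ => ?_
  · simp only [img_mul, img_gen_zero, e1]
  · simp only [sgn_mul, img_gen_zero, sgn_gen_zero (n := n) (by omega), e1, e2, one_mul, mul_one]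
    grind

/-! ### The length of a signed permutation -/

/-- The entry at `j` of the one-line notation of `u`, a nonzero integer. -/
def entry (u : SignedPerm n) (j : ℕ) : ℤ := (u.sgn j : ℤ) * (u.img j + 1)

/-- The number of inversions plus the sum of the absolute values of the negative entries. -/
def len (u : SignedPerm n) : ℕ :=
  ∑ a ∈ Finset.range n, ((Finset.range n).filter fun b => a < b ∧ u.entry b < u.entry a).card +
    ∑ a ∈ Finset.range n, if u.sgn a = -1 then u.img a + 1 else 0

/-- The generator `s_i` is a right descent of `u`. -/
def Desc (u : SignedPerm n) (i : ℕ) : Prop :=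
  if i = 0 then u.entry 0 < 0 else u.entry i < u.entry (i - 1)

theorem entry_mul_gen_zero (hn : 0 < n) (u : SignedPerm n) (j : ℕ) :
    (u * gen n 0).entry j = if j = 0 then -u.entry 0 else u.entry j := by
  simp only [entry, sgn_mul, img_mul, img_gen_zero, sgn_gen_zero hn]
  split_ifs with h
  · subst h; simp
  · simp

theorem entry_mul_gen_succ {i : ℕ} (hi : i + 1 < n) (u : SignedPerm n) (j : ℕ) :
    (u * gen n (i + 1)).entry j =
      if j = i then u.entry (i + 1) else if j = i + 1 then u.entry i else u.entry j := by
  simp only [entry, sgn_mul, img_mul, img_gen_succ hi, sgn_gen_succ hi, one_mul]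
  split_ifs <;> rfl

theorem natAbs_entry (u : SignedPerm n) (j : ℕ) : (u.entry j).natAbs = u.img j + 1 := by
  rcases Int.units_eq_one_or (u.sgn j) with h | h <;> simp [entry, h] <;> omega

theorem entry_injective (u : SignedPerm n) : Function.Injective u.entry := fun a b h => by
  have h' := congrArg Int.natAbs h
  rw [natAbs_entry, natAbs_entry] at h'
  exact u.img_injective (by omega)

theorem entry_neg_iff (u : SignedPerm n) (j : ℕ) : u.entry j < 0 ↔ u.sgn j = -1 := by
  rcases Int.units_eq_one_or (u.sgn j) with h | h
  · simp [entry, h]; omega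
  · simp [entry, h]; omega

theorem sum_range_image (u : SignedPerm n) (f : ℕ → ℕ) :
    ∑ a ∈ Finset.range n, f (u.img a) = ∑ a ∈ Finset.range n, f a := by
  refine Finset.sum_bij' (fun a _ => u.img a) (fun a _ => (u⁻¹).img a) ?_ ?_ ?_ ?_ fun _ _ => rfl
  · intro a ha; exact Finset.mem_range.mpr (img_lt u (Finset.mem_range.mp ha))
  · intro a ha; exact Finset.mem_range.mpr (img_lt _ (Finset.mem_range.mp ha))
  · intro a _; rw [← img_mul, inv_mul_cancel, img_one]
  · intro a _; rw [← img_mul, mul_inv_cancel, img_one]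

theorem len_mul_gen_zero (hn : 0 < n) (u : SignedPerm n) (h : ¬ Desc u 0) :
    (u * gen n 0).len = u.len + 1 := by
  have h0 : u.sgn 0 = 1 := by
    rcases Int.units_eq_one_or (u.sgn 0) with h' | h'
    · exact h'
    · exact absurd (by rwa [Desc, if_pos rfl, entry_neg_iff]) h
  have he : u.entry 0 = u.img 0 + 1 := by simp [entry, h0]
  obtain ⟨m, rfl⟩ : ∃ m, n = m + 1 := ⟨n - 1, by omega⟩
  have hv0 : (u * gen (m + 1) 0).sgn 0 = -1 := by
    rw [sgn_mul, img_gen_zero, sgn_gen_zero hn, if_pos rfl, h0, mul_one]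
  have hv1 : ∀ j, (u * gen (m + 1) 0).sgn (j + 1) = u.sgn (j + 1) := fun j => by
    rw [sgn_mul, img_gen_zero, sgn_gen_zero hn, if_neg (Nat.succ_ne_zero j), one_mul]
  have hvi : ∀ j, (u * gen (m + 1) 0).img j = u.img j := fun j => by rw [img_mul, img_gen_zero]
  -- If the first entry is `c > 0`, negating it destroys the `c - 1` inversions with the entries of
  -- absolute value less than `c`, while `c` is added to the sum of the negative entries.
  have hcard : ((Finset.range (m + 1)).filter fun b => 0 < b ∧ u.entry b < u.entry 0).card =
      ((Finset.range (m + 1)).filter fun b => 0 < b ∧ u.entry b < -u.entry 0).card + u.img 0 := by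
    have h1 : ((Finset.range (m + 1)).filter fun b => u.img b < u.img 0).card = u.img 0 := by
      rw [Finset.card_filter, sum_range_image u fun a => if a < u.img 0 then 1 else 0,
        ← Finset.card_filter]
      have h2 : (Finset.range (m + 1)).filter (fun a => a < u.img 0) = Finset.range (u.img 0) := by
        have := img_lt u hn
        ext a; simp only [Finset.mem_filter, Finset.mem_range]; omega
      rw [h2, Finset.card_range]
    conv_rhs => rw [← h1]
    rw [← Finset.card_union_of_disjoint]
    · congr 1
      ext b
      have hb := natAbs_entry u b
      have hb2 : u.img b = u.img 0 ↔ b = 0 := u.img_injective.eq_iff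
      simp only [Finset.mem_filter, Finset.mem_union, Finset.mem_range]
      omega
    · rw [Finset.disjoint_left]
      intro b h1 h2
      have hb := natAbs_entry u b
      simp only [Finset.mem_filter, Finset.mem_range] at h1 h2
      omega
  have hrest : ∀ a, ((Finset.range (m + 1)).filter fun b => a + 1 < b ∧
      (u * gen (m + 1) 0).entry b < (u * gen (m + 1) 0).entry (a + 1)).card =
      ((Finset.range (m + 1)).filter fun b => a + 1 < b ∧ u.entry b < u.entry (a + 1)).card := by
    intro a
    congr 1
    refine Finset.filter_congr fun b _ => ?_
    rw [entry_mul_gen_zero hn, entry_mul_gen_zero hn, if_neg (Nat.succ_ne_zero a)]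
    by_cases hb : b = 0
    · subst hb; simp
    · rw [if_neg hb]
  have hfirst : ((Finset.range (m + 1)).filter fun b => 0 < b ∧
      (u * gen (m + 1) 0).entry b < (u * gen (m + 1) 0).entry 0) =
      (Finset.range (m + 1)).filter fun b => 0 < b ∧ u.entry b < -u.entry 0 := by
    refine Finset.filter_congr fun b _ => ?_
    rw [entry_mul_gen_zero hn, entry_mul_gen_zero hn, if_pos rfl]
    by_cases hb : b = 0
    · subst hb; simp
    · rw [if_neg hb]
  rw [len, len, Finset.sum_range_succ', Finset.sum_range_succ', Finset.sum_range_succ',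
    Finset.sum_range_succ']
  simp only [hrest, hfirst, hv0, hv1, hvi, h0, hcard, if_true]
  rw [if_neg (by decide)]
  omega

theorem len_mul_gen_succ {i : ℕ} (hi : i + 1 < n) (u : SignedPerm n) (h : ¬ Desc u (i + 1)) :
    (u * gen n (i + 1)).len = u.len + 1 := by
  have hlt : u.entry i < u.entry (i + 1) := by
    rw [Desc, if_neg (Nat.succ_ne_zero i), Nat.add_sub_cancel, not_lt] at h
    exact lt_of_le_of_ne h fun e => by have := u.entry_injective e; omega
  set s := gen n (i + 1) with hs
  have hss : ∀ j, s.img (s.img j) = j := fun j => by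
    rw [← img_mul, hs, gen_mul_self, img_one]
  have hsgn : ∀ j, (u * s).sgn j = u.sgn (s.img j) := fun j => by
    rw [sgn_mul, hs, sgn_gen_succ hi, one_mul]
  have hent : ∀ j, (u * s).entry j = u.entry (s.img j) := fun j => by
    rw [entry, hsgn, img_mul, entry]
  have himg : ∀ j, s.img j = if j = i then i + 1 else if j = i + 1 then i else j :=
    img_gen_succ hi
  have e2 : (∑ a ∈ Finset.range n, if (u * s).sgn a = -1 then (u * s).img a + 1 else 0) =
      ∑ a ∈ Finset.range n, if u.sgn a = -1 then u.img a + 1 else 0 := by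
    rw [← sum_range_image s fun a => if u.sgn a = -1 then u.img a + 1 else 0]
    simp only [hsgn, img_mul]
  have hinv : ∀ v : SignedPerm n,
      ∑ a ∈ Finset.range n, ((Finset.range n).filter fun b => a < b ∧ v.entry b < v.entry a).card =
      ((Finset.range n ×ˢ Finset.range n).filter
        fun p : ℕ × ℕ => p.1 < p.2 ∧ v.entry p.2 < v.entry p.1).card := by
    intro v
    simp only [Finset.card_filter]
    rw [Finset.sum_product]
  rw [len, len, e2, hinv, hinv]
  set I := (Finset.range n ×ˢ Finset.range n).filter
    fun p : ℕ × ℕ => p.1 < p.2 ∧ u.entry p.2 < u.entry p.1 with hI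
  -- The inversions of `u * s` are those of `u`, relabelled by `s`, and the new one `(i, i + 1)`.
  have e3 : ((Finset.range n ×ˢ Finset.range n).filter
      fun p : ℕ × ℕ => p.1 < p.2 ∧ (u * s).entry p.2 < (u * s).entry p.1) =
      insert (i, i + 1) (I.image fun p => (s.img p.1, s.img p.2)) := by
    ext ⟨a, b⟩
    simp only [hI, hent, Finset.mem_filter, Finset.mem_product, Finset.mem_range,
      Finset.mem_insert, Finset.mem_image, Prod.mk.injEq, Prod.exists]
    constructor
    · rintro ⟨⟨ha, hb⟩, hab, hlt'⟩
      by_cases hp : a = i ∧ b = i + 1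
      · exact Or.inl hp
      · refine Or.inr ⟨s.img a, s.img b, ⟨⟨img_lt _ ha, img_lt _ hb⟩, ?_, hlt'⟩, hss a, hss b⟩
        rw [himg, himg]
        split_ifs <;> omega
    · rintro (⟨rfl, rfl⟩ | ⟨a', b', ⟨⟨ha, hb⟩, hab, hlt'⟩, rfl, rfl⟩)
      · refine ⟨⟨by omega, by omega⟩, by omega, ?_⟩
        rw [himg, himg, if_pos rfl, if_neg (by omega), if_pos rfl]
        exact hlt
      · refine ⟨⟨img_lt _ ha, img_lt _ hb⟩, ?_, by rwa [hss, hss]⟩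
        have hp : ¬ (a' = i ∧ b' = i + 1) := by
          rintro ⟨rfl, rfl⟩; omega
        rw [himg, himg]
        split_ifs <;> omega
  rw [e3, Finset.card_insert_of_notMem, Finset.card_image_of_injective]
  · omega
  · rintro ⟨a, b⟩ ⟨a', b'⟩ hp
    simp only [Prod.mk.injEq] at hp ⊢
    exact ⟨s.img_injective hp.1, s.img_injective hp.2⟩
  · intro hmem
    obtain ⟨⟨a, b⟩, hp, hab⟩ := Finset.mem_image.mp hmem
    simp only [hI, Finset.mem_filter, Prod.mk.injEq] at hp hab
    obtain ⟨h1, h2⟩ := hab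
    rw [himg] at h1 h2
    have := hp.2.1
    split_ifs at h1 h2 <;> omega

theorem desc_mul_gen_self {i : ℕ} (hi : i < n) (u : SignedPerm n) :
    Desc (u * gen n i) i ↔ ¬ Desc u i := by
  rcases i with _ | i
  · have := natAbs_entry u 0
    simp only [Desc, if_true, entry_mul_gen_zero hi]
    omega
  · have : u.entry (i + 1) ≠ u.entry i := fun e => by have := u.entry_injective e; omega
    simp only [Desc, Nat.add_one_ne_zero, if_false, entry_mul_gen_succ hi, Nat.add_sub_cancel,
      if_true, if_neg (show i + 1 ≠ i by omega)]
    omega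

theorem len_mul_gen_of_not_desc {i : ℕ} (hi : i < n) {u : SignedPerm n} (h : ¬ Desc u i) :
    (u * gen n i).len = u.len + 1 := by
  rcases i with _ | i
  · exact len_mul_gen_zero hi u h
  · exact len_mul_gen_succ hi u h

theorem len_mul_gen_of_desc {i : ℕ} (hi : i < n) {u : SignedPerm n} (h : Desc u i) :
    (u * gen n i).len + 1 = u.len := by
  have h' : ¬ Desc (u * gen n i) i := by rw [desc_mul_gen_self hi, not_not]; exact h
  rw [← len_mul_gen_of_not_desc hi h', mul_assoc, gen_mul_self, mul_one]

/-- Without descents the entries are positive and increasing. -/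
theorem eq_one_of_forall_not_desc {u : SignedPerm n} (h : ∀ i < n, ¬ Desc u i) : u = 1 := by
  have hpos : ∀ j < n, 0 < u.entry j := by
    intro j hj
    induction j with
    | zero =>
      have h1 := h 0 hj
      have h2 := natAbs_entry u 0
      rw [Desc, if_pos rfl] at h1
      omega
    | succ j ih =>
      have h1 := h (j + 1) hj
      rw [Desc, if_neg (Nat.succ_ne_zero j), Nat.add_sub_cancel] at h1
      have := ih (by omega)
      omega
  have hsgn : ∀ j < n, u.sgn j = 1 := fun j hj => by
    rcases Int.units_eq_one_or (u.sgn j) with h' | h'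
    · exact h'
    · have := (entry_neg_iff u j).mpr h'
      have := hpos j hj
      omega
  have hlt : ∀ j, j + 1 < n → u.img j < u.img (j + 1) := by
    intro j hj
    have h1 := h (j + 1) hj
    rw [Desc, if_neg (Nat.succ_ne_zero j), Nat.add_sub_cancel, not_lt, entry, entry,
      hsgn j (by omega), hsgn (j + 1) hj] at h1
    have h2 : u.img j ≠ u.img (j + 1) := fun e => by have := u.img_injective e; omega
    simp at h1
    omega
  have hge : ∀ j < n, j ≤ u.img j := by
    intro j hj
    induction j with
    | zero => omega
    | succ j ih => have := hlt j hj; have := ih (by omega); omega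
  have hle : ∀ k, ∀ j, j + k + 1 = n → u.img j ≤ j := by
    intro k
    induction k with
    | zero => intro j hj; have := img_lt u (show j < n by omega); omega
    | succ k ih => intro j hj; have := ih (j + 1) (by omega); have := hlt j (by omega); omega
  refine ext_img (fun j hj => ?_) fun j hj => by rw [hsgn j hj, sgn_one]
  rw [img_one]
  exact le_antisymm (hle (n - j - 1) j (by omega)) (hge j hj)

theorem len_one : (1 : SignedPerm n).len = 0 := by
  simp only [len, Nat.add_eq_zero_iff, Finset.sum_eq_zero_iff, Finset.card_eq_zero,
    Finset.filter_eq_empty_iff]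
  constructor
  · intro a _ b _
    simp only [entry, sgn_one, img_one]
    simp
    omega
  · intro a _
    rw [sgn_one, if_neg (by decide)]

theorem wordProd_cons (i : Fin n) (a : List (Fin n)) :
    wordProd (i :: a) = gen n i * wordProd a := by
  rw [gen_of_lt i.2]; simp [wordProd]

theorem wordProd_append (a b : List (Fin n)) : wordProd (a ++ b) = wordProd a * wordProd b := by
  simp [wordProd]

theorem len_inv_wordProd_le (a : List (Fin n)) : (wordProd a)⁻¹.len ≤ a.length := by
  induction a with
  | nil => simp [wordProd, len_one]
  | cons i a ih =>
    rw [wordProd_cons, mul_inv_rev, gen_inv, List.length_cons]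
    by_cases h : Desc (wordProd a)⁻¹ i
    · have := len_mul_gen_of_desc i.2 h; omega
    · rw [len_mul_gen_of_not_desc i.2 h]; omega

/-- Stripping off descents one at a time gives a word with `len u` letters. -/
theorem exists_word (u : SignedPerm n) :
    ∃ a : List (Fin n), wordProd a = u⁻¹ ∧ a.length = u.len := by
  induction hL : u.len generalizing u with
  | zero =>
    refine ⟨[], ?_, rfl⟩
    rw [eq_one_of_forall_not_desc (u := u)]
    · simp [wordProd]
    · intro i hi h
      have := len_mul_gen_of_desc hi h
      omega
  | succ L ih =>
    obtain ⟨i, hi, h⟩ : ∃ i < n, Desc u i := by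
      by_contra! h
      rw [eq_one_of_forall_not_desc h, len_one] at hL
      omega
    have h1 := len_mul_gen_of_desc hi h
    obtain ⟨a, ha, hal⟩ := ih (u * gen n i) (by omega)
    refine ⟨⟨i, hi⟩ :: a, ?_, by rw [List.length_cons, hal]⟩
    rw [wordProd_cons, ha, mul_inv_rev, ← mul_assoc, mul_inv_cancel, one_mul]

/-- The length function counts the letters of reduced words of `w`, taken on `w⁻¹` because
`Desc` refers to right descents while words are read from the left. -/
theorem IsReducedWord.length_eq {a : List (Fin n)} {w : SignedPerm n} (h : IsReducedWord a w) :
    a.length = w⁻¹.len := by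
  obtain ⟨b, hb, hbl⟩ := exists_word w⁻¹
  rw [inv_inv] at hb
  have h1 := h.2 b hb
  have h2 := len_inv_wordProd_le a
  rw [h.1] at h2
  omega

end SignedPerm

/-! ### Independence of the reduced word -/

section Matsumoto

open SignedPerm MvPolynomial

variable {n : ℕ} {A : Type*} [CommRing A]

theorem wordOp_append (a b : List (Fin n)) (f : MvPolynomial (Fin n) A) :
    wordOp (a ++ b) f = wordOp a (wordOp b f) := List.foldr_append ..

theorem wordOp_nil (f : MvPolynomial (Fin n) A) : wordOp ([] : List (Fin n)) f = f := rfl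

theorem wordProd_nil : wordProd ([] : List (Fin n)) = 1 := rfl

variable (A) in
/-- Two different descents of `u` are the initial letters of the two sides of a braid relation that
begins reduced words of `u⁻¹`. -/
def BraidAt (u : SignedPerm n) (i j : Fin n) : Prop :=
  ∃ (p q : List (Fin n)) (v : SignedPerm n), wordProd (i :: p) = wordProd (j :: q) ∧
    p.length = q.length ∧ u⁻¹ = wordProd (i :: p) * v⁻¹ ∧ u.len = p.length + 1 + v.len ∧
    ∀ f : MvPolynomial (Fin n) A, wordOp (i :: p) f = wordOp (j :: q) f

theorem BraidAt.symm {u : SignedPerm n} {i j : Fin n} (h : BraidAt A u i j) : BraidAt A u j i := by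
  obtain ⟨p, q, v, h1, h2, h3, h4, h5⟩ := h
  exact ⟨q, p, v, h1.symm, h2.symm, h1 ▸ h3, h2 ▸ h4, fun f => (h5 f).symm⟩

variable [IsDomain A] [CharZero A]

theorem wordOp_cons (i : Fin n) (a : List (Fin n)) (f : MvPolynomial (Fin n) A) :
    wordOp (i :: a) f = ddiff n A i (wordOp a f) := by
  rw [ddiff_eq i.2]; rfl

theorem braidAt_of_lt {u : SignedPerm n} {i j : Fin n} (hij : (i : ℕ) < j) (hi : Desc u i)
    (hj : Desc u j) : BraidAt A u i j := by
  have e1 := len_mul_gen_of_desc i.2 hi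
  have hn : (i : ℕ) + 1 < n := by have := j.2; omega
  rcases Nat.lt_or_ge ((i : ℕ) + 1) j with h | h
  · have hd : Desc (u * gen n i) j := by
      obtain ⟨j', hj'⟩ : ∃ k, (j : ℕ) = k + 1 := ⟨j - 1, by omega⟩
      rw [hj'] at hj h ⊢
      simp only [Desc, Nat.add_one_ne_zero, if_false, Nat.add_sub_cancel] at hj ⊢
      rcases hi0 : (i : ℕ) with _ | i'
      · rw [entry_mul_gen_zero (by omega), entry_mul_gen_zero (by omega), if_neg (by omega),
          if_neg (by omega)]
        exact hj
      · rw [entry_mul_gen_succ (by omega), entry_mul_gen_succ (by omega), if_neg (by omega),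
          if_neg (by omega), if_neg (by omega), if_neg (by omega)]
        exact hj
    have e2 := len_mul_gen_of_desc j.2 hd
    refine ⟨[j], [i], u * gen n i * gen n j, ?_, rfl, ?_, ?_, ?_⟩
    · simp only [wordProd_cons, wordProd_nil, mul_one]
      exact gen_comm h j.2
    · simp only [wordProd_cons, wordProd_nil, mul_one, mul_inv_rev, gen_inv]
      rw [mul_assoc, ← mul_assoc (gen n j), gen_mul_self, one_mul, ← mul_assoc, gen_mul_self,
        one_mul]
    · simp only [List.length_cons, List.length_nil]; omega
    · intro f
      simp only [wordOp_cons, wordOp_nil, ← Module.End.mul_apply]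
      rw [(ddiff_comm (Or.inl h)).eq]
  · have hj1 : (j : ℕ) = i + 1 := by omega
    rcases hi0 : (i : ℕ) with _ | i'
    · have hn1 : 1 < n := by omega
      have hj2 : (j : ℕ) = 1 := by omega
      have a0 : ∀ w : SignedPerm n, (w * gen n 0).entry 0 = -w.entry 0 := fun w => by
        rw [entry_mul_gen_zero (by omega), if_pos rfl]
      have a1 : ∀ w : SignedPerm n, (w * gen n 0).entry 1 = w.entry 1 := fun w => by
        rw [entry_mul_gen_zero (by omega), if_neg (by omega)]
      have b0 : ∀ w : SignedPerm n, (w * gen n 1).entry 0 = w.entry 1 := fun w => by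
        rw [entry_mul_gen_succ (i := 0) hn1, if_pos rfl]
      have b1 : ∀ w : SignedPerm n, (w * gen n 1).entry 1 = w.entry 0 := fun w => by
        rw [entry_mul_gen_succ (i := 0) hn1, if_neg (by omega), if_pos rfl]
      rw [hi0] at hi e1
      rw [hj2] at hj
      have c0 : ∀ w : SignedPerm n, Desc w 0 ↔ w.entry 0 < 0 := fun w => by simp [Desc]
      have c1 : ∀ w : SignedPerm n, Desc w 1 ↔ w.entry 1 < w.entry 0 := fun w => by simp [Desc]
      rw [c0] at hi
      rw [c1] at hj
      have e2 := len_mul_gen_of_desc (u := u * gen n 0) hn1 (by rw [c1, a1, a0]; omega)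
      have e3 := len_mul_gen_of_desc (u := u * gen n 0 * gen n 1) (i := 0) (by omega)
        (by rw [c0, b0, a1]; omega)
      have e4 := len_mul_gen_of_desc (u := u * gen n 0 * gen n 1 * gen n 0) hn1
        (by rw [c1, a1, a0, b1, b0, a1, a0]; omega)
      refine ⟨[j, i, j], [i, j, i], u * gen n 0 * gen n 1 * gen n 0 * gen n 1, ?_, rfl, ?_, ?_, ?_⟩
      · simp only [wordProd_cons, wordProd_nil, mul_one, hi0, hj2]
        have := gen_braid_four hn1
        simpa only [mul_assoc] using this
      · simp only [wordProd_cons, wordProd_nil, mul_one, mul_inv_rev, gen_inv, hi0, hj2]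
        have c : ∀ (k : ℕ) (w : SignedPerm n), gen n k * (gen n k * w) = w := fun k w => by
          rw [← mul_assoc, gen_mul_self, one_mul]
        simp only [mul_assoc, c]
      · simp only [List.length_cons, List.length_nil]; omega
      · intro f
        simp only [wordOp_cons, wordOp_nil, hi0, hj2]
        have := LinearMap.congr_fun (ddiff_braid_four (n := n) (A := A)) f
        simpa only [Module.End.mul_apply] using this
    · rw [hi0] at hi e1 hn hj1
      rw [hj1] at hj
      have hi1 : i' + 1 < n := by omega
      have a0 : ∀ w : SignedPerm n, (w * gen n (i' + 1)).entry i' = w.entry (i' + 1) := fun w => by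
        rw [entry_mul_gen_succ hi1, if_pos rfl]
      have a1 : ∀ w : SignedPerm n, (w * gen n (i' + 1)).entry (i' + 1) = w.entry i' := fun w => by
        rw [entry_mul_gen_succ hi1, if_neg (by omega), if_pos rfl]
      have a2 : ∀ w : SignedPerm n, (w * gen n (i' + 1)).entry (i' + 1 + 1) =
          w.entry (i' + 1 + 1) := fun w => by
        rw [entry_mul_gen_succ hi1, if_neg (by omega), if_neg (by omega)]
      have b0 : ∀ w : SignedPerm n, (w * gen n (i' + 1 + 1)).entry i' = w.entry i' := fun w => by
        rw [entry_mul_gen_succ hn, if_neg (by omega), if_neg (by omega)]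
      have b1 : ∀ w : SignedPerm n, (w * gen n (i' + 1 + 1)).entry (i' + 1) =
          w.entry (i' + 1 + 1) := fun w => by
        rw [entry_mul_gen_succ hn, if_pos rfl]
      have c1 : ∀ w : SignedPerm n, Desc w (i' + 1) ↔ w.entry (i' + 1) < w.entry i' :=
        fun w => by simp [Desc]
      have c2 : ∀ w : SignedPerm n, Desc w (i' + 1 + 1) ↔
          w.entry (i' + 1 + 1) < w.entry (i' + 1) := fun w => by simp [Desc]
      rw [c1] at hi
      rw [c2] at hj
      have e2 := len_mul_gen_of_desc (u := u * gen n (i' + 1)) hn (by rw [c2, a1, a2]; omega)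
      have e3 := len_mul_gen_of_desc (u := u * gen n (i' + 1) * gen n (i' + 1 + 1)) hi1
        (by rw [c1, b0, b1, a0, a2]; omega)
      refine ⟨[j, i], [i, j], u * gen n (i' + 1) * gen n (i' + 1 + 1) * gen n (i' + 1),
        ?_, rfl, ?_, ?_, ?_⟩
      · simp only [wordProd_cons, wordProd_nil, mul_one, hi0, hj1]
        have := gen_braid_three (n := n) (i := i' + 1) (by omega) hn
        simpa only [mul_assoc] using this
      · simp only [wordProd_cons, wordProd_nil, mul_one, mul_inv_rev, gen_inv, hi0, hj1]
        have c : ∀ (k : ℕ) (w : SignedPerm n), gen n k * (gen n k * w) = w := fun k w => by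
          rw [← mul_assoc, gen_mul_self, one_mul]
        simp only [mul_assoc, c]
      · simp only [List.length_cons, List.length_nil]; omega
      · intro f
        simp only [wordOp_cons, wordOp_nil, hi0, hj1]
        have := LinearMap.congr_fun (ddiff_braid_three (n := n) (A := A) (i := i' + 1) (by omega)) f
        simpa only [Module.End.mul_apply] using this

/-- Matsumoto's theorem: two reduced words of the same element give the same operator. -/
theorem wordOp_eq_of_wordProd_eq {u : SignedPerm n} {a b : List (Fin n)} (ha : wordProd a = u⁻¹)
    (hb : wordProd b = u⁻¹) (hal : a.length = u.len) (hbl : b.length = u.len)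
    (f : MvPolynomial (Fin n) A) : wordOp a f = wordOp b f := by
  induction hL : u.len generalizing u a b with
  | zero =>
    rw [List.eq_nil_of_length_eq_zero (hal.trans hL), List.eq_nil_of_length_eq_zero (hbl.trans hL)]
  | succ L ih =>
    rcases a with _ | ⟨i, a⟩
    · simp [hL] at hal
    rcases b with _ | ⟨j, b⟩
    · simp [hL] at hbl
    rw [List.length_cons] at hal hbl
    have hdesc : ∀ (k : Fin n) (c : List (Fin n)), wordProd (k :: c) = u⁻¹ → c.length + 1 = u.len →
        wordProd c = (u * gen n k)⁻¹ ∧ Desc u k := by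
      intro k c hc hcl
      have e : wordProd c = (u * gen n k)⁻¹ := by
        rw [mul_inv_rev, ← hc, wordProd_cons, gen_inv, ← mul_assoc, gen_mul_self, one_mul]
      refine ⟨e, ?_⟩
      by_contra h
      have h1 := len_mul_gen_of_not_desc k.2 h
      have h2 := len_inv_wordProd_le c
      rw [e, inv_inv] at h2
      omega
    obtain ⟨ha', hi⟩ := hdesc i a ha hal
    obtain ⟨hb', hj⟩ := hdesc j b hb hbl
    have li := len_mul_gen_of_desc i.2 hi
    have lj := len_mul_gen_of_desc j.2 hj
    by_cases hij : i = j
    · subst hij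
      rw [wordOp_cons, wordOp_cons, ih ha' hb' (by omega) (by omega) (by omega)]
    · have hbr : BraidAt A u i j := by
        rcases lt_or_gt_of_ne (fun h => hij (Fin.ext h) : (i : ℕ) ≠ j) with h | h
        · exact braidAt_of_lt h hi hj
        · exact (braidAt_of_lt h hj hi).symm
      obtain ⟨p, q, v, h1, h2, h3, h4, h5⟩ := hbr
      obtain ⟨c, hc, hcl⟩ := exists_word v
      have hp : wordProd (i :: (p ++ c)) = u⁻¹ := by
        rw [← List.cons_append, wordProd_append, hc, h3]
      have hq : wordProd (j :: (q ++ c)) = u⁻¹ := by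
        rw [← List.cons_append, wordProd_append, hc, h3, h1]
      have hpl : (p ++ c).length + 1 = u.len := by rw [List.length_append]; omega
      have hql : (q ++ c).length + 1 = u.len := by rw [List.length_append]; omega
      -- By induction both words may be replaced by ones that begin with the sides of a braid
      -- relation.
      have e1 := ih ha' (hdesc i _ hp hpl).1 (by omega) (by omega) (by omega)
      have e2 := ih hb' (hdesc j _ hq hql).1 (by omega) (by omega) (by omega)
      rw [wordOp_cons, wordOp_cons, e1, e2, ← wordOp_cons, ← wordOp_cons, ← List.cons_append,
        ← List.cons_append, wordOp_append, wordOp_append, h5]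

theorem weylOp_eq_wordOp {w : SignedPerm n} {a : List (Fin n)} (ha : wordProd a = w)
    (hal : a.length = w⁻¹.len) (f : MvPolynomial (Fin n) A) : weylOp w f = wordOp a f := by
  have h := Classical.choose_spec (exists_isReducedWord w)
  refine wordOp_eq_of_wordProd_eq (u := w⁻¹) ?_ ?_ h.length_eq hal f
  · rw [inv_inv]; exact h.1
  · rw [inv_inv]; exact ha

end Matsumoto

end DoubleSchubert

namespace DoubleSchubert

open MvPolynomial SignedPerm

/-! ### A reduced word -/

section ReducedWord

variable (n : ℕ)

/-- The product `s_{a+l-1} ⋯ s_{a+1} s_a`. -/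
def chainElt (a : ℕ) : ℕ → SignedPerm n
  | 0 => 1
  | l + 1 => gen n (a + l) * chainElt a l

theorem chainElt_succ' (a l : ℕ) :
    chainElt n a (l + 1) = chainElt n (a + 1) l * gen n a := by
  induction l with
  | zero => simp [chainElt]
  | succ l ih =>
    rw [chainElt, ih, chainElt, mul_assoc, add_right_comm, add_assoc]

theorem img_chainElt {a l : ℕ} (h : a + l < n) (j : ℕ) : (chainElt n (a + 1) l).img j =
    if j = a then a + l else if a < j ∧ j ≤ a + l then j - 1 else j := by
  induction l with
  | zero =>
    rw [chainElt, img_one]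
    split_ifs <;> omega
  | succ l ih =>
    rw [chainElt, img_mul, ih (by omega), add_right_comm, img_gen_succ (by omega)]
    split_ifs <;> omega

theorem sgn_chainElt {a l : ℕ} (h : a + l < n) (j : ℕ) : (chainElt n (a + 1) l).sgn j = 1 := by
  induction l with
  | zero => rw [chainElt, sgn_one]
  | succ l ih =>
    rw [chainElt, sgn_mul, ih (by omega), add_right_comm, sgn_gen_succ (by omega), one_mul]

theorem img_chainElt_zero (hn : 0 < n) (j : ℕ) : (chainElt n 0 n).img j =
    if j = 0 then n - 1 else if j < n then j - 1 else j := by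
  obtain ⟨m, rfl⟩ : ∃ m, n = m + 1 := ⟨n - 1, by omega⟩
  rw [chainElt_succ', img_mul, img_gen_zero, img_chainElt _ (by omega)]
  split_ifs <;> omega

theorem sgn_chainElt_zero (hn : 0 < n) (j : ℕ) : (chainElt n 0 n).sgn j =
    if j = 0 then -1 else 1 := by
  obtain ⟨m, rfl⟩ : ∃ m, n = m + 1 := ⟨n - 1, by omega⟩
  rw [chainElt_succ', sgn_mul, img_gen_zero, sgn_chainElt _ (by omega), sgn_gen_zero hn, mul_one]

theorem img_chainElt_pow {k j : ℕ} (hk : k ≤ n) (hj : j < n) : (chainElt n 0 n ^ k).img j =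
    if j < k then n - k + j else j - k := by
  induction k with
  | zero => rw [pow_zero, img_one]; simp
  | succ k ih =>
    rw [pow_succ', img_mul, ih (by omega), img_chainElt_zero n (by omega)]
    split_ifs <;> omega

theorem sgn_chainElt_pow {k j : ℕ} (hk : k ≤ n) (hj : j < n) : (chainElt n 0 n ^ k).sgn j =
    if j < k then -1 else 1 := by
  induction k with
  | zero => rw [pow_zero, sgn_one]; simp
  | succ k ih =>
    rw [pow_succ', sgn_mul, ih (by omega), img_chainElt_pow n (by omega) hj,
      sgn_chainElt_zero n (by omega)]
    split_ifs <;> first | rfl | omega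

/-- The inverse of the permutation `(μ_k, …, μ_1, λ_1, …, λ_ℓ)`, `μ = λ'`, built up by running
through the parts of `λ` that are at most `p`. -/
def sortElt (lam : Finset ℕ) : ℕ → SignedPerm n
  | 0 => 1
  | p + 1 => if p + 1 ∈ lam then chainElt n (coCount lam p + 1) (n - (p + 1)) * sortElt lam p
      else sortElt lam p

theorem coCount_mono (lam : Finset ℕ) {j p : ℕ} (h : j ≤ p) : coCount lam j ≤ coCount lam p :=
  Finset.card_le_card (Finset.sdiff_subset_sdiff (Finset.Icc_subset_Icc_right h) le_rfl)

theorem coCount_le_add (lam : Finset ℕ) {j p : ℕ} (h : j ≤ p) :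
    coCount lam p ≤ coCount lam j + (p - j) := by
  induction p, h using Nat.le_induction with
  | base => omega
  | succ p hp ih =>
    rw [coCount_succ]
    split_ifs <;> omega

theorem coCount_of_mem {lam : Finset ℕ} {j p : ℕ} (h : j < p) (hj : j + 1 ∈ lam) :
    coCount lam p + 1 ≤ coCount lam j + (p - j) := by
  have h1 := coCount_le_add lam (show j + 1 ≤ p from h)
  rw [coCount_succ, if_pos hj] at h1
  omega

theorem coCount_of_notMem {lam : Finset ℕ} {j p : ℕ} (h : j < p) (hj : j + 1 ∉ lam) :
    coCount lam j + 1 ≤ coCount lam p := by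
  have h1 := coCount_mono lam (show j + 1 ≤ p from h)
  rwa [coCount_succ, if_neg hj] at h1

theorem img_sortElt (lam : Finset ℕ) {p j : ℕ} (hp : p ≤ n) (hj : j < n) :
    (sortElt n lam p).img j = if j < p then
      (if j + 1 ∈ lam then n - 1 - j + coCount lam j else coCount lam j)
      else coCount lam p + (j - p) := by
  induction p with
  | zero =>
    rw [sortElt, img_one, if_neg (Nat.not_lt_zero _)]
    have := coCount_le lam 0
    omega
  | succ p ih =>
    have hc := coCount_le lam p
    rw [sortElt, coCount_succ]
    by_cases hpl : p + 1 ∈ lam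
    · rw [if_pos hpl, if_pos hpl, img_mul, ih (by omega), img_chainElt n (by omega)]
      rcases lt_trichotomy j p with h | rfl | h
      · by_cases hjl : j + 1 ∈ lam
        · have := coCount_of_mem h hjl
          simp only [hjl, h, if_true, if_pos (show j < p + 1 by omega)]
          split_ifs <;> omega
        · have := coCount_of_notMem h hjl
          simp only [hjl, h, if_true, if_false, if_pos (show j < p + 1 by omega)]
          split_ifs <;> omega
      · rw [if_neg (show ¬ j < j by omega), if_pos (show j < j + 1 by omega), if_pos hpl]
        split_ifs <;> omega
      · rw [if_neg (show ¬ j < p by omega), if_neg (show ¬ j < p + 1 by omega)]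
        split_ifs <;> omega
    · rw [if_neg hpl, if_neg hpl, ih (by omega)]
      rcases lt_trichotomy j p with h | rfl | h
      · rw [if_pos h, if_pos (show j < p + 1 by omega)]
      · rw [if_neg (show ¬ j < j by omega), if_pos (show j < j + 1 by omega), if_neg hpl]
        omega
      · rw [if_neg (show ¬ j < p by omega), if_neg (show ¬ j < p + 1 by omega)]
        omega

theorem sgn_sortElt (lam : Finset ℕ) {p : ℕ} (hp : p ≤ n) (j : ℕ) :
    (sortElt n lam p).sgn j = 1 := by
  induction p with
  | zero => rw [sortElt, sgn_one]
  | succ p ih =>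
    have hc := coCount_le lam p
    rw [sortElt]
    split_ifs
    · rw [sgn_mul, ih (by omega), sgn_chainElt n (by omega), one_mul]
    · exact ih (by omega)

/-- The element `w_λ⁻¹ w_0` as a product of generators. -/
def grassProd (lam : Finset ℕ) : SignedPerm n :=
  chainElt n 0 n ^ coCount lam n * sortElt n lam n

theorem img_grassProd (lam : Finset ℕ) {j : ℕ} (hj : j < n) : (grassProd n lam).img j =
    if j + 1 ∈ lam then n - 1 - j + coCount lam j - coCount lam n
      else n - coCount lam n + coCount lam j := by
  have hk := coCount_le lam n
  have hj' := img_lt (sortElt n lam n) hj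
  rw [grassProd, img_mul, img_chainElt_pow n hk hj', img_sortElt n lam le_rfl hj, if_pos hj]
  split_ifs with h1 h2 h2
  · have := coCount_of_mem hj h1; omega
  · rfl
  · rfl
  · have := coCount_of_notMem hj h1; omega

theorem sgn_grassProd (lam : Finset ℕ) {j : ℕ} (hj : j < n) : (grassProd n lam).sgn j =
    if j + 1 ∈ lam then 1 else -1 := by
  have hk := coCount_le lam n
  have hj' := img_lt (sortElt n lam n) hj
  rw [grassProd, sgn_mul, sgn_sortElt n lam le_rfl, one_mul, sgn_chainElt_pow n hk hj',
    img_sortElt n lam le_rfl hj, if_pos hj]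
  split_ifs with h1 h2 h2
  · have := coCount_of_mem hj h1; omega
  · rfl
  · rfl
  · have := coCount_of_notMem hj h1; omega

variable {n}

theorem sort_insert_min {S : Finset ℕ} {a : ℕ} (ha : ∀ b ∈ S, a < b) :
    (insert a S).sort (· ≤ ·) = a :: S.sort (· ≤ ·) :=
  Finset.sort_insert _ (fun b hb => (ha b hb).le) fun h => lt_irrefl _ (ha a h)

theorem sort_getD_numLT {S : Finset ℕ} {b : ℕ} (hb : b ∈ S) :
    (S.sort (· ≤ ·)).getD (numLT S b) 0 = b := by
  induction S using Finset.induction_on_min with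
  | empty => simp at hb
  | insert a S ha ih =>
    have ha' : a ∉ S := fun h => lt_irrefl _ (ha a h)
    rw [sort_insert_min ha]
    rcases Finset.mem_insert.mp hb with rfl | hb
    · rw [numLT_insert_max le_rfl, numLT, Finset.filter_false_of_mem fun c hc => (ha c hc).not_gt]
      rfl
    · rw [numLT, Finset.filter_insert, if_pos (ha b hb),
        Finset.card_insert_of_notMem (by simp [ha'])]
      exact ih hb

theorem coCount_eq_numLT {lam : Finset ℕ} {j : ℕ} (hj : j < n) :
    coCount lam j = numLT (dual n lam) (j + 1) := by
  rw [coCount, numLT, dual]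
  congr 1
  ext c
  simp only [Finset.mem_sdiff, Finset.mem_filter, Finset.mem_Icc]
  constructor
  · rintro ⟨h1, h2⟩; exact ⟨⟨⟨h1.1, by omega⟩, h2⟩, by omega⟩
  · rintro ⟨⟨h1, h2⟩, h3⟩; exact ⟨⟨h1.1, by omega⟩, h2⟩

theorem numLT_add_coCount {lam : Finset ℕ} (hlam : lam ∈ strictPartitions n) (j : ℕ) :
    numLT lam (j + 1) + coCount lam j = j := by
  have h' : lam ⊆ Finset.Icc 1 n := Finset.mem_powerset.mp hlam
  rw [numLT, coCount, ← Finset.card_union_of_disjoint]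
  · conv_rhs => rw [← Nat.add_sub_cancel j 1, ← Nat.card_Icc 1 j]
    congr 1
    ext c
    simp only [Finset.mem_union, Finset.mem_sdiff, Finset.mem_filter, Finset.mem_Icc]
    constructor
    · rintro (⟨h1, h2⟩ | ⟨h1, h2⟩)
      · have := Finset.mem_Icc.mp (h' h1); omega
      · exact h1
    · intro h1
      by_cases h : c ∈ lam
      · exact Or.inl ⟨h, by omega⟩
      · exact Or.inr ⟨h1, h⟩
  · rw [Finset.disjoint_left]
    intro c h1 h2
    exact (Finset.mem_sdiff.mp h2).2 (Finset.mem_filter.mp h1).1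

theorem card_add_coCount {lam : Finset ℕ} (hlam : lam ∈ strictPartitions n) :
    lam.card + coCount lam n = n := by
  have h' : lam ⊆ Finset.Icc 1 n := Finset.mem_powerset.mp hlam
  have h1 := numLT_add_coCount hlam n
  rwa [numLT, Finset.filter_true_of_mem] at h1
  intro c hc
  have := Finset.mem_Icc.mp (h' hc)
  omega

/-- Both sides are compared letter by letter: up to sign, `w_λ⁻¹ w_0` sends `j` to the place of `j` in
the word `(λ_1, …, λ_ℓ, μ_k, …, μ_1)`. -/
theorem grassElt_mul_grassProd {lam : Finset ℕ} (hlam : lam ∈ strictPartitions n) :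
    grassElt lam hlam * grassProd n lam = longest n := by
  have hcard := card_add_coCount hlam
  have himg : ∀ i (hi : i < n), (grassElt lam hlam).img i =
      (grassWord n lam)[i]'(by rw [grassWord_length hlam]; exact hi) - 1 := by
    intro i hi
    rw [img_of_lt _ hi]
    rfl
  have hsgn : ∀ i < n, (grassElt lam hlam).sgn i = if i < lam.card then -1 else 1 := by
    intro i hi
    rw [sgn_of_lt _ hi]
    rfl
  have hword : ∀ j (hj : j < n), (grassProd n lam).img j < n ∧
      ((grassProd n lam).img j < lam.card ↔ j + 1 ∈ lam) ∧
      ∀ h, (grassWord n lam)[(grassProd n lam).img j]'h = j + 1 := by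
    intro j hj
    refine ⟨img_lt _ hj, ?_, ?_⟩
    · rw [img_grassProd n lam hj]
      split_ifs with h
      · have := coCount_of_mem hj h
        simp only [h, iff_true]
        have := coCount_le lam j
        have := coCount_mono lam hj.le
        omega
      · simp only [h, iff_false]; omega
    · intro h
      have e := img_grassProd n lam hj
      by_cases hjl : j + 1 ∈ lam
      · rw [if_pos hjl] at e
        have h1 := numLT_add_coCount hlam j
        have h2 := numLT_add_numGT hjl
        have h3 := coCount_of_mem hj hjl
        have h4 : (grassProd n lam).img j = numGT lam (j + 1) := by omega
        have h5 := numGT_lt_card hjl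
        have h6 := part_numGT hjl
        rw [part, List.getD_eq_getElem _ _ (by rwa [Finset.length_sort])] at h6
        simp only [grassWord, h4]
        rw [List.getElem_append_left (by rwa [Finset.length_sort])]
        exact h6
      · rw [if_neg hjl] at e
        have hjd : j + 1 ∈ dual n lam := by
          rw [dual, Finset.mem_sdiff, Finset.mem_Icc]; exact ⟨by omega, hjl⟩
        have h1 := sort_getD_numLT hjd
        rw [← coCount_eq_numLT hj, List.getD_eq_getElem _ _ (by
          rw [Finset.length_sort, coCount_eq_numLT hj]
          have := numLT_add_numGT hjd
          omega)] at h1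
        simp only [grassWord, e]
        rw [List.getElem_append_right (by rw [Finset.length_sort]; omega)]
        conv_rhs => rw [← h1]
        congr 1
        rw [Finset.length_sort]
        omega
  refine ext_img (fun j hj => ?_) fun j hj => ?_
  · obtain ⟨h1, -, h3⟩ := hword j hj
    rw [img_mul, himg _ h1, h3, img_of_lt _ hj]
    rfl
  · obtain ⟨h1, h2, -⟩ := hword j hj
    rw [sgn_mul, hsgn _ h1, sgn_grassProd n lam hj, sgn_of_lt _ hj]
    simp only [h2, longest]
    split_ifs <;> rfl

/-- In one-line notation the inverse of `w_λ⁻¹ w_0` is `(λ_1, …, λ_ℓ, -μ_k, …, -μ_1)`, `μ = λ'`,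
which is decreasing. -/
theorem len_inv_grassProd {lam : Finset ℕ} (hlam : lam ∈ strictPartitions n) :
    (grassProd n lam)⁻¹.len = n * (n - 1) / 2 + weight (dual n lam) := by
  have hcard := card_add_coCount hlam
  set V := grassProd n lam with hV
  have hs : ∀ j < n, (V⁻¹).sgn (V.img j) = V.sgn j := by
    intro j _
    have h := sgn_mul V⁻¹ V j
    rw [inv_mul_cancel, sgn_one] at h
    rcases Int.units_eq_one_or (V.sgn j) with h1 | h1 <;>
      rcases Int.units_eq_one_or ((V⁻¹).sgn (V.img j)) with h2 | h2 <;> rw [h1, h2] at h ⊢ <;>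
      simp at h
  have hi : ∀ j, (V⁻¹).img (V.img j) = j := fun j => by
    rw [← img_mul, inv_mul_cancel, img_one]
  have hsurj : ∀ a < n, ∃ j < n, V.img j = a := fun a ha =>
    ⟨(V⁻¹).img a, img_lt _ ha, by rw [← img_mul, mul_inv_cancel, img_one]⟩
  -- A decreasing sequence has all `n (n - 1) / 2` inversions.
  have hdec : ∀ a < n, ∀ b < n, a < b → (V⁻¹).entry b < (V⁻¹).entry a := by
    intro a ha b hb hab
    obtain ⟨j, hj, rfl⟩ := hsurj a ha
    obtain ⟨j', hj', rfl⟩ := hsurj b hb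
    rw [entry, entry, hs j hj, hs j' hj', hi, hi, hV, sgn_grassProd n lam hj,
      sgn_grassProd n lam hj']
    rw [hV, img_grassProd n lam hj, img_grassProd n lam hj'] at hab
    by_cases h1 : j + 1 ∈ lam
    · have e1 := coCount_of_mem hj h1
      by_cases h2 : j' + 1 ∈ lam
      · have e2 := coCount_of_mem hj' h2
        simp only [h1, h2, if_true, Units.val_one] at hab ⊢
        rcases Nat.lt_or_ge j j' with h | h
        · have e3 := coCount_of_mem h h1; omega
        · rcases Nat.eq_or_lt_of_le h with rfl | h
          · omega
          · omega
      · simp only [h1, h2, if_true, if_false, Units.val_one, Units.val_neg]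
        omega
    · by_cases h2 : j' + 1 ∈ lam
      · have e2 := coCount_of_mem hj' h2
        simp only [h1, h2, if_true, if_false] at hab
        have := coCount_le lam j'
        omega
      · simp only [h1, h2, if_false, Units.val_one, Units.val_neg] at hab ⊢
        rcases Nat.lt_or_ge j' j with h | h
        · have := coCount_mono lam h.le; omega
        · rcases Nat.eq_or_lt_of_le h with rfl | h
          · omega
          · omega
  rw [len]
  congr 1
  · have e1 : ∀ a ∈ Finset.range n, ((Finset.range n).filter fun b =>
        a < b ∧ (V⁻¹).entry b < (V⁻¹).entry a).card = n - 1 - a := by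
      intro a ha
      rw [Finset.mem_range] at ha
      have : ((Finset.range n).filter fun b => a < b ∧ (V⁻¹).entry b < (V⁻¹).entry a) =
          Finset.Ioo a n := by
        ext b
        simp only [Finset.mem_filter, Finset.mem_range, Finset.mem_Ioo]
        constructor
        · rintro ⟨h1, h2, -⟩; exact ⟨h2, h1⟩
        · rintro ⟨h1, h2⟩; exact ⟨h2, h1, hdec a ha b h2 h1⟩
      rw [this, Nat.card_Ioo]
      omega
    rw [Finset.sum_congr rfl e1, Finset.sum_range_reflect (fun a => a) n, Finset.sum_range_id]
  · rw [← sum_range_image V]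
    have e1 : ∀ j ∈ Finset.range n, (if (V⁻¹).sgn (V.img j) = -1 then (V⁻¹).img (V.img j) + 1
        else 0) = if j + 1 ∈ lam then 0 else j + 1 := by
      intro j hj
      rw [Finset.mem_range] at hj
      rw [hs j hj, hi, hV, sgn_grassProd n lam hj]
      by_cases h : j + 1 ∈ lam
      · rw [if_pos h, if_pos h, if_neg (by decide)]
      · rw [if_neg h, if_neg h, if_pos rfl]
    rw [Finset.sum_congr rfl e1, weight, dual, Finset.sdiff_eq_filter, Finset.sum_filter,
      Finset.sum_congr rfl (fun q _ => (ite_not (q ∈ lam) q 0)),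
      Finset.range_eq_Ico, Finset.sum_Ico_add' (fun q => if q ∈ lam then 0 else q) 0 n 1]
    rfl

/-- The operator `E` is the composite of divided differences for a word of length `L` with
product `g`. -/
def Realizes (g : SignedPerm n) (L : ℕ)
    (E : Module.End (MvPolynomial (Fin n) ℤ) (PolyXY n)) : Prop :=
  ∃ a : List (Fin n), wordProd a = g ∧ a.length = L ∧ ∀ f, wordOp a f = E f

theorem realizes_one : Realizes (1 : SignedPerm n) 0 1 := ⟨[], rfl, rfl, fun _ => rfl⟩

theorem Realizes.mul {g g' : SignedPerm n} {L L' : ℕ}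
    {E E' : Module.End (MvPolynomial (Fin n) ℤ) (PolyXY n)} (h : Realizes g L E)
    (h' : Realizes g' L' E') : Realizes (g * g') (L + L') (E * E') := by
  obtain ⟨a, h1, h2, h3⟩ := h
  obtain ⟨b, h4, h5, h6⟩ := h'
  refine ⟨a ++ b, by rw [wordProd_append, h1, h4], by rw [List.length_append, h2, h5],
    fun f => ?_⟩
  rw [wordOp_append, h6, h3, Module.End.mul_apply]

theorem realizes_gen {i : ℕ} (hi : i < n) : Realizes (gen n i) 1 (ddiff n _ i) :=
  ⟨[⟨i, hi⟩], by rw [wordProd_cons, wordProd_nil, mul_one], rfl,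
    fun f => by rw [wordOp_cons, wordOp_nil]⟩

theorem realizes_chain {a l : ℕ} (h : a + l ≤ n) :
    Realizes (chainElt n a l) l (chain n _ a l) := by
  induction l with
  | zero => exact realizes_one
  | succ l ih =>
    rw [add_comm l 1]
    have := (realizes_gen (n := n) (i := a + l) (by omega)).mul (ih (by omega))
    rwa [← chain_succ, add_comm 1 l] at *

theorem Realizes.pow {g : SignedPerm n} {L : ℕ}
    {E : Module.End (MvPolynomial (Fin n) ℤ) (PolyXY n)} (h : Realizes g L E) (k : ℕ) :
    Realizes (g ^ k) (k * L) (E ^ k) := by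
  induction k with
  | zero => rw [Nat.zero_mul]; exact realizes_one
  | succ k ih =>
    rw [pow_succ, pow_succ, Nat.succ_mul]
    exact ih.mul h

theorem realizes_sortElt (lam : Finset ℕ) {p : ℕ} (hp : p ≤ n) :
    Realizes (sortElt n lam p) (∑ q ∈ Finset.Icc 1 p with q ∈ lam, (n - q)) (sortOp n lam p) := by
  induction p with
  | zero => exact realizes_one
  | succ p ih =>
    have h : Finset.Icc 1 (p + 1) = insert (p + 1) (Finset.Icc 1 p) := by
      ext c; simp only [Finset.mem_Icc, Finset.mem_insert]; omega
    have hc := coCount_le lam p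
    rw [h, Finset.filter_insert, sortElt, sortOp]
    split_ifs
    · rw [Finset.sum_insert (by simp)]
      exact (realizes_chain (by omega)).mul (ih (by omega))
    · exact ih (by omega)

theorem filter_mem_eq {lam : Finset ℕ} (hlam : lam ∈ strictPartitions n) :
    (Finset.Icc 1 n).filter (fun q => q ∈ lam) = lam := by
  rw [Finset.filter_mem_eq_inter]
  exact Finset.inter_eq_right.mpr (Finset.mem_powerset.mp hlam)

theorem sum_sub_add_weight {lam : Finset ℕ} (hlam : lam ∈ strictPartitions n) :
    ∑ q ∈ lam, (n - q) + weight lam = lam.card * n := by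
  rw [weight, ← Finset.sum_add_distrib, Finset.card_eq_sum_ones, Finset.sum_mul]
  refine Finset.sum_congr rfl fun q hq => ?_
  have := Finset.mem_Icc.mp (Finset.mem_powerset.mp hlam hq)
  omega

theorem weight_add_weight_dual {lam : Finset ℕ} (hlam : lam ∈ strictPartitions n) :
    weight lam + weight (dual n lam) = n * (n - 1) / 2 + n := by
  rw [add_comm, weight, weight, dual, Finset.sum_sdiff (Finset.mem_powerset.mp hlam)]
  have := Finset.sum_range_id (n + 1)
  rw [Nat.add_sub_cancel, Finset.sum_range_succ', add_zero] at this
  rw [show Finset.Icc 1 n = Finset.Ico (0 + 1) (n + 1) from rfl,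
    ← Finset.sum_Ico_add' (fun q => q) 0 n 1, ← Finset.range_eq_Ico, Finset.sum_add_distrib,
    Finset.sum_range_id]
  simp

/-- The word of `T^k ∘ S` has as many letters as `w_λ⁻¹ w_0` has length, so it is reduced. -/
theorem weylOp_grassElt {lam : Finset ℕ} (hlam : lam ∈ strictPartitions n) (f : PolyXY n) :
    weylOp ((grassElt lam hlam)⁻¹ * longest n) f =
      ((fullChain n (MvPolynomial (Fin n) ℤ)) ^ coCount lam n * sortOp n lam n :
        Module.End (MvPolynomial (Fin n) ℤ) (PolyXY n)) f := by
  have e : (grassElt lam hlam)⁻¹ * longest n = grassProd n lam := by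
    rw [← grassElt_mul_grassProd hlam, inv_mul_cancel_left]
  rw [e]
  obtain ⟨a, h1, h2, h3⟩ := ((realizes_chain (n := n) (a := 0) (l := n) (by omega)).pow
    (coCount lam n)).mul (realizes_sortElt lam le_rfl)
  rw [weylOp_eq_wordOp (w := grassProd n lam) (a := a) h1, h3]
  · rfl
  · rw [h2, len_inv_grassProd hlam, filter_mem_eq hlam]
    have e1 := sum_sub_add_weight hlam
    have e2 := weight_add_weight_dual hlam
    have e3 := card_add_coCount hlam
    have e4 : lam.card * n + coCount lam n * n = n * n := by rw [← add_mul, e3]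
    have e5 : n * (n - 1) / 2 * 2 = n * (n - 1) := by
      rw [← Finset.sum_range_id, Finset.sum_range_id_mul_two]
    have e6 : n * (n - 1) + n = n * n := by
      rcases n with _ | m
      · rfl
      · rw [Nat.add_sub_cancel]; ring
    omega

end ReducedWord

/-! ### The formula -/

section Formula

variable {n : ℕ}

theorem sum_range_le_weight {S : Finset ℕ} (h0 : 0 ∉ S) :
    ∑ i ∈ Finset.range S.card, (i + 1) ≤ weight S := by
  induction S using Finset.induction_on_max with
  | empty => simp
  | insert a S ha ih =>
    have ha' : a ∉ S := fun h => lt_irrefl _ (ha a h)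
    rw [Finset.mem_insert, not_or] at h0
    rw [Finset.card_insert_of_notMem ha', Finset.sum_range_succ, weight, Finset.sum_insert ha']
    have h1 : S ⊆ Finset.Ioo 0 a := fun b hb => Finset.mem_Ioo.mpr
      ⟨Nat.pos_of_ne_zero fun h => h0.2 (h ▸ hb), ha b hb⟩
    have h2 := Finset.card_le_card h1
    rw [Nat.card_Ioo] at h2
    have h3 := ih h0.2
    rw [weight] at h3
    omega

theorem neg_one_pow_congr_of_even_add {R : Type*} [CommRing R] {a b : ℕ} (h : Even (a + b)) :
    (-1 : R) ^ a = (-1) ^ b := by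
  rcases Nat.even_or_odd a with ha | ha
  · rw [ha.neg_one_pow, ((Nat.even_add.mp h).mp ha).neg_one_pow]
  · have hb : Odd b := by
      rw [← Nat.not_even_iff_odd] at ha ⊢
      exact fun hb => ha ((Nat.even_add.mp h).mpr hb)
    rw [ha.neg_one_pow, hb.neg_one_pow]

/-- The signs collected from `Δ(X, Y)` and from the determinant combine to `(-1)^{e(λ)}`. -/
theorem neg_one_pow_sign {R : Type*} [CommRing R] {lam : Finset ℕ}
    (hlam : lam ∈ strictPartitions n) :
    (-1 : R) ^ (n * (n - 1) / 2 + ∑ q ∈ lam, (n - q) +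
      coCount lam n * (coCount lam n - 1) / 2) = (-1) ^ excess lam := by
  have h0 : 0 ∉ lam := fun h => by
    have := Finset.mem_Icc.mp (Finset.mem_powerset.mp hlam h); omega
  have e1 := sum_sub_add_weight hlam
  have e2 := card_add_coCount hlam
  have e3 := sum_range_le_weight h0
  have e4 : ∀ m, m * (m - 1) / 2 * 2 + m = m * m := fun m => by
    rw [← Finset.sum_range_id, Finset.sum_range_id_mul_two]
    rcases m with _ | m
    · rfl
    · rw [Nat.add_sub_cancel]; ring
  have e5 : ∑ i ∈ Finset.range lam.card, (i + 1) = lam.card * (lam.card - 1) / 2 + lam.card := by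
    rw [Finset.sum_add_distrib, Finset.sum_range_id]; simp
  have e6 := e4 n
  have e7 := e4 lam.card
  have e8 := e4 (coCount lam n)
  have e9 : n * n = lam.card * lam.card + 2 * (lam.card * coCount lam n) +
      coCount lam n * coCount lam n := by
    conv_lhs => rw [← e2]
    ring
  have e10 : lam.card * n = lam.card * lam.card + lam.card * coCount lam n := by
    conv_lhs => rw [← e2]
    ring
  refine neg_one_pow_congr_of_even_add ?_
  rw [excess, e5]
  rw [e5] at e3
  generalize lam.card * coCount lam n = c at *
  generalize lam.card * lam.card = d at *
  generalize coCount lam n * coCount lam n = d' at *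
  generalize lam.card * n = d'' at *
  generalize n * n = d3 at *
  generalize n * (n - 1) / 2 = t at *
  generalize lam.card * (lam.card - 1) / 2 = t' at *
  generalize coCount lam n * (coCount lam n - 1) / 2 = t'' at *
  generalize ∑ q ∈ lam, (n - q) = s at *
  generalize weight lam = w at *
  exact ⟨t'' + c + t', by omega⟩

/-- The `β` that do not contain `μ` contribute `0`, since their determinants vanish. -/
theorem coeffIter_eq_sum (mu al : Finset ℕ)
    (g : Finset ℕ → MvPolynomial (Fin n) ℤ) :
    coeffIter n mu g al = (-1) ^ (weight mu + mu.card * (mu.card - 1) / 2) *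
      ∑ be ∈ (strictPartitions n).filter (fun be =>
        DiagramLE mu be ∧ be.card = mu.card ∧ Disjoint al be),
        (-1) ^ (intertwining al be + weight be) * g (al ∪ be) * schurDet n be mu := by
  rw [coeffIter]
  congr 1
  symm
  have hsub : (strictPartitions n).filter (fun be =>
      DiagramLE mu be ∧ be.card = mu.card ∧ Disjoint al be) ⊆
      (Finset.Icc 1 n \ al).powersetCard mu.card := by
    intro be hbe
    rw [Finset.mem_filter, strictPartitions, Finset.mem_powerset] at hbe
    rw [Finset.mem_powersetCard, Finset.subset_sdiff]
    exact ⟨⟨hbe.1, hbe.2.2.2.symm⟩, hbe.2.2.1⟩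
  rw [← Finset.sum_subset hsub]
  · refine Finset.sum_congr rfl fun be hbe => ?_
    rw [Finset.mem_filter] at hbe
    have h0 : 0 ∉ be := fun h => by
      have := Finset.mem_Icc.mp (Finset.mem_powerset.mp hbe.1 h); omega
    rw [intertwining_eq_sum hbe.2.2.2 h0, add_comm (weight be)]
    ring
  · intro be h1 h2
    rw [Finset.mem_powersetCard, Finset.subset_sdiff] at h1
    rw [schurDet_eq_zero, mul_zero, zero_mul]
    intro hle
    refine h2 (Finset.mem_filter.mpr ⟨?_, hle, h1.2, h1.1.2.symm⟩)
    rw [strictPartitions, Finset.mem_powerset]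
    exact h1.1.1

theorem qKernel_eq_qCombination :
    qKernel n = qCombination n fun al => qTilde n (dual n al) := by
  refine Finset.sum_congr rfl fun al hal => ?_
  have h0 : 0 ∉ al := fun h => by
    have := Finset.mem_Icc.mp (Finset.mem_powerset.mp hal h); omega
  rw [inX_qTilde n h0, mul_comm]
  rfl

end Formula

end DoubleSchubert

theorem theorem1p1 (n : ℕ) (lam : Finset ℕ) (hlam : lam ∈ strictPartitions n) :
    typeC (grassElt lam hlam) =
      (-1) ^ (excess lam + weight (dual n lam)) *
        ∑ al ∈ strictPartitions n, inX (qTilde n al) *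
          ∑ be ∈ (strictPartitions n).filter (fun be =>
              DiagramLE (dual n lam) be ∧ be.card = (dual n lam).card ∧ Disjoint al be),
            (-1) ^ (intertwining al be + weight be) *
              inY (qTilde n (dual n (al ∪ be))) *
              inY (schurDet n be (dual n lam)) := by
  have hk : coCount lam n = (dual n lam).card := rfl
  have e1 : ∀ f : PolyXY n, (fullChain n (MvPolynomial (Fin n) ℤ) ^ coCount lam n)
      ((-1) ^ (∑ q ∈ lam, (n - q)) * f) = (-1) ^ (∑ q ∈ lam, (n - q)) *
        (fullChain n (MvPolynomial (Fin n) ℤ) ^ coCount lam n) f := by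
    intro f
    rcases neg_one_pow_eq_or (PolyXY n) (∑ q ∈ lam, (n - q)) with h | h <;> rw [h] <;> simp
  rw [typeC, weylOp_grassElt hlam, Module.End.mul_apply, qKernel_eq_qCombination,
    sortOp_deltaXY n lam le_rfl, Nat.sub_self, staircase, mul_one, filter_mem_eq hlam, e1, hk,
    show Finset.Icc 1 n \ lam = dual n lam from rfl,
    fullChain_pow_factProd n (mu := dual n lam) Finset.sdiff_subset]
  have e2 := neg_one_pow_sign (R := PolyXY n) hlam
  rw [pow_add _ (excess lam), ← e2, hk, pow_add, pow_add, mul_assoc, mul_assoc, mul_assoc]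
  congr 2
  rw [qCombination, ← mul_assoc, ← pow_add, add_comm (_ / 2), Finset.mul_sum]
  refine Finset.sum_congr rfl fun al hal => ?_
  have h0 : 0 ∉ al := fun h => by
    have := Finset.mem_Icc.mp (Finset.mem_powerset.mp hal h); omega
  rw [coeffIter_eq_sum, inX_qTilde n h0]
  simp only [inY, map_mul, map_sum, map_pow, map_neg, map_one]
  ring
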